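/- Let $n\ge 2$ and $m\ge 0$ be integers and let $K=\prod_{i=1}^n[a_i,b_i]\subset\mathbb{R}^n$ with $a_i<b_i$ for all $i$. There exist a function $\chi\in C_c^\infty(\mathbb{R}^n;\mathbb{R})$ with $\operatorname{supp}\chi\subset K$ and a constant $\kappa>0$ (depending only on $n,m,\chi$) with the following property. Put $\chi_\alpha:=\frac{(-1)^{|\alpha|}}{\alpha!}\partial^\alpha\chi$ for $\alpha\in\mathbb{N}^n$. For every measurable, locally integrable vector field $u_0:\mathbb{R}^n\to\mathbb{R}^n$ with $\operatorname{div}u_0=0$ in the sense of distributions, there are families of real $n\times n$ matrices $A_\alpha(t)$ and $B_\alpha(t)$ (depending, for the given $n,m,\chi$, only on $\alpha$, $t$ and $u_0$) such that the forces $$f_m(x,t)=\sum_{|\alpha|\le m-1}A_\alpha(t)\chi_\alpha(x)\quad(f_0\equiv 0),\qquad f_{m+1}(x,t)=\sum_{|\alpha|\le m}B_\alpha(t)\chi_\alpha(x)$$ satisfy (i) and (ii) below. Here a mild solution on $[0,T]$ (or on $[0,\infty)$) of the Navier–Stokes equations $\partial_tu-\Delta u+(u\cdot\nabla)u+\nabla\pi=\operatorname{div}f$,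 $\operatorname{div}u=0$, $u(\cdot,0)=u_0$ is a measurable $u$, divergence-free in the sense of distributions at each time, with $u(\cdot,0)=u_0$ a.e. and $$u(t)=e^{t\Delta}u_0-\int_0^te^{(t-s)\Delta}\mathbb{P}\operatorname{div}(u\otimes u-f)(s)\,ds\qquad(t>0),$$ where $e^{t\Delta}$ is the heat semigroup, $\mathbb{P}$ is the orthogonal projection of $L^2(\mathbb{R}^n)^n$ onto divergence-free fields, $(\operatorname{div}f)_i=\sum_j\partial_jf_{j,i}$, the operators $e^{t\Delta}$ and $e^{t\Delta}\mathbb{P}\operatorname{div}$ act by convolution with their kernels, and all integrals converge absolutely. (i) Let $0<T<\infty$ and suppose $(\sqrt T+T^{(m+3)/2})\,\operatorname{ess\,sup}_x(1+|x|)^{n+1+m}|u_0(x)|\le\kappa$. Then there is a mild solution $u$ on $[0,T]$ with $f=f_m$ and $$\operatorname{ess\,sup}_{t\in[0,T]}|u(x,t)|=O(|x|^{-(n+1+m)})\quad\text{as }|x|\to\infty.$$ If in addition $u_0(x)=o(|x|^{-(n+1+m)})$ as $|x|\to\infty$, then there is a mild solution $u$ on $[0,T]$ with $f=f_{m+1}$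 and $$\operatorname{ess\,sup}_{t\in[0,T]}|u(x,t)|=o(|x|^{-(n+1+m)})\quad\text{as }|x|\to\infty.$$ (ii) Suppose $\operatorname{ess\,sup}_x(1+|x|)^{n+1+m}|u_0(x)|\le\kappa$, $\int(1+|x|)^{m+1}|u_0(x)|\,dx\le\kappa$, and $\int x^\alpha u_0(x)\,dx=0$ for all $\alpha\in\mathbb{N}^n$ with $|\alpha|\le m$. Then there is a mild solution $u$ on $[0,\infty)$ with $f=f_m$ and $$\operatorname{ess\,sup}_{t\ge0}|u(x,t)|=O(|x|^{-(n+1+m)})\ \text{ as }|x|\to\infty,\qquad \operatorname{ess\,sup}_{x}|u(x,t)|=O(t^{-(n+1+m)/2})\ \text{ as }t\to\infty,$$ and moreover $\|f_m(t)\|_{L^\infty(\mathbb{R}^n)}=O(t^{-(n+3+m)/2})$ as $t\to\infty$. -/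

import Mathlib

open MeasureTheory Set Filter
open scoped ENNReal FourierTransform ContDiff

/-- Euclidean space `ℝⁿ`. -/
abbrev E (n : ℕ) := EuclideanSpace ℝ (Fin n)

/-- The box `∏ᵢ [aᵢ, bᵢ]` in `ℝⁿ`. -/
def box {n : ℕ} (a b : Fin n → ℝ) : Set (E n) :=
  {x | ∀ i, a i ≤ x i ∧ x i ≤ b i}

/-! ### Multi-indices -/

/-- The monomial `x^α`. -/
def monomialAt {n : ℕ} (α : Fin n → ℕ) (x : E n) : ℝ := ∏ i, x i ^ α i

/-- The factorial `α!` of a multi-index. -/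
def multiFactorial {n : ℕ} (α : Fin n → ℕ) : ℕ := ∏ i, (α i).factorial

/-- The finite set of multi-indices `α ∈ ℕⁿ` with `|α| ≤ m - 1`, that is `|α| < m`
(empty for `m = 0`). -/
def multiIndicesBelow (n m : ℕ) : Finset (Fin n → ℕ) :=
  (Fintype.piFinset fun _ : Fin n => Finset.range m).filter fun α => ∑ i, α i < m

theorem mem_multiIndicesBelow {n m : ℕ} (α : Fin n → ℕ) :
    α ∈ multiIndicesBelow n m ↔ ∑ i, α i < m := by
  simp only [multiIndicesBelow, Finset.mem_filter, Fintype.mem_piFinset, Finset.mem_range,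
    and_iff_right_iff_imp]
  intro h i
  exact lt_of_le_of_lt (Finset.single_le_sum (fun j _ => Nat.zero_le (α j)) (Finset.mem_univ i)) h

/-- The partial derivative `∂ᵢ f`. -/
noncomputable def partialDeriv {n : ℕ} (i : Fin n) (f : E n → ℝ) : E n → ℝ :=
  fun x => fderiv ℝ f x (EuclideanSpace.single i 1)

/-- The derivative `∂^α f = ∂₁^{α₁} ⋯ ∂ₙ^{αₙ} f`. -/
noncomputable def multiDeriv {n : ℕ} (α : Fin n → ℕ) (f : E n → ℝ) : E n → ℝ :=
  (List.finRange n).foldr (fun i g => (partialDeriv i)^[α i] g) f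

/-! ### The force -/

/-- `χ_α = ((-1)^{|α|} / α!) ∂^α χ`. -/
noncomputable def controlProfile {n : ℕ} (χ : E n → ℝ) (α : Fin n → ℕ) (x : E n) : ℝ :=
  (-1) ^ (∑ i, α i) / (multiFactorial α : ℝ) * multiDeriv α χ x

/-- The matrix `f_m(x,t) = ∑_{|α| ≤ m - 1} A_α(t) χ_α(x)` (so `f_0 = 0`). -/
noncomputable def controlForce {n : ℕ} (m : ℕ) (χ : E n → ℝ)
    (A : (Fin n → ℕ) → ℝ → Matrix (Fin n) (Fin n) ℝ) (t : ℝ) (x : E n) :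
    Matrix (Fin n) (Fin n) ℝ :=
  ∑ α ∈ multiIndicesBelow n m, controlProfile χ α x • A α t

/-! ### Kernels -/

/-- The heat kernel `g_t(x) = (4πt)^{-n/2} exp(-|x|²/(4t))`, for `t > 0`. -/
noncomputable def heatKernel {n : ℕ} (t : ℝ) (x : E n) : ℝ :=
  (4 * Real.pi * t) ^ (-(n : ℝ) / 2) * Real.exp (-‖x‖ ^ 2 / (4 * t))

/-- The symbol of `R ↦ (e^{tΔ} ℙ div R)_j`, where `(div R)_l = ∑_k ∂_k R_{k,l}` and `ℙ` is the
orthogonal projection of `L²` onto divergence-free fields. In the normalization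
`𝓕 f ξ = ∫ exp(-2πi x·ξ) f(x) dx`, the operators `e^{tΔ}`, `∂_k`, `ℙ_{j,l}` have the symbols
`exp(-4π²t|ξ|²)`, `2πi ξ_k` and `δ_{j,l} - ξ_j ξ_l / |ξ|²`. -/
noncomputable def oseenSymbol {n : ℕ} (t : ℝ) (j k l : Fin n) (ξ : E n) : ℂ :=
  (Real.exp (-(4 * Real.pi ^ 2 * t * ‖ξ‖ ^ 2)) : ℂ) * (2 * Real.pi * Complex.I * (ξ k : ℂ)) *
    (((if j = l then 1 else 0) - ξ j * ξ l / ‖ξ‖ ^ 2 : ℝ) : ℂ)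

/-- The kernel `F_{j;k,l}(x,t)` of `e^{tΔ} ℙ div`, for `t > 0` (the inverse Fourier transform of
the symbol; it is real-valued). -/
noncomputable def oseenKernel {n : ℕ} (t : ℝ) (j k l : Fin n) (x : E n) : ℝ :=
  (𝓕⁻ (oseenSymbol t j k l) x).re

/-! ### Mild solutions -/

/-- `v` is locally integrable and `div v = 0` in the sense of distributions. -/
def IsWeaklyDivFree {n : ℕ} (v : E n → E n) : Prop :=
  LocallyIntegrable v volume ∧
    ∀ φ : E n → ℝ, ContDiff ℝ ∞ φ → HasCompactSupport φ → ∫ x, fderiv ℝ φ x (v x) = 0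

/-- `u` is a mild solution, on the time interval `I ∋ 0`, of the Navier–Stokes equations
`∂_t u - Δu + (u·∇)u + ∇π = div f`, `div u = 0`, `u(0) = u₀`, that is
`u(t) = e^{tΔ}u₀ - ∫₀ᵗ e^{(t-s)Δ} ℙ div (u ⊗ u - f)(s) ds`, all integrals being absolutely
convergent. Here `(u ⊗ u)_{k,l} = u_k u_l` and `(div f)_l = ∑_k ∂_k f_{k,l}`. -/
structure IsMildSolution {n : ℕ} (I : Set ℝ) (u₀ : E n → E n)
    (f : ℝ → E n → Matrix (Fin n) (Fin n) ℝ) (u : ℝ → E n → E n) : Prop where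
  measurable : Measurable (Function.uncurry u)
  initial : u 0 =ᵐ[volume] u₀
  divFree : ∀ t ∈ I, IsWeaklyDivFree (u t)
  integrable_heat : ∀ t ∈ I, 0 < t → ∀ x,
    Integrable (fun y => heatKernel t (x - y) • u₀ y) volume
  integrable_nonlinear : ∀ t ∈ I, 0 < t → ∀ x, ∀ j k l,
    IntegrableOn (fun p : ℝ × E n =>
      oseenKernel (t - p.1) j k l (x - p.2) * (u p.1 p.2 k * u p.1 p.2 l))
      (Ioo 0 t ×ˢ univ) (volume.prod volume)
  integrable_force : ∀ t ∈ I, 0 < t → ∀ x, ∀ j k l,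
    IntegrableOn (fun p : ℝ × E n => oseenKernel (t - p.1) j k l (x - p.2) * f p.1 p.2 k l)
      (Ioo 0 t ×ˢ univ) (volume.prod volume)
  equation : ∀ t ∈ I, 0 < t → ∀ x, ∀ j,
    u t x j = (∫ y, heatKernel t (x - y) • u₀ y) j -
      ∫ s in Ioo 0 t, ∫ y, ∑ k, ∑ l,
        oseenKernel (t - s) j k l (x - y) * (u s y k * u s y l - f s y k l)

/-! ### Size conditions -/

/-- `ess sup_x (1+|x|)^{n+1+m} |u₀(x)|`. -/
noncomputable def weightedSup {n : ℕ} (m : ℕ) (u₀ : E n → E n) : ℝ≥0∞ :=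
  essSup (fun x => ENNReal.ofReal ((1 + ‖x‖) ^ (n + 1 + m) * ‖u₀ x‖)) volume

/-- `∫ (1+|x|)^{m+1} |u₀(x)| dx`. -/
noncomputable def weightedIntegral {n : ℕ} (m : ℕ) (u₀ : E n → E n) : ℝ≥0∞ :=
  ∫⁻ x, ENNReal.ofReal ((1 + ‖x‖) ^ (m + 1) * ‖u₀ x‖)

/-- `ess sup_{t ∈ I} |u(x,t)|`. -/
noncomputable def timeSup {n : ℕ} (I : Set ℝ) (u : ℝ → E n → E n) (x : E n) : ℝ≥0∞ :=
  essSup (fun t => ‖u t x‖ₑ) (volume.restrict I)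

/-!
The obstruction to spatial decay of a Navier–Stokes flow beyond `|x|^{-n-1}` is the nonlocal tail of
the kernel `F` of `e^{tΔ} ℙ div`: convolved with an integrable matrix field `R`, it decays like
`|x|^{-(n+1)}` with a coefficient proportional to `∫ R`. When the moments of `R` of order `< N`
vanish, Taylor expansion of the kernel improves this to `|x|^{-(n+1+N)}`. So `u ⊗ u` should be
replaced by `u ⊗ u - f` with vanishing moments, and this is what a force `f = ∑ A_α χ_α` with
`A_α(t) = ∫ z^α (u ⊗ u)(z, t) dz` does, provided that `∫ y^β χ_α = δ_{αβ}`. Integration by parts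
reduces the latter to `∫ χ = 1` and `∫ y^γ χ = 0` for `0 < |γ| ≤ m`, which some smooth `χ` supported
in the box satisfies (`exists_moment_profile`, `integral_monomialAt_mul_controlProfile_eq`).

With this choice the force is a function of `u`, and `u` is the fixed point of the map
`u ↦ e^{tΔ} v - F * (u ⊗ u - f(u))` (`mildMap`), a contraction for the supremum norm weighted by
`(1 + |x|)^{n+1+m}` on `[0, T]`, or by `(1 + √t + |x|)^{n+1+m}` on `[0, ∞)`
(`exists_fixedPoint_of_weighted_contraction`, `exists_mildMap_eq`). The estimates behind it are:

* `exists_oseen_convolution_le`, the convolution bound for `F`. Since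
  `|ξ|^{-2} e^{-4π²τ|ξ|²} = 4π² ∫_τ^∞ e^{-4π²s|ξ|²} ds`, the kernel is a derivative of the heat
  kernel plus an integral over `s > τ` of self-similar kernels with Schwartz profile
  (`fourierInv_oseenSymbol`), so that Taylor expansion is only needed for Schwartz functions
  (`exists_taylor_poly`, `norm_convolution_dilate_le`);
* `exists_momentCorrection_le`, the size of `u ⊗ u - f`, and the resulting bounds
  `exists_duhamel_local_le` and `exists_duhamel_global_le` of the integral term;
* `exists_norm_heatConv_le` and `exists_norm_heatConv_le_of_moments`, the decay of the heat flow,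
  global in time when the moments of the initial field vanish up to order `m`.

The `o`-statement uses one more order of moments, `N = m + 1`: the integral term is then
`O(|x|^{-(n+2+m)})`, and the heat flow preserves the `o`-decay (`eventually_norm_heatConv_le`).
The decay of the force in time is that of the moments of `u ⊗ u` (`exists_abs_controlForce_le`).

The matrices must not depend on `T`. They are taken from the global solution whenever the
hypotheses for it hold, and otherwise from the solution on the longest admissible interval
(`exists_local_solution_family`); solutions on shorter intervals are restrictions.
-/

section

open scoped SchwartzMap LineDeriv

/-! ### Gaussians as Schwartz functions -/

theorem one_add_pow_mul_exp_neg_sq_le {a : ℝ} (ha : 0 < a) (p : ℕ) {t : ℝ} (ht : 0 ≤ t) :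
    (1 + t) ^ p * Real.exp (-(a * t ^ 2)) ≤ p.factorial * a⁻¹ ^ p * Real.exp (2 * a) := by
  have h1 : (a * (2 + t ^ 2)) ^ p ≤ p.factorial * Real.exp (a * (2 + t ^ 2)) := by
    have := Real.pow_div_factorial_le_exp (a * (2 + t ^ 2)) (by positivity) p
    rw [div_le_iff₀ (by positivity)] at this
    linarith
  have h2 : (1 + t) ^ p ≤ (2 + t ^ 2) ^ p :=
    pow_le_pow_left₀ (by linarith) (by nlinarith [sq_nonneg (t - 1)]) p
  have h3 : Real.exp (a * (2 + t ^ 2)) = Real.exp (2 * a) * Real.exp (a * t ^ 2) := by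
    rw [← Real.exp_add]; ring_nf
  have h4 : (2 + t ^ 2) ^ p ≤ p.factorial * a⁻¹ ^ p * (Real.exp (2 * a) * Real.exp (a * t ^ 2)) := by
    rw [mul_pow, h3] at h1
    rw [inv_pow, mul_comm (p.factorial : ℝ), mul_assoc, ← div_eq_inv_mul,
      le_div_iff₀ (by positivity)]
    linarith
  rw [Real.exp_neg, ← div_eq_mul_inv, div_le_iff₀ (Real.exp_pos _), mul_assoc]
  exact h2.trans h4

/-- The Gaussian `x ↦ exp (-a |x|²)`, `a > 0`, as a Schwartz function. -/
noncomputable def gaussianSchwartz (n : ℕ) (a : ℝ) (ha : 0 < a) : 𝓢(E n, ℂ) where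
  toFun x := (Real.exp (-(a * ‖x‖ ^ 2)) : ℂ)
  smooth' := by
    have : ContDiff ℝ ∞ fun x : E n => Real.exp (-(a * ‖x‖ ^ 2)) :=
      Real.contDiff_exp.comp ((contDiff_const.mul (contDiff_norm_sq ℝ)).neg)
    exact Complex.ofRealCLM.contDiff.comp this
  decay' := by
    intro k N
    have hq : (fun x : E n => -(a * ‖x‖ ^ 2)).HasTemperateGrowth := by fun_prop
    obtain ⟨p, C, hC, hb⟩ := hq.norm_iteratedFDeriv_le_uniform N
    refine ⟨N.factorial * (max C 1) ^ N *
      ((k + p * N).factorial * a⁻¹ ^ (k + p * N) * Real.exp (2 * a)), fun x => ?_⟩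
    have hexp : ContDiff ℝ ∞ (fun y : ℝ => (Real.exp y : ℂ)) :=
      Complex.ofRealCLM.contDiff.comp Real.contDiff_exp
    have hder : ∀ i, ∀ y : ℝ, ‖iteratedFDeriv ℝ i (fun y : ℝ => (Real.exp y : ℂ)) y‖
        ≤ Real.exp y := by
      intro i y
      have h1 := Complex.ofRealLI.norm_iteratedFDeriv_comp_left (x := y)
        (Real.contDiff_exp (n := ∞)).contDiffAt (i := i) (by exact_mod_cast le_top)
      have h2 : (⇑Complex.ofRealLI ∘ Real.exp) = (fun y : ℝ => (Real.exp y : ℂ)) := rfl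
      rw [h2] at h1
      rw [h1, norm_iteratedFDeriv_eq_norm_iteratedDeriv, iteratedDeriv_eq_iterate,
        Real.iter_deriv_exp, Real.norm_eq_abs, abs_of_pos (Real.exp_pos _)]
    have key := norm_iteratedFDeriv_comp_le (n := N) (N := ∞)
      (f := fun x : E n => -(a * ‖x‖ ^ 2)) hexp
      ((contDiff_const.mul (contDiff_norm_sq ℝ)).neg) (by exact_mod_cast le_top) x
      (D := max C 1 * (1 + ‖x‖) ^ p) (fun i _ => hder i _)
      (fun i hi1 hi => (hb i hi x).trans ?_)
    · have h0 := one_add_pow_mul_exp_neg_sq_le ha (k + p * N) (norm_nonneg x)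
      have hk : ‖x‖ ^ k ≤ (1 + ‖x‖) ^ k := by gcongr; linarith
      calc ‖x‖ ^ k * _ ≤ (1 + ‖x‖) ^ k * (N.factorial * Real.exp (-(a * ‖x‖ ^ 2)) *
            (max C 1 * (1 + ‖x‖) ^ p) ^ N) := by
            gcongr
            exact key
        _ = N.factorial * (max C 1) ^ N *
            ((1 + ‖x‖) ^ (k + p * N) * Real.exp (-(a * ‖x‖ ^ 2))) := by
            rw [mul_pow, pow_add, pow_mul]; ring
        _ ≤ _ := by gcongr
    · have h1 : (1 : ℝ) ≤ max C 1 * (1 + ‖x‖) ^ p :=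
        one_le_mul_of_one_le_of_one_le (le_max_right _ _)
          (one_le_pow₀ (by linarith [norm_nonneg x]))
      calc C * (1 + ‖x‖) ^ p ≤ max C 1 * (1 + ‖x‖) ^ p := by gcongr; exact le_max_left _ _
        _ ≤ _ := le_self_pow₀ h1 (by omega)

@[simp]
theorem gaussianSchwartz_apply {n : ℕ} {a : ℝ} (ha : 0 < a) (x : E n) :
    gaussianSchwartz n a ha x = (Real.exp (-(a * ‖x‖ ^ 2)) : ℂ) := rfl

theorem hasTemperateGrowth_coord {n : ℕ} (i : Fin n) :
    (fun x : E n => (x i : ℂ)).HasTemperateGrowth :=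
  (Complex.ofRealCLM ∘L (EuclideanSpace.proj i : E n →L[ℝ] ℝ)).hasTemperateGrowth

/-! ### Taylor expansion of Schwartz functions and convolution with vanishing moments -/

/-- The complex polynomial functions on `ℝⁿ` of degree `< N`. -/
def polySpan (n N : ℕ) : Submodule ℂ (E n → ℂ) :=
  Submodule.span ℂ ((fun (α : Fin n → ℕ) (x : E n) => (monomialAt α x : ℂ)) ''
    {α | ∑ i, α i < N})

theorem monomialAt_smul {n : ℕ} (α : Fin n → ℕ) (c : ℝ) (x : E n) :
    monomialAt α (c • x) = c ^ (∑ i, α i) * monomialAt α x := by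
  simp [monomialAt, mul_pow, Finset.prod_mul_distrib, Finset.prod_pow_eq_pow_sum]

theorem monomialAt_add_single {n : ℕ} (α : Fin n → ℕ) (i : Fin n) (x : E n) :
    monomialAt (α + Pi.single i 1) x = x i * monomialAt α x := by
  simp only [monomialAt, Pi.add_apply, pow_add, Finset.prod_mul_distrib]
  rw [mul_comm]
  congr 1
  rw [Finset.prod_eq_single i]
  · simp
  · intro j _ hj; simp [hj]
  · simp

theorem abs_monomialAt_le {n : ℕ} (α : Fin n → ℕ) (x : E n) :
    |monomialAt α x| ≤ ‖x‖ ^ (∑ i, α i) := by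
  rw [monomialAt, Finset.abs_prod, ← Finset.prod_pow_eq_pow_sum]
  refine Finset.prod_le_prod (fun _ _ => abs_nonneg _) fun i _ => ?_
  rw [abs_pow]
  exact pow_le_pow_left₀ (abs_nonneg _) (by simpa using PiLp.norm_apply_le x i) _

theorem continuous_monomialAt {n : ℕ} (α : Fin n → ℕ) :
    Continuous (monomialAt α : E n → ℝ) := by
  unfold monomialAt; fun_prop

theorem comp_smul_mem_polySpan {n N : ℕ} {p : E n → ℂ} (hp : p ∈ polySpan n N) (c : ℝ) :
    (fun y => p (c • y)) ∈ polySpan n N := by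
  induction hp using Submodule.span_induction with
  | mem p hp =>
    obtain ⟨α, hα, rfl⟩ := hp
    have : (fun y : E n => (monomialAt α (c • y) : ℂ)) =
        ((c : ℂ) ^ (∑ i, α i)) • fun y : E n => (monomialAt α y : ℂ) := by
      ext y; simp [monomialAt_smul]
    simp only [this]
    exact Submodule.smul_mem _ _ (Submodule.subset_span ⟨α, hα, rfl⟩)
  | zero => exact Submodule.zero_mem _
  | add p q _ _ hp hq => exact Submodule.add_mem _ hp hq
  | smul c p _ hp => exact Submodule.smul_mem _ c hp

theorem coord_mul_mem_polySpan {n N : ℕ} {p : E n → ℂ} (hp : p ∈ polySpan n N) (i : Fin n) :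
    (fun y => (y i : ℂ) * p y) ∈ polySpan n (N + 1) := by
  induction hp using Submodule.span_induction with
  | mem p hp =>
    obtain ⟨α, hα, rfl⟩ := hp
    refine Submodule.subset_span ⟨α + Pi.single i 1, ?_, ?_⟩
    · simp only [mem_ofPred_eq, Pi.add_apply, Finset.sum_add_distrib] at hα ⊢
      simpa using hα
    · ext y; simp [monomialAt_add_single]
  | zero =>
    refine (congrArg (· ∈ polySpan n (N + 1)) ?_).mp (Submodule.zero_mem _)
    ext y; simp
  | add p q _ _ hp hq =>
    have := Submodule.add_mem _ hp hq
    refine (congrArg (· ∈ polySpan n (N + 1)) ?_).mp this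
    ext y; simp [mul_add]
  | smul c p _ hp =>
    have := Submodule.smul_mem _ c hp
    refine (congrArg (· ∈ polySpan n (N + 1)) ?_).mp this
    ext y; simp; ring

theorem const_mem_polySpan (n N : ℕ) (c : ℂ) : (fun _ : E n => c) ∈ polySpan n (N + 1) := by
  have : (fun _ : E n => c) = c • fun y : E n => (monomialAt 0 y : ℂ) := by
    ext y; simp [monomialAt]
  rw [this]
  exact Submodule.smul_mem _ _ (Submodule.subset_span ⟨0, by simp, rfl⟩)

/-- The radial average `q(y) = ∫₀¹ p(σ y) dσ` of a polynomial, described by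
`d/dσ (σ q(σ y)) = p(σ y)`. -/
theorem exists_radial_primitive {n N : ℕ} {p : E n → ℂ} (hp : p ∈ polySpan n N) :
    ∃ q ∈ polySpan n N, ∀ (y : E n) (σ : ℝ),
      HasDerivAt (fun σ : ℝ => (σ : ℂ) * q (σ • y)) (p (σ • y)) σ := by
  induction hp using Submodule.span_induction with
  | mem p hp =>
    obtain ⟨α, hα, rfl⟩ := hp
    refine ⟨((∑ i, α i : ℕ) + 1 : ℂ)⁻¹ • fun y : E n => (monomialAt α y : ℂ),
      Submodule.smul_mem _ _ (Submodule.subset_span ⟨α, hα, rfl⟩), fun y σ => ?_⟩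
    set k := ∑ i, α i with hk
    have hk0 : ((k : ℂ) + 1) ≠ 0 := by exact_mod_cast Nat.succ_ne_zero k
    have h1 : (fun σ : ℝ => (σ : ℂ) * (((k : ℂ) + 1)⁻¹ • fun y : E n => (monomialAt α y : ℂ))
        (σ • y)) = fun σ : ℝ => ((((k : ℝ) + 1)⁻¹ * monomialAt α y * σ ^ (k + 1) : ℝ) : ℂ) := by
      ext σ
      simp [monomialAt_smul, ← hk]; ring
    rw [h1]
    refine HasDerivAt.ofReal_comp ?_
    refine ((hasDerivAt_pow (k + 1) σ).const_mul _).congr_deriv ?_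
    rw [monomialAt_smul, ← hk]
    have : ((k : ℝ) + 1) ≠ 0 := by positivity
    field_simp
    push_cast
    ring
  | zero => exact ⟨0, Submodule.zero_mem _, fun y σ => by simpa using hasDerivAt_const σ (0 : ℂ)⟩
  | add p₁ p₂ _ _ h₁ h₂ =>
    obtain ⟨q₁, hq₁, hd₁⟩ := h₁
    obtain ⟨q₂, hq₂, hd₂⟩ := h₂
    refine ⟨q₁ + q₂, Submodule.add_mem _ hq₁ hq₂, fun y σ => ?_⟩
    simpa [mul_add] using (hd₁ y σ).fun_add (hd₂ y σ)
  | smul c p _ h =>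
    obtain ⟨q, hq, hd⟩ := h
    refine ⟨c • q, Submodule.smul_mem _ _ hq, fun y σ => ?_⟩
    have := (hd y σ).const_mul c
    simp only [Pi.smul_apply, smul_eq_mul]
    refine this.congr_of_eventuallyEq (Eventually.of_forall fun σ => ?_)
    simp only; ring

theorem schwartz_decay {n : ℕ} (f : 𝓢(E n, ℂ)) (d : ℕ) :
    ∃ C, 0 ≤ C ∧ ∀ x, ‖f x‖ ≤ C / (1 + ‖x‖) ^ d := by
  refine ⟨2 ^ d * ((Finset.Iic (d, 0)).sup fun m => SchwartzMap.seminorm ℝ m.1 m.2) f,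
    by positivity, fun x => ?_⟩
  have := SchwartzMap.one_add_le_sup_seminorm_apply (𝕜 := ℝ) (m := (d, 0)) (k := d) (n := 0)
    le_rfl le_rfl f x
  rw [norm_iteratedFDeriv_zero] at this
  rw [le_div_iff₀ (by positivity), mul_comm]
  exact this

theorem fderiv_apply_eq_sum {n : ℕ} {F : Type*} [NormedAddCommGroup F] [NormedSpace ℝ F]
    (L : E n →L[ℝ] F) (y : E n) : L y = ∑ i, y i • L (EuclideanSpace.single i 1) := by
  conv_lhs => rw [← (EuclideanSpace.basisFun (Fin n) ℝ).sum_repr y]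
  simp

/-- Taylor expansion of a Schwartz function with uniform decay: for `|y| ≤ (1 + |x|) / 4`, the
function `f (x - y)` is a polynomial in `y` of degree `< N` up to `O(|y|^N (1 + |x|)^{-d})`. -/
theorem exists_taylor_poly {n : ℕ} (N d : ℕ) : ∀ f : 𝓢(E n, ℂ), ∃ C, 0 ≤ C ∧ ∀ x : E n,
    ∃ p ∈ polySpan n N, (∀ y, ‖p y‖ ≤ C * (1 + ‖y‖) ^ N / (1 + ‖x‖) ^ d) ∧
      ∀ y, 4 * ‖y‖ ≤ 1 + ‖x‖ → ‖f (x - y) - p y‖ ≤ C * ‖y‖ ^ N / (1 + ‖x‖) ^ d := by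
  induction N with
  | zero =>
    intro f
    obtain ⟨C, hC, hf⟩ := schwartz_decay f d
    refine ⟨C * 2 ^ d, by positivity, fun x => ⟨0, Submodule.zero_mem _, fun y => ?_, fun y hy => ?_⟩⟩
    · simp only [Pi.zero_apply, norm_zero]; positivity
    · have h1 : ‖x‖ - ‖y‖ ≤ ‖x - y‖ := norm_sub_norm_le x y
      have h2 : 1 + ‖x‖ ≤ 2 * (1 + ‖x - y‖) := by linarith [norm_nonneg x]
      simp only [Pi.zero_apply, sub_zero, pow_zero, mul_one]
      refine (hf _).trans ?_
      rw [div_le_div_iff₀ (by positivity) (by positivity), mul_assoc, ← mul_pow]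
      gcongr
  | succ N ih =>
    intro f
    let g : Fin n → 𝓢(E n, ℂ) := fun i => ∂_{(EuclideanSpace.single i 1 : E n)} f
    have hg : ∀ i z, g i z = fderiv ℝ f z (EuclideanSpace.single i 1) := fun i z =>
      SchwartzMap.lineDerivOp_apply_eq_fderiv _ _ _
    choose C hC hp using fun i => ih (g i)
    obtain ⟨C₀, hC₀, hf₀⟩ := schwartz_decay f d
    refine ⟨C₀ + ∑ i, C i, add_nonneg hC₀ (Finset.sum_nonneg fun i _ => hC i), fun x => ?_⟩
    choose p hpm hpb hpe using fun i => hp i x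
    choose q hqm hqd using fun i => exists_radial_primitive (hpm i)
    have hyi : ∀ (y : E n) i, ‖(y i : ℂ)‖ ≤ ‖y‖ := fun y i => by
      simpa using PiLp.norm_apply_le y i
    refine ⟨(fun _ => f x) - ∑ i, fun y => (y i : ℂ) * q i y, Submodule.sub_mem _
      (const_mem_polySpan n N _) (Submodule.sum_mem _ fun i _ => coord_mul_mem_polySpan (hqm i) i),
      fun y => ?_, fun y hy => ?_⟩
    · have hq : ∀ i, ‖q i y‖ ≤ C i * (1 + ‖y‖) ^ N / (1 + ‖x‖) ^ d := by
        intro i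
        have := norm_image_sub_le_of_norm_deriv_le_segment_01'
          (fun σ _ => (hqd i y σ).hasDerivWithinAt)
          (C := C i * (1 + ‖y‖) ^ N / (1 + ‖x‖) ^ d) (fun σ hσ => (hpb i _).trans ?_)
        · simpa using this
        · rw [norm_smul, Real.norm_of_nonneg hσ.1]
          have : σ * ‖y‖ ≤ ‖y‖ := mul_le_of_le_one_left (norm_nonneg y) hσ.2.le
          have := hC i
          have := hσ.1
          gcongr
      simp only [Pi.sub_apply, Finset.sum_apply]
      have h1 : (1 : ℝ) ≤ (1 + ‖y‖) ^ (N + 1) := one_le_pow₀ (by linarith [norm_nonneg y])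
      calc ‖f x - ∑ i, (y i : ℂ) * q i y‖ ≤ ‖f x‖ + ∑ i, ‖(y i : ℂ) * q i y‖ :=
            (norm_sub_le _ _).trans (by gcongr; exact norm_sum_le _ _)
        _ ≤ C₀ * (1 + ‖y‖) ^ (N + 1) / (1 + ‖x‖) ^ d +
            ∑ i, C i * (1 + ‖y‖) ^ (N + 1) / (1 + ‖x‖) ^ d := by
            gcongr with i
            · refine (hf₀ x).trans ?_
              gcongr
              exact le_mul_of_one_le_right hC₀ h1
            · rw [norm_mul]
              calc ‖(y i : ℂ)‖ * ‖q i y‖ ≤ (1 + ‖y‖) * (C i * (1 + ‖y‖) ^ N / (1 + ‖x‖) ^ d) := by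
                    gcongr
                    · linarith [hyi y i]
                    · exact hq i
                _ = _ := by rw [pow_succ]; ring
        _ = _ := by rw [add_mul, add_div, Finset.sum_mul, Finset.sum_div]
    · -- Along `σ ↦ x - σ y`, the error has derivative `-∑ yᵢ (∂ᵢf - pᵢ)`, bounded by induction.
      have hder : ∀ σ : ℝ, HasDerivAt (fun σ : ℝ => f (x - σ • y) + ∑ i, (y i : ℂ) *
          ((σ : ℂ) * q i (σ • y))) (-∑ i, (y i : ℂ) * (g i (x - σ • y) - p i (σ • y))) σ := by
        intro σ
        have h1 : HasDerivAt (fun σ : ℝ => f (x - σ • y)) (fderiv ℝ f (x - σ • y) (-y)) σ := by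
          have hl : HasDerivAt (fun σ : ℝ => x - σ • y) (-y) σ := by
            simpa using (hasDerivAt_const σ x).fun_sub ((hasDerivAt_id σ).smul_const y)
          exact (f.hasFDerivAt (x - σ • y)).comp_hasDerivAt σ hl
        have h2 : HasDerivAt (fun σ : ℝ => ∑ i, (y i : ℂ) * ((σ : ℂ) * q i (σ • y)))
            (∑ i, (y i : ℂ) * p i (σ • y)) σ :=
          HasDerivAt.fun_sum fun i _ => (hqd i y σ).const_mul _
        refine (h1.add h2).congr_deriv ?_
        rw [map_neg, fderiv_apply_eq_sum]
        simp only [hg, mul_sub, Finset.sum_sub_distrib, Complex.real_smul]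
        ring
      have := norm_image_sub_le_of_norm_deriv_le_segment_01'
        (fun σ _ => (hder σ).hasDerivWithinAt)
        (C := (∑ i, C i) * ‖y‖ ^ (N + 1) / (1 + ‖x‖) ^ d) (fun σ hσ => ?_)
      · simp only [one_smul, Complex.ofReal_one, one_mul, zero_smul, sub_zero, Complex.ofReal_zero,
          zero_mul, mul_zero, Finset.sum_const_zero, add_zero] at this
        simp only [Pi.sub_apply, Finset.sum_apply]
        rw [← sub_add, sub_add_eq_add_sub]
        refine this.trans ?_
        gcongr
        linarith
      · rw [norm_neg, Finset.sum_mul, Finset.sum_div]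
        refine (norm_sum_le _ _).trans (Finset.sum_le_sum fun i _ => ?_)
        have h0 : ‖σ • y‖ ≤ ‖y‖ := by
          rw [norm_smul, Real.norm_of_nonneg hσ.1]
          exact mul_le_of_le_one_left (norm_nonneg y) hσ.2.le
        rw [norm_mul]
        have hCi := hC i
        calc _ ≤ ‖y‖ * (C i * ‖y‖ ^ N / (1 + ‖x‖) ^ d) := by
              gcongr
              · exact hyi y i
              · refine (hpe i (σ • y) (by linarith)).trans ?_
                gcongr
          _ = _ := by rw [pow_succ]; ring

theorem integrable_inv_one_add_norm_pow {n e : ℕ} (he : n < e) :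
    Integrable (fun y : E n => ((1 + ‖y‖) ^ e)⁻¹) := by
  have := integrable_one_add_norm (E := E n) (μ := volume) (r := (e : ℝ)) (by simpa using he)
  refine this.congr (Eventually.of_forall fun y => ?_)
  simp only
  rw [Real.rpow_neg (by positivity), Real.rpow_natCast]

/-- The moments of `R` of order `< N` vanish. Integrability is required up to order `N`, the order
of the Taylor remainder against which `R` is integrated. -/
structure VanishingMoments {n : ℕ} (N : ℕ) (R : E n → ℝ) : Prop where
  integrable : Integrable R
  integrable_pow : Integrable fun y => ‖y‖ ^ N * R y
  moment_eq_zero : ∀ α : Fin n → ℕ, ∑ i, α i < N → ∫ y, monomialAt α y * R y = 0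

theorem VanishingMoments.integrable_monomialAt_mul {n N : ℕ} {R : E n → ℝ}
    (h : VanishingMoments N R) {α : Fin n → ℕ} (hα : ∑ i, α i ≤ N) :
    Integrable fun y => monomialAt α y * R y := by
  refine (h.integrable.norm.add h.integrable_pow.norm).mono'
    ((continuous_monomialAt α).aestronglyMeasurable.mul h.integrable.aestronglyMeasurable)
    (Eventually.of_forall fun y => ?_)
  simp only [Pi.add_apply, norm_mul, norm_pow, norm_norm]
  rw [← one_add_mul]
  gcongr
  refine (abs_monomialAt_le α y).trans ?_
  rcases le_total ‖y‖ 1 with hy | hy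
  · have := pow_le_one₀ (n := ∑ i, α i) (norm_nonneg y) hy
    have : 0 ≤ ‖y‖ ^ N := by positivity
    linarith
  · have := pow_le_pow_right₀ hy hα
    linarith

/-- A function with vanishing moments is orthogonal to polynomials of low degree. -/
theorem VanishingMoments.polySpan {n N : ℕ} {R : E n → ℝ} (h : VanishingMoments N R)
    {p : E n → ℂ} (hp : p ∈ polySpan n N) :
    Integrable (fun y => p y * (R y : ℂ)) ∧ ∫ y, p y * (R y : ℂ) = 0 := by
  induction hp using Submodule.span_induction with
  | mem p hp =>
    obtain ⟨α, hα, rfl⟩ := hp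
    have h1 := (h.integrable_monomialAt_mul (le_of_lt hα)).ofReal (𝕜 := ℂ)
    simp only [Complex.coe_algebraMap, RCLike.ofReal_mul] at h1
    refine ⟨h1, ?_⟩
    have h2 := integral_ofReal (μ := volume) (𝕜 := ℂ) (f := fun y => monomialAt α y * R y)
    rw [h.moment_eq_zero α hα] at h2
    simpa using h2
  | zero => simp
  | add p q _ _ hp hq =>
    simp only [Pi.add_apply, add_mul]
    exact ⟨hp.1.add hq.1, by rw [integral_add hp.1 hq.1, hp.2, hq.2, add_zero]⟩
  | smul c p _ hp =>
    simp only [Pi.smul_apply, smul_eq_mul, mul_assoc]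
    exact ⟨hp.1.const_mul c, by rw [integral_const_mul, hp.2, mul_zero]⟩

theorem one_add_norm_pow_le {n : ℕ} {x y : E n} {N : ℕ} (hxy : 1 + ‖x‖ ≤ 4 * ‖y‖) :
    (1 + ‖y‖) ^ N ≤ 5 ^ N * ‖y‖ ^ N := by
  rw [← mul_pow]
  gcongr
  linarith [norm_nonneg x]

/-- Convolution of the dilate `f (· / r)` of a Schwartz function with a function whose moments of
order `< N` vanish: only `∫ |y|^N |R|` and the part of the convolution integral over
`4 |y| > r + |x|` matter. -/
theorem norm_convolution_dilate_le {n : ℕ} (f : 𝓢(E n, ℂ)) (N d : ℕ) :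
    ∃ C, 0 ≤ C ∧ ∀ r : ℝ, 0 < r → ∀ R : E n → ℝ, VanishingMoments N R → ∀ x : E n,
      ‖∫ y, f (r⁻¹ • (x - y)) * (R y : ℂ)‖ ≤
        C * (r ^ d / (r ^ N * (r + ‖x‖) ^ d)) * (∫ y, ‖y‖ ^ N * |R y|) +
        ∫ y in {y : E n | r + ‖x‖ < 4 * ‖y‖}, ‖f (r⁻¹ • (x - y))‖ * |R y| := by
  obtain ⟨C, hC, hT⟩ := exists_taylor_poly (n := n) N d f
  refine ⟨C * 5 ^ N, by positivity, fun r hr R hR x => ?_⟩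
  obtain ⟨p, hp, hpb, hpe⟩ := hT (r⁻¹ • x)
  obtain ⟨hPi, hP0⟩ := hR.polySpan (comp_smul_mem_polySpan hp r⁻¹)
  have hRm := hR.integrable.aestronglyMeasurable
  have hfm : Continuous fun y => f (r⁻¹ • (x - y)) := by fun_prop
  have hfi : Integrable fun y => f (r⁻¹ • (x - y)) * (R y : ℂ) := by
    obtain ⟨B, hB, hfB⟩ := schwartz_decay f 0
    refine (hR.integrable.ofReal (𝕜 := ℂ)).bdd_mul (c := B) hfm.aestronglyMeasurable
      (Eventually.of_forall fun y => by simpa using hfB _)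
  -- The Taylor polynomial integrates to zero against `R`.
  have hsub : ∫ y, f (r⁻¹ • (x - y)) * (R y : ℂ) =
      ∫ y, (f (r⁻¹ • (x - y)) * (R y : ℂ) - p (r⁻¹ • y) * (R y : ℂ)) := by
    rw [integral_sub hfi hPi, hP0, sub_zero]
  have hS : MeasurableSet {y : E n | r + ‖x‖ < 4 * ‖y‖} :=
    measurableSet_lt measurable_const (by fun_prop)
  have hK : ∀ y : E n, ‖r⁻¹ • y‖ ^ N / (1 + ‖r⁻¹ • x‖) ^ d =
      (r ^ d / (r ^ N * (r + ‖x‖) ^ d)) * ‖y‖ ^ N := by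
    intro y
    rw [norm_smul, norm_smul, norm_inv, Real.norm_of_nonneg hr.le]
    have : 1 + r⁻¹ * ‖x‖ = r⁻¹ * (r + ‖x‖) := by field_simp
    rw [this, mul_pow, mul_pow, inv_pow, inv_pow]
    have : r + ‖x‖ ≠ 0 := by positivity
    field_simp
  have hi2 : Integrable (fun y => ‖f (r⁻¹ • (x - y))‖ * |R y|) := by
    refine hfi.norm.congr (Eventually.of_forall fun y => by simp)
  have hi3 : Integrable fun y => C * 5 ^ N * (r ^ d / (r ^ N * (r + ‖x‖) ^ d)) * (‖y‖ ^ N * |R y|) := by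
    refine Integrable.const_mul ?_ _
    exact hR.integrable_pow.norm.congr (Eventually.of_forall fun y => by simp)
  rw [hsub]
  refine (norm_integral_le_integral_norm _).trans ?_
  rw [← integral_const_mul, ← integral_indicator hS, ← integral_add hi3 (hi2.indicator hS)]
  refine integral_mono (hfi.sub hPi).norm (hi3.add (hi2.indicator hS)) fun y => ?_
  beta_reduce
  rw [← sub_mul, norm_mul, Complex.norm_real, Real.norm_eq_abs]
  have hx4 : 4 * ‖r⁻¹ • y‖ ≤ 1 + ‖r⁻¹ • x‖ ↔ 4 * ‖y‖ ≤ r + ‖x‖ := by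
    rw [norm_smul, norm_smul, norm_inv, Real.norm_of_nonneg hr.le]
    have h1 : 4 * (r⁻¹ * ‖y‖) = r⁻¹ * (4 * ‖y‖) := by ring
    have h2 : 1 + r⁻¹ * ‖x‖ = r⁻¹ * (r + ‖x‖) := by field_simp
    rw [h1, h2, mul_le_mul_iff_right₀ (by positivity)]
  have e1 : C * 5 ^ N * (r ^ d / (r ^ N * (r + ‖x‖) ^ d)) * (‖y‖ ^ N * |R y|) =
      5 ^ N * (C * ‖r⁻¹ • y‖ ^ N / (1 + ‖r⁻¹ • x‖) ^ d) * |R y| := by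
    rw [mul_div_assoc, hK]; ring
  rw [e1]
  have h5 : (1 : ℝ) ≤ 5 ^ N := one_le_pow₀ (by norm_num)
  by_cases hy : 4 * ‖y‖ ≤ r + ‖x‖
  · rw [indicator_of_notMem (by simpa using hy), add_zero]
    gcongr
    rw [smul_sub]
    refine (hpe _ (hx4.2 hy)).trans (le_mul_of_one_le_left (by positivity) h5)
  · rw [indicator_of_mem (by simpa using hy), ← add_mul]
    gcongr
    refine (norm_sub_le _ _).trans ?_
    rw [add_comm]
    gcongr
    refine (hpb _).trans ?_
    rw [← hx4, not_le] at hy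
    calc C * (1 + ‖r⁻¹ • y‖) ^ N / (1 + ‖r⁻¹ • x‖) ^ d
        ≤ C * (5 ^ N * ‖r⁻¹ • y‖ ^ N) / (1 + ‖r⁻¹ • x‖) ^ d := by
          gcongr
          exact one_add_norm_pow_le hy.le
      _ = _ := by ring

/-! ### Self-similar kernels -/

/-- The self-similar kernel `K_s(x) = s^{-(n+j)/2} f(x / √s)` with Schwartz profile `f`. -/
noncomputable def dilateKernel {n : ℕ} (f : 𝓢(E n, ℂ)) (j : ℕ) (s : ℝ) (x : E n) : ℂ :=
  ((((√s) ^ (n + j))⁻¹ : ℝ) : ℂ) * f ((√s)⁻¹ • x)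

theorem measurable_dilateKernel {n : ℕ} (f : 𝓢(E n, ℂ)) (j : ℕ) :
    Measurable fun p : ℝ × E n => dilateKernel f j p.1 p.2 := by
  unfold dilateKernel
  have : Measurable fun p : ℝ × E n => f ((√p.1)⁻¹ • p.2) :=
    f.continuous.measurable.comp (by fun_prop)
  fun_prop

theorem continuous_dilateKernel {n : ℕ} (f : 𝓢(E n, ℂ)) (j : ℕ) (s : ℝ) :
    Continuous (dilateKernel f j s) := by
  unfold dilateKernel; fun_prop

theorem integrable_dilateKernel {n : ℕ} (f : 𝓢(E n, ℂ)) (j : ℕ) {s : ℝ} (hs : 0 < s) :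
    Integrable (dilateKernel f j s) := by
  have : (√s)⁻¹ ≠ 0 := by positivity
  exact (f.integrable.comp_smul this).const_mul _

theorem integral_norm_dilateKernel {n : ℕ} (f : 𝓢(E n, ℂ)) (j : ℕ) {s : ℝ} (hs : 0 < s) :
    ∫ x, ‖dilateKernel f j s x‖ = ((√s) ^ j)⁻¹ * ∫ x, ‖f x‖ := by
  have h0 : 0 < √s := by positivity
  simp only [dilateKernel, norm_mul, Complex.norm_real, norm_inv, norm_pow,
    Real.norm_of_nonneg h0.le]
  rw [integral_const_mul, Measure.integral_comp_inv_smul_of_nonneg volume (fun x => ‖f x‖) h0.le]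
  simp only [finrank_euclideanSpace, Fintype.card_fin, smul_eq_mul]
  rw [pow_add]
  field_simp

theorem integrable_dilateKernel_mul {n : ℕ} (f : 𝓢(E n, ℂ)) (j : ℕ) {s : ℝ}
    {R : E n → ℝ} (hR : Integrable R) (x : E n) :
    Integrable fun y => dilateKernel f j s (x - y) * (R y : ℂ) := by
  obtain ⟨B, hB, hfB⟩ := schwartz_decay f 0
  have hc : Continuous fun y => dilateKernel f j s (x - y) :=
    (continuous_dilateKernel f j s).comp (by fun_prop)
  refine (hR.ofReal (𝕜 := ℂ)).bdd_mul (c := ‖((((√s) ^ (n + j))⁻¹ : ℝ) : ℂ)‖ * B)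
    hc.aestronglyMeasurable (Eventually.of_forall fun y => ?_)
  rw [dilateKernel, norm_mul]
  gcongr
  simpa using hfB _

/-- Convolution of a self-similar kernel with a function of decay `(b + |y|)^{-e}` and vanishing
moments. The decay exponent `d` used for the profile is a free parameter. -/
theorem norm_convolution_dilateKernel_le {n : ℕ} (f : 𝓢(E n, ℂ)) (j N d : ℕ) (e : ℕ) :
    ∃ C, 0 ≤ C ∧ ∀ s : ℝ, 0 < s → ∀ (b S : ℝ), 0 < b → 0 ≤ S → ∀ R : E n → ℝ,
      VanishingMoments N R → (∀ᵐ y, |R y| ≤ S / (b + ‖y‖) ^ e) → ∀ x : E n,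
      ‖∫ y, dilateKernel f j s (x - y) * (R y : ℂ)‖ ≤
        C * ((√s) ^ d / ((√s) ^ (n + j + N) * (√s + ‖x‖) ^ d) * (∫ y, ‖y‖ ^ N * |R y|) +
          ((√s) ^ j)⁻¹ * (S / (b + (√s + ‖x‖)) ^ e)) := by
  obtain ⟨C, hC, hconv⟩ := norm_convolution_dilate_le f N d
  refine ⟨C + (∫ x, ‖f x‖) * 4 ^ e, by positivity, fun s hs b S hb hS R hR hRb x => ?_⟩
  have h0 : 0 < √s := by positivity
  have hint : Integrable fun y => ‖f ((√s)⁻¹ • (x - y))‖ :=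
    ((f.integrable.comp_smul (inv_ne_zero h0.ne')).comp_sub_left x).norm
  have h1 := hconv (√s) h0 R hR x
  have h2 : ∫ y in {y : E n | √s + ‖x‖ < 4 * ‖y‖}, ‖f ((√s)⁻¹ • (x - y))‖ * |R y| ≤
      (√s) ^ n * (∫ x, ‖f x‖) * (4 ^ e * (S / (b + (√s + ‖x‖)) ^ e)) := by
    have hval : ∫ y, ‖f ((√s)⁻¹ • (x - y))‖ = (√s) ^ n * ∫ x, ‖f x‖ := by
      rw [integral_sub_left_eq_self (fun y => ‖f ((√s)⁻¹ • y)‖) volume x,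
        Measure.integral_comp_inv_smul_of_nonneg volume (fun x => ‖f x‖) h0.le]
      simp
    rw [← hval, ← integral_mul_const]
    refine (setIntegral_mono_on_ae (g := fun y => ‖f ((√s)⁻¹ • (x - y))‖ *
      (4 ^ e * (S / (b + (√s + ‖x‖)) ^ e))) ?_ ?_ (measurableSet_lt measurable_const (by fun_prop)) ?_).trans
      (setIntegral_le_integral (hint.mul_const _) (Eventually.of_forall fun y => ?_))
    · refine Integrable.integrableOn ?_
      obtain ⟨B, hB, hfB⟩ := schwartz_decay f 0
      have hc : Continuous fun y => ‖f ((√s)⁻¹ • (x - y))‖ := by fun_prop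
      exact hR.integrable.abs.bdd_mul (c := B) hc.aestronglyMeasurable
        (Eventually.of_forall fun y => by simpa using hfB _)
    · exact (hint.mul_const _).integrableOn
    · filter_upwards [hRb] with y hy hyS
      gcongr
      refine hy.trans ?_
      rw [← mul_div_assoc, div_le_div_iff₀ (by positivity) (by positivity)]
      rw [show 4 ^ e * S * (b + ‖y‖) ^ e = S * (4 * (b + ‖y‖)) ^ e by rw [mul_pow]; ring]
      have : √s + ‖x‖ < 4 * ‖y‖ := hyS
      gcongr
      linarith
    · simp only [Pi.zero_apply]; positivity
  have e1 : ∫ y, dilateKernel f j s (x - y) * (R y : ℂ) =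
      ((((√s) ^ (n + j))⁻¹ : ℝ) : ℂ) * ∫ y, f ((√s)⁻¹ • (x - y)) * (R y : ℂ) := by
    simp only [dilateKernel, mul_assoc]
    rw [integral_const_mul]
  rw [e1, norm_mul, Complex.norm_real, Real.norm_of_nonneg (by positivity)]
  set I := ∫ y, ‖y‖ ^ N * |R y|
  set F := ∫ x, ‖f x‖
  have hI : 0 ≤ I := integral_nonneg fun y => by positivity
  have hF : 0 ≤ F := integral_nonneg fun y => by positivity
  calc _ ≤ ((√s) ^ (n + j))⁻¹ * (C * ((√s) ^ d / ((√s) ^ N * (√s + ‖x‖) ^ d)) * I +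
        (√s) ^ n * F * (4 ^ e * (S / (b + (√s + ‖x‖)) ^ e))) := by gcongr; exact h1.trans (by gcongr)
    _ = C * ((√s) ^ d / ((√s) ^ (n + j + N) * (√s + ‖x‖) ^ d) * I) +
        F * 4 ^ e * (((√s) ^ j)⁻¹ * (S / (b + (√s + ‖x‖)) ^ e)) := by
        have : √s + ‖x‖ ≠ 0 := by positivity
        have : b + (√s + ‖x‖) ≠ 0 := by positivity
        rw [pow_add _ (n + j) N, pow_add _ n j]
        field_simp
    _ ≤ _ := by
        rw [mul_add]
        gcongr
        · exact le_add_of_nonneg_right (by positivity)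
        · exact le_add_of_nonneg_left hC

theorem integral_inv_sqrt_add_pow_three {τ X : ℝ} (hτ : 0 ≤ τ) (hX : 0 ≤ X) (hτX : 0 < τ + X ^ 2) :
    IntegrableOn (fun s : ℝ => ((√s + X) ^ 3)⁻¹) (Ioi τ) ∧
      ∫ s in Ioi τ, ((√s + X) ^ 3)⁻¹ ≤ 4 * (√τ + X)⁻¹ := by
  have hle : ∀ s ∈ Ioi τ, ((√s + X) ^ 3)⁻¹ ≤ (s + X ^ 2) ^ (-(3 / 2) : ℝ) := by
    intro s hs
    have hs0 : 0 < s := hτ.trans_lt hs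
    have h1 : s + X ^ 2 ≤ (√s + X) ^ 2 := by
      have := Real.sq_sqrt hs0.le
      nlinarith [mul_nonneg (Real.sqrt_nonneg s) hX]
    rw [Real.rpow_neg (by positivity)]
    gcongr
    calc (s + X ^ 2) ^ (3 / 2 : ℝ) ≤ ((√s + X) ^ 2) ^ (3 / 2 : ℝ) := by gcongr
      _ = (√s + X) ^ 3 := by
        rw [← Real.rpow_natCast, ← Real.rpow_mul (by positivity), ← Real.rpow_natCast]
        norm_num
  have hint : IntegrableOn (fun s : ℝ => (s + X ^ 2) ^ (-(3 / 2) : ℝ)) (Ioi τ) :=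
    integrableOn_add_rpow_Ioi_of_lt (by norm_num) (by linarith)
  have hm : AEStronglyMeasurable (fun s : ℝ => ((√s + X) ^ 3)⁻¹) (volume.restrict (Ioi τ)) := by
    have : Measurable (fun s : ℝ => ((√s + X) ^ 3)⁻¹) := by fun_prop
    exact this.aestronglyMeasurable
  have hint2 : IntegrableOn (fun s : ℝ => ((√s + X) ^ 3)⁻¹) (Ioi τ) := by
    refine Integrable.mono' hint hm ?_
    filter_upwards [ae_restrict_mem measurableSet_Ioi] with s hs
    rw [Real.norm_of_nonneg (by positivity)]
    exact hle s hs
  refine ⟨hint2, (setIntegral_mono_on hint2 hint measurableSet_Ioi hle).trans ?_⟩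
  have hval : ∫ s in Ioi τ, (s + X ^ 2) ^ (-(3 / 2) : ℝ) = 2 * (√(τ + X ^ 2))⁻¹ := by
    have h1 := (measurePreserving_add_right (volume : Measure ℝ) (X ^ 2)).setIntegral_preimage_emb
      (measurableEmbedding_addRight (X ^ 2)) (fun s : ℝ => s ^ (-(3 / 2) : ℝ)) (Ioi (τ + X ^ 2))
    have h2 : (fun s => s + X ^ 2) ⁻¹' (Ioi (τ + X ^ 2)) = Ioi τ := by ext; simp
    rw [h2] at h1
    rw [h1, integral_Ioi_rpow_of_lt (by norm_num) hτX, Real.sqrt_eq_rpow,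
      ← Real.rpow_neg hτX.le]
    norm_num
    ring
  rw [hval]
  have h3 : √τ + X ≤ 2 * √(τ + X ^ 2) := by
    have h4 : √τ ≤ √(τ + X ^ 2) := Real.sqrt_le_sqrt (by nlinarith)
    have h5 : X ≤ √(τ + X ^ 2) := Real.le_sqrt_of_sq_le (by linarith)
    linarith
  have h0 : 0 < √τ + X := by
    rcases hX.eq_or_lt with rfl | hX'
    · have : 0 < τ := by simpa using hτX
      positivity
    · positivity
  have h6 : 0 < √(τ + X ^ 2) := by positivity
  rw [← div_eq_mul_inv, ← div_eq_mul_inv, div_le_div_iff₀ h6 h0]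
  linarith

/-! ### The Oseen kernel -/

/-- For a homogeneous polynomial `p` of degree `j`, the inverse Fourier transform of
`exp (-4π² s |ξ|²) p(ξ)` is a self-similar kernel. -/
theorem fourierInv_gaussian_mul {n j : ℕ} {p : E n → ℂ} (hp : p.HasTemperateGrowth)
    (hhom : ∀ (c : ℝ) (ξ : E n), p (c • ξ) = (c : ℂ) ^ j * p ξ) {s : ℝ} (hs : 0 < s) (x : E n) :
    𝓕⁻ (fun ξ => (Real.exp (-(4 * Real.pi ^ 2 * s * ‖ξ‖ ^ 2)) : ℂ) * p ξ) x =
      dilateKernel (𝓕⁻ (SchwartzMap.smulLeftCLM ℂ p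
        (gaussianSchwartz n (4 * Real.pi ^ 2) (by positivity)))) j s x := by
  have h0 : 0 < √s := by positivity
  rw [dilateKernel, SchwartzMap.fourierInv_coe, Real.fourierInv_eq', Real.fourierInv_eq']
  have := Measure.integral_comp_smul_of_nonneg (volume : Measure (E n)) (fun v : E n =>
    Complex.exp (↑(2 * Real.pi * inner ℝ v ((√s)⁻¹ • x)) * Complex.I) •
      SchwartzMap.smulLeftCLM ℂ p (gaussianSchwartz n (4 * Real.pi ^ 2) (by positivity)) v)
    (√s) (hR := h0.le)
  simp only [finrank_euclideanSpace, Fintype.card_fin] at this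
  have h1 : ((((√s) ^ (n + j))⁻¹ : ℝ) : ℂ) = ((((√s) ^ j)⁻¹ : ℝ) : ℂ) * ((((√s) ^ n)⁻¹ : ℝ) : ℂ) := by
    rw [← Complex.ofReal_mul, pow_add, mul_inv, mul_comm]
  rw [h1, mul_assoc ((((√s) ^ j)⁻¹ : ℝ) : ℂ), ← Complex.real_smul (x := ((√s) ^ n)⁻¹), ← this, ← integral_const_mul]
  refine integral_congr_ae (Eventually.of_forall fun ξ => ?_)
  simp only [hp, SchwartzMap.smulLeftCLM_apply_apply, gaussianSchwartz_apply, hhom, smul_eq_mul]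
  have e1 : inner ℝ (√s • ξ) ((√s)⁻¹ • x) = inner ℝ ξ x := by
    rw [inner_smul_left, inner_smul_right]; simp; field_simp
  have e2 : 4 * Real.pi ^ 2 * ‖√s • ξ‖ ^ 2 = 4 * Real.pi ^ 2 * s * ‖ξ‖ ^ 2 := by
    rw [norm_smul, mul_pow, Real.norm_of_nonneg h0.le, Real.sq_sqrt hs.le]; ring
  rw [e1, e2]
  have : ((√s : ℝ) : ℂ) ≠ 0 := by exact_mod_cast h0.ne'
  push_cast
  field_simp

/-- The symbol `2πi ξ_k` of `∂_k`. -/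
noncomputable def derivSymbol {n : ℕ} (k : Fin n) (ξ : E n) : ℂ :=
  2 * Real.pi * Complex.I * (ξ k : ℂ)

/-- The symbol `(2πi)³ ξ_j ξ_k ξ_l` of `∂_j ∂_k ∂_l`. -/
noncomputable def tripleSymbol {n : ℕ} (j k l : Fin n) (ξ : E n) : ℂ :=
  -(8 * Real.pi ^ 3 * Complex.I) * ((ξ j : ℂ) * (ξ k : ℂ) * (ξ l : ℂ))

theorem derivSymbol_growth {n : ℕ} (k : Fin n) : (derivSymbol k : E n → ℂ).HasTemperateGrowth := by
  have := hasTemperateGrowth_coord k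
  unfold derivSymbol; fun_prop

theorem tripleSymbol_growth {n : ℕ} (j k l : Fin n) :
    (tripleSymbol j k l : E n → ℂ).HasTemperateGrowth := by
  have := hasTemperateGrowth_coord j
  have := hasTemperateGrowth_coord k
  have := hasTemperateGrowth_coord l
  unfold tripleSymbol; fun_prop

theorem derivSymbol_smul {n : ℕ} (k : Fin n) (c : ℝ) (ξ : E n) :
    derivSymbol k (c • ξ) = (c : ℂ) ^ 1 * derivSymbol k ξ := by
  simp [derivSymbol]; ring

theorem tripleSymbol_smul {n : ℕ} (j k l : Fin n) (c : ℝ) (ξ : E n) :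
    tripleSymbol j k l (c • ξ) = (c : ℂ) ^ 3 * tripleSymbol j k l ξ := by
  simp [tripleSymbol]; ring

/-- The Gaussian `exp (-4π² |ξ|²)`, the symbol of `e^Δ`. -/
noncomputable def unitGaussian (n : ℕ) : 𝓢(E n, ℂ) :=
  gaussianSchwartz n (4 * Real.pi ^ 2) (by positivity)

/-- The profile of the kernel `∂_k g_s`, with `g_s` the heat kernel. -/
noncomputable def derivProfile {n : ℕ} (k : Fin n) : 𝓢(E n, ℂ) :=
  𝓕⁻ (SchwartzMap.smulLeftCLM ℂ (derivSymbol k) (unitGaussian n))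

/-- The profile of the kernel `∂_j ∂_k ∂_l g_s`, with `g_s` the heat kernel. -/
noncomputable def tripleProfile {n : ℕ} (j k l : Fin n) : 𝓢(E n, ℂ) :=
  𝓕⁻ (SchwartzMap.smulLeftCLM ℂ (tripleSymbol j k l) (unitGaussian n))

theorem integral_exp_neg_symbol {n : ℕ} {τ : ℝ} {ξ : E n} (hξ : ξ ≠ 0) :
    ∫ s in Ioi τ, Real.exp (-(4 * Real.pi ^ 2 * s * ‖ξ‖ ^ 2)) =
      Real.exp (-(4 * Real.pi ^ 2 * τ * ‖ξ‖ ^ 2)) / (4 * Real.pi ^ 2 * ‖ξ‖ ^ 2) := by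
  have hx : 0 < ‖ξ‖ := norm_pos_iff.2 hξ
  have := integral_exp_mul_Ioi (a := -(4 * Real.pi ^ 2 * ‖ξ‖ ^ 2))
    (by rw [neg_lt_zero]; positivity) τ
  rw [neg_div_neg_eq] at this
  rw [show -(4 * Real.pi ^ 2 * τ * ‖ξ‖ ^ 2) = -(4 * Real.pi ^ 2 * ‖ξ‖ ^ 2) * τ by ring, ← this]
  refine integral_congr_ae (Eventually.of_forall fun s => ?_)
  simp only; ring_nf

/-- The singular factor `1 / |ξ|²` of the projection is absorbed in an integral of Gaussians over
`s > τ`. -/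
theorem oseenSymbol_eq {n : ℕ} (τ : ℝ) (j k l : Fin n) (ξ : E n) :
    oseenSymbol τ j k l ξ =
      (if j = l then 1 else 0) * ((Real.exp (-(4 * Real.pi ^ 2 * τ * ‖ξ‖ ^ 2)) : ℂ) *
        derivSymbol k ξ) +
      ∫ s in Ioi τ, (Real.exp (-(4 * Real.pi ^ 2 * s * ‖ξ‖ ^ 2)) : ℂ) * tripleSymbol j k l ξ := by
  rw [integral_mul_const, integral_complex_ofReal]
  rcases eq_or_ne ξ 0 with rfl | hξ
  · simp [oseenSymbol, derivSymbol, tripleSymbol]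
  have hx : (‖ξ‖ : ℂ) ≠ 0 := by exact_mod_cast (norm_pos_iff.2 hξ).ne'
  have hpi : (Real.pi : ℂ) ≠ 0 := by exact_mod_cast Real.pi_pos.ne'
  rw [integral_exp_neg_symbol hξ]
  simp only [oseenSymbol, derivSymbol, tripleSymbol]
  split_ifs <;> push_cast <;> field_simp <;> ring

theorem integrable_gaussian_tripleSymbol {n : ℕ} {τ : ℝ} (hτ : 0 < τ) (j k l : Fin n) :
    Integrable (fun p : ℝ × E n => (Real.exp (-(4 * Real.pi ^ 2 * p.1 * ‖p.2‖ ^ 2)) : ℂ) *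
      tripleSymbol j k l p.2) ((volume.restrict (Ioi τ)).prod volume) := by
  have hm : Continuous (fun p : ℝ × E n => (Real.exp (-(4 * Real.pi ^ 2 * p.1 * ‖p.2‖ ^ 2)) : ℂ) *
      tripleSymbol j k l p.2) := by
    unfold tripleSymbol; fun_prop
  set f : 𝓢(E n, ℂ) := SchwartzMap.smulLeftCLM ℂ (tripleSymbol j k l) (unitGaussian n) with hf
  have hscale : ∀ s : ℝ, 0 < s → ∀ ξ : E n,
      (Real.exp (-(4 * Real.pi ^ 2 * s * ‖ξ‖ ^ 2)) : ℂ) * tripleSymbol j k l ξ =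
        ((((√s) ^ 3)⁻¹ : ℝ) : ℂ) * f (√s • ξ) := by
    intro s hs ξ
    have h0 : ((√s : ℝ) : ℂ) ≠ 0 := by exact_mod_cast (Real.sqrt_pos.2 hs).ne'
    rw [hf, SchwartzMap.smulLeftCLM_apply_apply (tripleSymbol_growth j k l), tripleSymbol_smul,
      unitGaussian, gaussianSchwartz_apply]
    rw [norm_smul, mul_pow, Real.norm_of_nonneg (Real.sqrt_nonneg s), Real.sq_sqrt hs.le,
      smul_eq_mul]
    rw [← mul_assoc (4 * Real.pi ^ 2) s]
    push_cast
    field_simp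
  rw [integrable_prod_iff hm.aestronglyMeasurable]
  constructor
  · filter_upwards [ae_restrict_mem measurableSet_Ioi] with s hs
    have hs0 : 0 < s := hτ.trans hs
    simp only [hscale s hs0]
    exact (f.integrable.comp_smul (Real.sqrt_pos.2 hs0).ne').const_mul _
  · have := ((integral_inv_sqrt_add_pow_three hτ.le le_rfl (by simpa using hτ)).1).mul_const
      (((√τ) ^ n)⁻¹ * ∫ ξ, ‖f ξ‖)
    refine Integrable.mono' this hm.norm.aestronglyMeasurable.integral_prod_right' ?_
    filter_upwards [ae_restrict_mem measurableSet_Ioi] with s hs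
    have hs0 : 0 < s := hτ.trans hs
    have h0 : 0 < √s := Real.sqrt_pos.2 hs0
    simp only [hscale s hs0, norm_mul, Complex.norm_real, norm_inv, norm_pow,
      Real.norm_of_nonneg h0.le]
    rw [integral_const_mul, Measure.integral_comp_smul_of_nonneg volume (fun x => ‖f x‖) (√s)
      (hR := h0.le), Real.norm_of_nonneg (by positivity), add_zero]
    simp only [finrank_euclideanSpace, Fintype.card_fin, smul_eq_mul]
    have : √τ ≤ √s := Real.sqrt_le_sqrt (le_of_lt hs)
    have : 0 < √τ := Real.sqrt_pos.2 hτ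
    gcongr

/-- `F_{j;k,l}(·, τ) = δ_{jl} ∂_k g_τ + ∫_τ^∞ ∂_j ∂_k ∂_l g_s ds`. -/
theorem fourierInv_oseenSymbol {n : ℕ} {τ : ℝ} (hτ : 0 < τ) (j k l : Fin n) (x : E n) :
    𝓕⁻ (oseenSymbol τ j k l) x =
      (if j = l then 1 else 0) * dilateKernel (derivProfile k) 1 τ x +
      ∫ s in Ioi τ, dilateKernel (tripleProfile j k l) 3 s x := by
  have hI := integrable_gaussian_tripleSymbol (n := n) hτ j k l
  have hexp : Continuous fun v : E n =>
      Complex.exp (↑(2 * Real.pi * inner ℝ v x) * Complex.I) := by fun_prop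
  have hnorm : ∀ v : E n, ‖Complex.exp (↑(2 * Real.pi * inner ℝ v x) * Complex.I)‖ = 1 :=
    fun v => Complex.norm_exp_ofReal_mul_I _
  have hI2 : Integrable (fun p : ℝ × E n =>
      Complex.exp (↑(2 * Real.pi * inner ℝ p.2 x) * Complex.I) *
      ((Real.exp (-(4 * Real.pi ^ 2 * p.1 * ‖p.2‖ ^ 2)) : ℂ) * tripleSymbol j k l p.2))
      ((volume.restrict (Ioi τ)).prod volume) :=
    hI.bdd_mul (c := 1) (hexp.comp continuous_snd).aestronglyMeasurable
      (Eventually.of_forall fun p => (hnorm p.2).le)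
  have hD : Integrable fun ξ : E n => Complex.exp (↑(2 * Real.pi * inner ℝ ξ x) * Complex.I) *
      ((Real.exp (-(4 * Real.pi ^ 2 * τ * ‖ξ‖ ^ 2)) : ℂ) * derivSymbol k ξ) := by
    refine Integrable.bdd_mul (c := 1) ?_ hexp.aestronglyMeasurable
      (Eventually.of_forall fun v => (hnorm v).le)
    have h := (SchwartzMap.smulLeftCLM ℂ (derivSymbol k) (gaussianSchwartz n
      (4 * Real.pi ^ 2 * τ) (by positivity))).integrable (μ := volume)
    refine h.congr (Eventually.of_forall fun ξ => ?_)
    simp only [SchwartzMap.smulLeftCLM_apply_apply (derivSymbol_growth k), gaussianSchwartz_apply,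
      smul_eq_mul]
    ring
  rw [← show 𝓕⁻ (fun ξ => (Real.exp (-(4 * Real.pi ^ 2 * τ * ‖ξ‖ ^ 2)) : ℂ) * derivSymbol k ξ) x =
    dilateKernel (derivProfile k) 1 τ x from
      fourierInv_gaussian_mul (derivSymbol_growth k) (derivSymbol_smul k) hτ x]
  have hG : ∫ s in Ioi τ, dilateKernel (tripleProfile j k l) 3 s x = ∫ s in Ioi τ,
      ∫ ξ : E n, Complex.exp (↑(2 * Real.pi * inner ℝ ξ x) * Complex.I) *
      ((Real.exp (-(4 * Real.pi ^ 2 * s * ‖ξ‖ ^ 2)) : ℂ) * tripleSymbol j k l ξ) := by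
    refine setIntegral_congr_fun measurableSet_Ioi fun s hs => ?_
    have := fourierInv_gaussian_mul (tripleSymbol_growth j k l) (tripleSymbol_smul j k l)
      (hτ.trans hs) x
    rw [Real.fourierInv_eq'] at this
    exact this.symm
  have hI3 : Integrable fun ξ : E n => ∫ s in Ioi τ,
      Complex.exp (↑(2 * Real.pi * inner ℝ ξ x) * Complex.I) *
      ((Real.exp (-(4 * Real.pi ^ 2 * s * ‖ξ‖ ^ 2)) : ℂ) * tripleSymbol j k l ξ) :=
    hI2.integral_prod_right
  rw [hG, Real.fourierInv_eq', Real.fourierInv_eq',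
    integral_integral_swap (f := fun s ξ => Complex.exp (↑(2 * Real.pi * inner ℝ ξ x) * Complex.I) *
      ((Real.exp (-(4 * Real.pi ^ 2 * s * ‖ξ‖ ^ 2)) : ℂ) * tripleSymbol j k l ξ)) hI2,
    ← integral_const_mul]
  simp only [smul_eq_mul]
  rw [← integral_add (hD.const_mul _) hI3]
  refine integral_congr_ae (Eventually.of_forall fun ξ => ?_)
  simp only [oseenSymbol_eq]
  rw [integral_const_mul]
  ring

theorem measurable_oseenKernel {n : ℕ} (j k l : Fin n) :
    Measurable fun p : ℝ × E n => oseenKernel p.1 j k l p.2 := by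
  unfold oseenKernel
  simp only [Real.fourierInv_eq']
  refine Complex.measurable_re.comp ?_
  refine StronglyMeasurable.measurable ?_
  have : Measurable fun q : (ℝ × E n) × E n =>
      Complex.exp (↑(2 * Real.pi * inner ℝ q.2 q.1.2) * Complex.I) •
        oseenSymbol q.1.1 j k l q.2 := by
    unfold oseenSymbol
    fun_prop
  exact this.stronglyMeasurable.integral_prod_right'

theorem integrable_tripleKernel {n : ℕ} {τ : ℝ} (hτ : 0 < τ) (f : 𝓢(E n, ℂ)) :
    Integrable (fun p : ℝ × E n => dilateKernel f 3 p.1 p.2)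
      ((volume.restrict (Ioi τ)).prod volume) := by
  rw [integrable_prod_iff (measurable_dilateKernel f 3).aestronglyMeasurable]
  constructor
  · filter_upwards [ae_restrict_mem measurableSet_Ioi] with s hs
    exact integrable_dilateKernel f 3 (hτ.trans hs)
  · refine (((integral_inv_sqrt_add_pow_three hτ.le le_rfl (by simpa using hτ)).1).mul_const (∫ ξ, ‖f ξ‖)).congr ?_
    filter_upwards [ae_restrict_mem measurableSet_Ioi] with s hs
    rw [integral_norm_dilateKernel f 3 (hτ.trans hs), add_zero]

theorem integral_norm_tripleKernel_le {n : ℕ} {τ : ℝ} (hτ : 0 < τ) (f : 𝓢(E n, ℂ)) :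
    ∫ s in Ioi τ, ∫ x, ‖dilateKernel f 3 s x‖ ≤ 4 * (√τ)⁻¹ * ∫ ξ, ‖f ξ‖ := by
  have h1 : ∫ s in Ioi τ, ∫ x, ‖dilateKernel f 3 s x‖ =
      ∫ s in Ioi τ, ((√s + 0) ^ 3)⁻¹ * ∫ ξ, ‖f ξ‖ := by
    refine setIntegral_congr_fun measurableSet_Ioi fun s hs => ?_
    rw [integral_norm_dilateKernel f 3 (hτ.trans hs), add_zero]
  rw [h1, integral_mul_const]
  have := (integral_inv_sqrt_add_pow_three hτ.le le_rfl (by simpa using hτ)).2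
  rw [add_zero] at this
  gcongr

theorem measurable_oseenKernel_apply {n : ℕ} (τ : ℝ) (j k l : Fin n) :
    Measurable (oseenKernel τ j k l : E n → ℝ) := by
  have h := (measurable_oseenKernel j k l).comp (measurable_prodMk_left (x := τ))
  simpa only [Function.comp_def] using h

theorem integrable_integral_norm_oseenKernel {n : ℕ} {τ : ℝ} (hτ : 0 < τ) (j k l : Fin n) :
    Integrable (oseenKernel τ j k l) ∧ ∫ x, |oseenKernel τ j k l x| ≤
      ((∫ x, ‖derivProfile k x‖) + 4 * ∫ x, ‖tripleProfile j k l x‖) * (√τ)⁻¹ := by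
  have hT := integrable_tripleKernel hτ (tripleProfile j k l)
  have hT2 : Integrable fun x => ∫ s in Ioi τ, ‖dilateKernel (tripleProfile j k l) 3 s x‖ :=
    hT.norm.integral_prod_right
  have hD := (integrable_dilateKernel (derivProfile k) 1 hτ).norm
  have hsum : Integrable fun x => ‖dilateKernel (derivProfile k) 1 τ x‖ +
      ∫ s in Ioi τ, ‖dilateKernel (tripleProfile j k l) 3 s x‖ := hD.add hT2
  have hle : ∀ x, |oseenKernel τ j k l x| ≤ ‖dilateKernel (derivProfile k) 1 τ x‖ +
      ∫ s in Ioi τ, ‖dilateKernel (tripleProfile j k l) 3 s x‖ := by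
    intro x
    rw [oseenKernel]
    refine (Complex.abs_re_le_norm _).trans ?_
    rw [fourierInv_oseenSymbol hτ]
    refine (norm_add_le _ _).trans (add_le_add ?_ (norm_integral_le_integral_norm _))
    split_ifs <;> simp
  have hm := measurable_oseenKernel_apply τ j k l
  have hio : Integrable (oseenKernel τ j k l : E n → ℝ) :=
    hsum.mono' hm.aestronglyMeasurable (Eventually.of_forall hle)
  refine ⟨hio, (integral_mono hio.abs hsum hle).trans ?_⟩
  rw [integral_add hD hT2,
    ← integral_integral_swap (f := fun s x => ‖dilateKernel (tripleProfile j k l) 3 s x‖) hT.norm,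
    integral_norm_dilateKernel _ 1 hτ, pow_one, add_mul, mul_comm (√τ)⁻¹]
  refine add_le_add le_rfl ((integral_norm_tripleKernel_le hτ (tripleProfile j k l)).trans_eq ?_)
  rw [mul_right_comm]

theorem integrable_tripleKernel_mul {n : ℕ} {τ B : ℝ} (hτ : 0 < τ) (f : 𝓢(E n, ℂ)) {R : E n → ℝ}
    (hR : AEStronglyMeasurable R) (hB : ∀ y, |R y| ≤ B) (x : E n) :
    Integrable (fun p : ℝ × E n => dilateKernel f 3 p.1 (x - p.2) * (R p.2 : ℂ))
      ((volume.restrict (Ioi τ)).prod volume) := by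
  have hmp := (MeasurePreserving.id (volume.restrict (Ioi τ))).prod
    (volume.measurePreserving_sub_left x)
  have h := hmp.integrable_comp_of_integrable (integrable_tripleKernel hτ f)
  refine h.mul_bdd (c := B) ?_ (Eventually.of_forall fun p => ?_)
  · exact Complex.continuous_ofReal.comp_aestronglyMeasurable hR.comp_snd
  · rw [Complex.norm_real]; exact hB p.2

/-- Finitely many upper bounds have a common nonnegative one. -/
theorem exists_uniform_bound {ι : Type*} [Finite ι] {P : ι → ℝ → Prop}
    (hmono : ∀ i C C', C ≤ C' → P i C → P i C') (h : ∀ i, ∃ C, P i C) :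
    ∃ C, 0 ≤ C ∧ ∀ i, P i C := by
  cases nonempty_fintype ι
  choose C hC using h
  refine ⟨∑ i, |C i|, by positivity, fun i => hmono i _ _ ?_ (hC i)⟩
  exact (le_abs_self _).trans
    (Finset.single_le_sum (f := fun i => |C i|) (fun i _ => abs_nonneg _) (Finset.mem_univ i))

/-- The kernel of `e^{τΔ} ℙ div` has `L¹` norm `O(τ^{-1/2})`. -/
theorem exists_integral_oseenKernel_le (n : ℕ) : ∃ C, 0 ≤ C ∧ ∀ τ : ℝ, 0 < τ → ∀ j k l : Fin n,
    ∫ x, |oseenKernel τ j k l x| ≤ C * (√τ)⁻¹ := by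
  obtain ⟨C, hC, h⟩ := exists_uniform_bound (ι := Fin n × Fin n × Fin n)
    (P := fun i C => ∀ τ : ℝ, 0 < τ → ∫ x, |oseenKernel τ i.1 i.2.1 i.2.2 x| ≤ C * (√τ)⁻¹)
    (fun i C C' hCC h τ hτ => (h τ hτ).trans (by gcongr))
    (fun i => ⟨_, fun τ hτ => (integrable_integral_norm_oseenKernel hτ _ _ _).2⟩)
  exact ⟨C, hC, fun τ hτ j k l => h (j, k, l) τ hτ⟩

/-- The convolution with the Oseen kernel splits into its local part and its nonlocal tail. -/
theorem abs_oseen_convolution_le_split {n : ℕ} {τ B : ℝ} (hτ : 0 < τ) (j k l : Fin n)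
    {R : E n → ℝ} (hRi : Integrable R) (hB : ∀ y, |R y| ≤ B) (x : E n) :
    |∫ y, oseenKernel τ j k l (x - y) * R y| ≤
      ‖∫ y, dilateKernel (derivProfile k) 1 τ (x - y) * (R y : ℂ)‖ +
      ‖∫ s in Ioi τ, ∫ y, dilateKernel (tripleProfile j k l) 3 s (x - y) * (R y : ℂ)‖ := by
  have hD := integrable_dilateKernel_mul (derivProfile k) 1 (s := τ) hRi x
  have hT := integrable_tripleKernel_mul hτ (tripleProfile j k l) hRi.aestronglyMeasurable hB x
  have hTi : Integrable fun y => (∫ s in Ioi τ,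
      dilateKernel (tripleProfile j k l) 3 s (x - y)) * (R y : ℂ) := by
    simpa only [integral_mul_const] using hT.integral_prod_right
  have heq : ∫ y, 𝓕⁻ (oseenSymbol τ j k l) (x - y) * (R y : ℂ) =
      (if j = l then 1 else 0) * (∫ y, dilateKernel (derivProfile k) 1 τ (x - y) * (R y : ℂ)) +
      ∫ s in Ioi τ, ∫ y, dilateKernel (tripleProfile j k l) 3 s (x - y) * (R y : ℂ) := by
    rw [integral_integral_swap (f := fun s y => dilateKernel (tripleProfile j k l) 3 s (x - y) *
      (R y : ℂ)) hT, ← integral_const_mul]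
    simp only [integral_mul_const]
    rw [← integral_add (hD.const_mul _) hTi]
    refine integral_congr_ae (Eventually.of_forall fun y => ?_)
    simp only [fourierInv_oseenSymbol hτ]
    ring
  have hre : ∫ y, oseenKernel τ j k l (x - y) * R y =
      (∫ y, 𝓕⁻ (oseenSymbol τ j k l) (x - y) * (R y : ℂ)).re := by
    have hint : Integrable fun y => 𝓕⁻ (oseenSymbol τ j k l) (x - y) * (R y : ℂ) := by
      refine ((hD.const_mul (if j = l then 1 else 0)).add hTi).congr
        (Eventually.of_forall fun y => ?_)
      simp only [fourierInv_oseenSymbol hτ, Pi.add_apply]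
      ring
    have := integral_re hint
    simp only [RCLike.re_to_complex, Complex.re_mul_ofReal] at this
    exact this
  rw [hre, heq]
  refine (Complex.abs_re_le_norm _).trans ((norm_add_le _ _).trans (add_le_add ?_ le_rfl))
  split_ifs <;> simp

/-- The contribution of `∂_k g_τ` to the convolution with the Oseen kernel. -/
theorem exists_local_convolution_le (n N : ℕ) : ∃ C, 0 ≤ C ∧ ∀ k : Fin n, ∀ τ : ℝ, 0 < τ →
    ∀ (b S : ℝ), 0 < b → 0 ≤ S → ∀ R : E n → ℝ,
      VanishingMoments N R → (∀ᵐ y, |R y| ≤ S / (b + ‖y‖) ^ (n + 1 + N)) → ∀ x : E n,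
      ‖∫ y, dilateKernel (derivProfile k) 1 τ (x - y) * (R y : ℂ)‖ ≤
        C * ((∫ y, ‖y‖ ^ N * |R y|) / (√τ + ‖x‖) ^ (n + 1 + N) +
          S * (√τ)⁻¹ / (b + (√τ + ‖x‖)) ^ (n + 1 + N)) := by
  refine exists_uniform_bound
    (fun k C C' hCC h s hs b S hb hS R hR hRb x => (h s hs b S hb hS R hR hRb x).trans ?_)
    (fun k => ?_)
  · have : 0 ≤ ∫ y, ‖y‖ ^ N * |R y| := integral_nonneg fun y => by positivity
    gcongr
  · obtain ⟨C, -, h⟩ := norm_convolution_dilateKernel_le (derivProfile k) 1 N (n + 1 + N)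
      (n + 1 + N)
    refine ⟨C, fun τ hτ b S hb hS R hR hRb x => (h τ hτ b S hb hS R hR hRb x).trans_eq ?_⟩
    generalize ∫ y, ‖y‖ ^ N * |R y| = I
    have h0 : 0 < √τ := Real.sqrt_pos.2 hτ
    have h1 : √τ + ‖x‖ ≠ 0 := by positivity
    have h2 : b + (√τ + ‖x‖) ≠ 0 := by positivity
    rw [pow_one]
    congr 1
    field_simp

/-- The contribution of `∫_τ^∞ ∂_j ∂_k ∂_l g_s ds` to the convolution with the Oseen kernel: the
factor `s^{-3/2}` from three derivatives makes the integral in `s` converge. -/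
theorem exists_tail_convolution_le (n N : ℕ) : ∃ C, 0 ≤ C ∧ ∀ i : Fin n × Fin n × Fin n,
    ∀ τ : ℝ, 0 < τ → ∀ (b S : ℝ), 0 < b → 0 ≤ S → ∀ R : E n → ℝ,
      VanishingMoments N R → (∀ᵐ y, |R y| ≤ S / (b + ‖y‖) ^ (n + 1 + N)) → ∀ x : E n,
      ‖∫ s in Ioi τ, ∫ y, dilateKernel (tripleProfile i.1 i.2.1 i.2.2) 3 s (x - y) * (R y : ℂ)‖ ≤
        C * ((∫ y, ‖y‖ ^ N * |R y|) / (√τ + ‖x‖) ^ (n + 1 + N) +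
          S * (√τ)⁻¹ / (b + (√τ + ‖x‖)) ^ (n + 1 + N)) := by
  refine exists_uniform_bound
    (fun k C C' hCC h s hs b S hb hS R hR hRb x => (h s hs b S hb hS R hR hRb x).trans ?_)
    (fun i => ?_)
  · have : 0 ≤ ∫ y, ‖y‖ ^ N * |R y| := integral_nonneg fun y => by positivity
    gcongr
  · obtain ⟨C, hC, h⟩ := norm_convolution_dilateKernel_le (tripleProfile i.1 i.2.1 i.2.2) 3 N
      (n + 3 + N) (n + 1 + N)
    refine ⟨C * 4, fun τ hτ b S hb hS R hR hRb x => ?_⟩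
    have h' := fun s hs => h s hs b S hb hS R hR hRb x
    have hI : 0 ≤ ∫ y, ‖y‖ ^ N * |R y| := integral_nonneg fun y => by positivity
    generalize ∫ y, ‖y‖ ^ N * |R y| = I at h' hI ⊢
    have h0 : 0 < √τ := Real.sqrt_pos.2 hτ
    have hX := norm_nonneg x
    have hρ0 : 0 < √τ + ‖x‖ := by positivity
    have hBs' : ∀ s ∈ Ioi τ,
        ‖∫ y, dilateKernel (tripleProfile i.1 i.2.1 i.2.2) 3 s (x - y) * (R y : ℂ)‖ ≤
        C * (I / (√τ + ‖x‖) ^ (n + N) * ((√s + ‖x‖) ^ 3)⁻¹ +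
          S / (b + (√τ + ‖x‖)) ^ (n + 1 + N) * ((√s + 0) ^ 3)⁻¹) := by
      intro s hs
      have hs0 : 0 < s := hτ.trans hs
      have hs1 : √τ ≤ √s := Real.sqrt_le_sqrt (le_of_lt hs)
      have hs2 : 0 < √s := h0.trans_le hs1
      refine (h' s hs0).trans ?_
      have e1 : (√s) ^ (n + 3 + N) / ((√s) ^ (n + 3 + N) * (√s + ‖x‖) ^ (n + 3 + N)) * I =
          I / (√s + ‖x‖) ^ (n + N) * ((√s + ‖x‖) ^ 3)⁻¹ := by
        rw [show n + 3 + N = (n + N) + 3 by ring, pow_add (√s + ‖x‖)]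
        have : √s + ‖x‖ ≠ 0 := by positivity
        field_simp
      rw [e1, add_zero, mul_comm (((√s) ^ 3)⁻¹)]
      gcongr
    have hi1 := integral_inv_sqrt_add_pow_three hτ.le hX (by positivity)
    have hi2 := integral_inv_sqrt_add_pow_three hτ.le (le_refl (0 : ℝ)) (by simpa using hτ)
    refine (norm_integral_le_of_norm_le (((hi1.1.const_mul _).add
      (hi2.1.const_mul _)).const_mul C) ((ae_restrict_mem measurableSet_Ioi).mono hBs')).trans ?_
    simp only [Pi.add_apply]
    rw [integral_const_mul, integral_add (hi1.1.const_mul _) (hi2.1.const_mul _),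
      integral_const_mul, integral_const_mul, mul_assoc]
    have h5 := hi2.2
    rw [add_zero (√τ)] at h5
    refine mul_le_mul_of_nonneg_left ?_ hC
    calc _ ≤ I / (√τ + ‖x‖) ^ (n + N) * (4 * (√τ + ‖x‖)⁻¹) +
          S / (b + (√τ + ‖x‖)) ^ (n + 1 + N) * (4 * (√τ)⁻¹) :=
          add_le_add (mul_le_mul_of_nonneg_left hi1.2 (by positivity))
            (mul_le_mul_of_nonneg_left h5 (by positivity))
      _ = _ := by
          rw [show n + 1 + N = (n + N) + 1 by ring, pow_succ (√τ + ‖x‖)]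
          have h2 : b + (√τ + ‖x‖) ≠ 0 := by positivity
          field_simp

/-- Convolution of the Oseen kernel with a decaying function whose moments of order `< N` vanish.
The decay `(b + |x| + √τ)^{-(n+1+N)}` is that of the derivatives of order `N` of the kernel. -/
theorem exists_oseen_convolution_le (n N : ℕ) : ∃ C, 0 ≤ C ∧ ∀ τ : ℝ, 0 < τ → ∀ j k l : Fin n,
    ∀ (b S : ℝ), 0 < b → 0 ≤ S → ∀ R : E n → ℝ,
      VanishingMoments N R → (∀ y, |R y| ≤ S / (b + ‖y‖) ^ (n + 1 + N)) → ∀ x : E n,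
      |∫ y, oseenKernel τ j k l (x - y) * R y| ≤
        C * ((∫ y, ‖y‖ ^ N * |R y|) + S * (√τ)⁻¹) / (b + (√τ + ‖x‖)) ^ (n + 1 + N) := by
  obtain ⟨C₁, hC₁, h₁⟩ := exists_integral_oseenKernel_le n
  obtain ⟨C₂, hC₂, h₂⟩ := exists_local_convolution_le n N
  obtain ⟨C₃, hC₃, h₃⟩ := exists_tail_convolution_le n N
  refine ⟨2 ^ (n + 1 + N) * (C₁ + C₂ + C₃), by positivity,
    fun τ hτ j k l b S hb hS R hR hRb x => ?_⟩
  have h0 : 0 < √τ := Real.sqrt_pos.2 hτ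
  have hA := h₂ k τ hτ b S hb hS R hR (Eventually.of_forall hRb) x
  have hB := h₃ (j, k, l) τ hτ b S hb hS R hR (Eventually.of_forall hRb) x
  have hsup : ∀ y, |R y| ≤ S / b ^ (n + 1 + N) := fun y => (hRb y).trans (by
    gcongr; linarith [norm_nonneg y])
  have hsplit := abs_oseen_convolution_le_split hτ j k l hR.integrable hsup x
  have hK := (integrable_integral_norm_oseenKernel hτ j k l).1.comp_sub_left x
  have hI : 0 ≤ ∫ y, ‖y‖ ^ N * |R y| := integral_nonneg fun y => by positivity
  generalize ∫ y, ‖y‖ ^ N * |R y| = I at *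
  clear h₂ h₃
  generalize he : n + 1 + N = e at *
  generalize hρ : √τ + ‖x‖ = ρ at *
  have hρ0 : 0 < ρ := by rw [← hρ]; positivity
  rcases le_total b ρ with hbρ | hbρ
  · -- far from the origin or at late times, the Taylor expansion of the kernel is effective
    have hfar : I / ρ ^ e ≤ 2 ^ e * (I / (b + ρ) ^ e) := by
      rw [← mul_div_assoc, div_le_div_iff₀ (by positivity) (by positivity)]
      calc I * (b + ρ) ^ e ≤ I * (2 * ρ) ^ e := by gcongr; linarith
        _ = _ := by rw [mul_pow]; ring
    have h2e : (1 : ℝ) ≤ 2 ^ e := one_le_pow₀ (by norm_num)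
    calc _ ≤ (C₂ + C₃) * (I / ρ ^ e + S * (√τ)⁻¹ / (b + ρ) ^ e) := by
          rw [add_mul]; exact hsplit.trans (add_le_add hA hB)
      _ ≤ (C₂ + C₃) * (2 ^ e * (I / (b + ρ) ^ e) + 2 ^ e * (S * (√τ)⁻¹ / (b + ρ) ^ e)) := by
          gcongr
          exact le_mul_of_one_le_left (by positivity) h2e
      _ = 2 ^ e * (C₂ + C₃) * (I + S * (√τ)⁻¹) / (b + ρ) ^ e := by ring
      _ ≤ _ := by
          gcongr
          linarith
  · -- close to the origin, the `L¹` bound of the kernel suffices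
    calc |∫ y, oseenKernel τ j k l (x - y) * R y|
        ≤ ∫ y, |oseenKernel τ j k l (x - y) * R y| := abs_integral_le_integral_abs
      _ ≤ ∫ y, |oseenKernel τ j k l (x - y)| * (S / b ^ e) := by
          refine integral_mono_of_nonneg (Eventually.of_forall fun y => abs_nonneg _)
            (hK.abs.mul_const _) (Eventually.of_forall fun y => ?_)
          simp only [abs_mul]
          gcongr
          exact hsup y
      _ ≤ C₁ * (√τ)⁻¹ * (S / b ^ e) := by
          rw [integral_mul_const,
            integral_sub_left_eq_self (fun y => |oseenKernel τ j k l y|) volume x]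
          gcongr
          exact h₁ τ hτ j k l
      _ ≤ 2 ^ e * C₁ * (S * (√τ)⁻¹) / (b + ρ) ^ e := by
          have h2 : (b + ρ) ^ e ≤ 2 ^ e * b ^ e := by
            rw [← mul_pow]; gcongr; linarith
          rw [← mul_div_assoc, div_le_div_iff₀ (by positivity) (by positivity)]
          calc C₁ * (√τ)⁻¹ * S * (b + ρ) ^ e ≤ C₁ * (√τ)⁻¹ * S * (2 ^ e * b ^ e) := by gcongr
            _ = _ := by ring
      _ ≤ _ := by
          gcongr
          · linarith
          · linarith

/-! ### The heat kernel -/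

/-- The profile `(4π)^{-n/2} exp (-|x|²/4)` of the heat kernel. -/
noncomputable def heatProfile (n : ℕ) : 𝓢(E n, ℂ) :=
  (((4 * Real.pi) ^ (-(n : ℝ) / 2) : ℝ) : ℂ) • gaussianSchwartz n (1 / 4) (by norm_num)

theorem heatKernel_eq_dilateKernel {n : ℕ} {t : ℝ} (ht : 0 < t) (x : E n) :
    (heatKernel t x : ℂ) = dilateKernel (heatProfile n) 0 t x := by
  have h0 : 0 < √t := Real.sqrt_pos.2 ht
  rw [dilateKernel, heatProfile, smul_apply, gaussianSchwartz_apply, smul_eq_mul,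
    ← Complex.ofReal_mul, ← Complex.ofReal_mul, heatKernel, Complex.ofReal_inj, ← mul_assoc]
  congr 1
  · rw [Real.mul_rpow (by positivity) ht.le, mul_comm]
    congr 1
    rw [add_zero, Real.sqrt_eq_rpow, ← Real.rpow_natCast, ← Real.rpow_mul ht.le,
      ← Real.rpow_neg ht.le]
    congr 1
    ring
  · rw [norm_smul, norm_inv, mul_pow, inv_pow, Real.norm_of_nonneg h0.le, Real.sq_sqrt ht.le]
    congr 1
    field_simp

theorem measurable_heatKernel (n : ℕ) :
    Measurable fun p : ℝ × E n => heatKernel p.1 p.2 := by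
  unfold heatKernel; fun_prop

theorem measurable_heatKernel_apply {n : ℕ} (t : ℝ) : Measurable (heatKernel t : E n → ℝ) := by
  unfold heatKernel; fun_prop

theorem integrable_heatKernel {n : ℕ} {t : ℝ} (ht : 0 < t) :
    Integrable (heatKernel t : E n → ℝ) := by
  have h := (integrable_dilateKernel (heatProfile n) 0 ht).re
  refine h.congr (Eventually.of_forall fun x => ?_)
  simp only [← heatKernel_eq_dilateKernel ht]
  simp

theorem integral_abs_heatKernel {n : ℕ} {t : ℝ} (ht : 0 < t) :
    ∫ x : E n, |heatKernel t x| = ∫ x, ‖heatProfile n x‖ := by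
  have h := integral_norm_dilateKernel (heatProfile n) 0 ht
  simp only [← heatKernel_eq_dilateKernel ht, Complex.norm_real, Real.norm_eq_abs] at h
  simpa using h

/-- Decay of the heat flow of a decaying function whose moments of order `< N` vanish. -/
theorem exists_heat_convolution_le (n N d : ℕ) : ∃ C, 0 ≤ C ∧ ∀ t : ℝ, 0 < t → ∀ S : ℝ, 0 ≤ S →
    ∀ R : E n → ℝ, VanishingMoments N R → (∀ᵐ y, |R y| ≤ S / (1 + ‖y‖) ^ d) → ∀ x : E n,
      |∫ y, heatKernel t (x - y) * R y| ≤
        C * ((√t) ^ d / (√t) ^ (n + N) * (∫ y, ‖y‖ ^ N * |R y|) + S) /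
          (1 + (√t + ‖x‖)) ^ d := by
  obtain ⟨C, hC, h⟩ := norm_convolution_dilateKernel_le (heatProfile n) 0 N d d
  refine ⟨2 ^ d * (C + ∫ x, ‖heatProfile n x‖), by positivity, fun t ht S hS R hR hRb x => ?_⟩
  have h0 : 0 < √t := Real.sqrt_pos.2 ht
  have h' := h t ht 1 S one_pos hS R hR hRb x
  have hre : |∫ y, heatKernel t (x - y) * R y| ≤
      ‖∫ y, dilateKernel (heatProfile n) 0 t (x - y) * (R y : ℂ)‖ := by
    simp only [← heatKernel_eq_dilateKernel ht, ← Complex.ofReal_mul]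
    rw [integral_complex_ofReal, Complex.norm_real, Real.norm_eq_abs]
  have hK := ((integrable_heatKernel (n := n) ht).comp_sub_left x).abs
  have hF := integral_abs_heatKernel (n := n) ht
  have hF0 : 0 ≤ ∫ x, ‖heatProfile n x‖ := integral_nonneg fun y => norm_nonneg _
  have hI : 0 ≤ ∫ y, ‖y‖ ^ N * |R y| := integral_nonneg fun y => by positivity
  generalize ∫ y, ‖y‖ ^ N * |R y| = I at *
  generalize ∫ x, ‖heatProfile n x‖ = F at *
  generalize hρ : √t + ‖x‖ = ρ at *
  have hρ0 : 0 < ρ := by rw [← hρ]; positivity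
  rcases le_total 1 ρ with hbρ | hbρ
  · have hfar : 1 / ρ ^ d ≤ 2 ^ d * (1 / (1 + ρ) ^ d) := by
      rw [← mul_div_assoc, div_le_div_iff₀ (by positivity) (by positivity)]
      calc 1 * (1 + ρ) ^ d ≤ 1 * (2 * ρ) ^ d := by gcongr; linarith
        _ = _ := by rw [mul_pow]; ring
    have h2e : (1 : ℝ) ≤ 2 ^ d := one_le_pow₀ (by norm_num)
    calc _ ≤ C * ((√t) ^ d / (√t) ^ (n + N) * I * (1 / ρ ^ d) + S / (1 + ρ) ^ d) := by
          refine hre.trans (h'.trans_eq ?_)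
          rw [pow_zero, add_zero]
          congr 1
          field_simp
      _ ≤ C * ((√t) ^ d / (√t) ^ (n + N) * I * (2 ^ d * (1 / (1 + ρ) ^ d)) +
            2 ^ d * (S / (1 + ρ) ^ d)) := by
          gcongr
          exact le_mul_of_one_le_left (by positivity) h2e
      _ = 2 ^ d * C * ((√t) ^ d / (√t) ^ (n + N) * I + S) / (1 + ρ) ^ d := by ring
      _ ≤ _ := by
          gcongr
          linarith
  · calc |∫ y, heatKernel t (x - y) * R y|
        ≤ ∫ y, |heatKernel t (x - y) * R y| := abs_integral_le_integral_abs
      _ ≤ ∫ y, |heatKernel t (x - y)| * S := by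
          refine integral_mono_of_nonneg (Eventually.of_forall fun y => abs_nonneg _)
            (hK.mul_const _) ?_
          filter_upwards [hRb] with y hy
          simp only [abs_mul]
          gcongr
          refine hy.trans (div_le_self hS (one_le_pow₀ ?_))
          linarith [norm_nonneg y]
      _ = F * S := by
          rw [integral_mul_const,
            integral_sub_left_eq_self (fun y => |heatKernel t y|) volume x, hF]
      _ ≤ 2 ^ d * F * S / (1 + ρ) ^ d := by
          have h2 : (1 + ρ) ^ d ≤ 2 ^ d := by gcongr; linarith
          rw [le_div_iff₀ (by positivity)]
          calc F * S * (1 + ρ) ^ d ≤ F * S * 2 ^ d := by gcongr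
            _ = _ := by ring
      _ ≤ _ := by
          gcongr
          · linarith
          · exact le_add_of_nonneg_left (by positivity)

/-! ### The Oseen kernel is divergence free -/

theorem integrable_oseenSymbol {n : ℕ} {τ : ℝ} (hτ : 0 < τ) (j k l : Fin n) :
    Integrable (oseenSymbol τ j k l) := by
  have h1 : Integrable fun ξ : E n =>
      (Real.exp (-(4 * Real.pi ^ 2 * τ * ‖ξ‖ ^ 2)) : ℂ) * derivSymbol k ξ := by
    have h := (SchwartzMap.smulLeftCLM ℂ (derivSymbol k) (gaussianSchwartz n
      (4 * Real.pi ^ 2 * τ) (by positivity))).integrable (μ := volume)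
    refine h.congr (Eventually.of_forall fun ξ => ?_)
    simp only [SchwartzMap.smulLeftCLM_apply_apply (derivSymbol_growth k), gaussianSchwartz_apply,
      smul_eq_mul]
    ring
  have h2 : Integrable fun ξ : E n => ∫ s in Ioi τ,
      (Real.exp (-(4 * Real.pi ^ 2 * s * ‖ξ‖ ^ 2)) : ℂ) * tripleSymbol j k l ξ :=
    (integrable_gaussian_tripleSymbol hτ j k l).integral_prod_right
  exact ((h1.const_mul (if j = l then 1 else 0)).add h2).congr
    (Eventually.of_forall fun ξ => (oseenSymbol_eq τ j k l ξ).symm)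

theorem integral_mul_fourierInv_eq {n : ℕ} {f g : E n → ℂ} (hf : Integrable f) (hg : Integrable g) :
    ∫ x, f x * 𝓕⁻ g x = ∫ ξ, 𝓕⁻ f ξ * g ξ := by
  have hi : Integrable (fun p : E n × E n =>
      Complex.exp (↑(2 * Real.pi * inner ℝ p.2 p.1) * Complex.I) * (f p.1 * g p.2))
      (volume.prod volume) := by
    refine (hf.mul_prod hg).bdd_mul (c := 1) ?_ (Eventually.of_forall fun p => ?_)
    · exact Continuous.aestronglyMeasurable (by fun_prop)
    · exact (Complex.norm_exp_ofReal_mul_I _).le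
  have hs := integral_integral_swap (f := fun x ξ =>
    Complex.exp (↑(2 * Real.pi * inner ℝ ξ x) * Complex.I) * (f x * g ξ)) hi
  simp only [Real.fourierInv_eq', smul_eq_mul]
  rw [show (∫ x, f x * ∫ v, Complex.exp (↑(2 * Real.pi * inner ℝ v x) * Complex.I) * g v) =
    ∫ x, ∫ ξ, Complex.exp (↑(2 * Real.pi * inner ℝ ξ x) * Complex.I) * (f x * g ξ) by
      congr 1; ext x; rw [← integral_const_mul]; congr 1; ext ξ; ring, hs]
  congr 1; ext ξ
  rw [← integral_mul_const]
  congr 1; ext x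
  rw [real_inner_comm]; ring

/-- The divergence of the columns of the Oseen kernel, on the Fourier side. -/
theorem sum_coord_mul_oseenSymbol {n : ℕ} (τ : ℝ) (k l : Fin n) (ξ : E n) :
    ∑ j, (ξ j : ℂ) * oseenSymbol τ j k l ξ = 0 := by
  rcases eq_or_ne ξ 0 with rfl | hξ
  · simp
  have hx : ‖ξ‖ ≠ 0 := norm_ne_zero_iff.2 hξ
  have h : ∑ j, ξ j * ((if j = l then 1 else 0) - ξ j * ξ l / ‖ξ‖ ^ 2) = 0 := by
    have h1 : ∑ j, ξ j * (ξ j * ξ l / ‖ξ‖ ^ 2) = (∑ j, ξ j ^ 2) * (ξ l / ‖ξ‖ ^ 2) := by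
      rw [Finset.sum_mul]
      exact Finset.sum_congr rfl fun j _ => by ring
    simp only [mul_sub, Finset.sum_sub_distrib, mul_ite, mul_one, mul_zero, Finset.sum_ite_eq',
      Finset.mem_univ, if_true]
    rw [h1, ← EuclideanSpace.real_norm_sq_eq]
    field_simp
    ring
  have h2 : ∑ j, (ξ j : ℂ) * oseenSymbol τ j k l ξ =
      (Real.exp (-(4 * Real.pi ^ 2 * τ * ‖ξ‖ ^ 2)) : ℂ) * (2 * Real.pi * Complex.I * (ξ k : ℂ)) *
      ((∑ j, ξ j * ((if j = l then 1 else 0) - ξ j * ξ l / ‖ξ‖ ^ 2) : ℝ) : ℂ) := by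
    rw [Complex.ofReal_sum, Finset.mul_sum]
    refine Finset.sum_congr rfl fun j _ => ?_
    rw [oseenSymbol, Complex.ofReal_mul]
    ring
  rw [h2, h]; simp

theorem integrable_fourierInv_oseenSymbol {n : ℕ} {τ : ℝ} (hτ : 0 < τ) (j k l : Fin n) :
    Integrable (𝓕⁻ (oseenSymbol τ j k l)) := by
  have h2 : Integrable fun x => ∫ s in Ioi τ, dilateKernel (tripleProfile j k l) 3 s x :=
    (integrable_tripleKernel hτ (tripleProfile j k l)).integral_prod_right
  exact (((integrable_dilateKernel (derivProfile k) 1 hτ).const_mul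
    (if j = l then 1 else 0)).add h2).congr
    (Eventually.of_forall fun x => (fourierInv_oseenSymbol hτ j k l x).symm)

/-- The columns of the kernel of `e^{τΔ} ℙ div` are divergence free in the sense of
distributions. -/
theorem sum_integral_partialDeriv_mul_oseenKernel {n : ℕ} {τ : ℝ} (hτ : 0 < τ) (k l : Fin n)
    {φ : E n → ℝ} (hφ : ContDiff ℝ ∞ φ) (hc : HasCompactSupport φ) (y : E n) :
    ∑ j, ∫ x, partialDeriv j φ x * oseenKernel τ j k l (x - y) = 0 := by
  -- The translated test function, as a Schwartz function, to use the Fourier transform.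
  let ψ : 𝓢(E n, ℂ) := HasCompactSupport.toSchwartzMap (f := fun x => (φ (x + y) : ℂ))
    ((hc.comp_homeomorph (Homeomorph.addRight y)).comp_left Complex.ofReal_zero)
    (Complex.ofRealCLM.contDiff.comp (hφ.comp (by fun_prop)))
  have hψ : ∀ j x, (∂_{(EuclideanSpace.single j 1 : E n)} ψ) x = (partialDeriv j φ (x + y) : ℂ) := by
    intro j x
    rw [SchwartzMap.lineDerivOp_apply_eq_fderiv]
    have h1 : HasFDerivAt φ (fderiv ℝ φ (x + y)) (x + y) :=
      (hφ.differentiable (by simp)).differentiableAt.hasFDerivAt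
    have h2 : HasFDerivAt (fun x => φ (x + y)) (fderiv ℝ φ (x + y)) x := by
      have h := h1.comp x ((hasFDerivAt_id x).add_const y)
      rw [ContinuousLinearMap.comp_id] at h
      exact h
    have h3 : HasFDerivAt (ψ : E n → ℂ) (Complex.ofRealCLM ∘L fderiv ℝ φ (x + y)) x :=
      Complex.ofRealCLM.hasFDerivAt.comp x h2
    rw [h3.fderiv]
    rfl
  have key : ∀ j, ((∫ x, partialDeriv j φ x * oseenKernel τ j k l (x - y) : ℝ)) =
      (-(2 * Real.pi * Complex.I) * ∫ ξ, 𝓕⁻ ψ ξ * ((ξ j : ℂ) * oseenSymbol τ j k l ξ)).re := by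
    intro j
    have hb : Integrable fun x => (∂_{(EuclideanSpace.single j 1 : E n)} ψ) x *
        𝓕⁻ (oseenSymbol τ j k l) x := by
      obtain ⟨B, -, hB⟩ := schwartz_decay (∂_{(EuclideanSpace.single j 1 : E n)} ψ) 0
      exact (integrable_fourierInv_oseenSymbol hτ j k l).bdd_mul (c := B)
        (SchwartzMap.continuous _).aestronglyMeasurable
        (Eventually.of_forall fun x => by simpa using hB x)
    have h1 : ∫ x, partialDeriv j φ x * oseenKernel τ j k l (x - y) =
        ∫ x, ((∂_{(EuclideanSpace.single j 1 : E n)} ψ) x * 𝓕⁻ (oseenSymbol τ j k l) x).re := by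
      rw [← integral_add_right_eq_self _ y]
      simp only [hψ, add_sub_cancel_right, Complex.re_ofReal_mul]
      rfl
    have h2 := integral_re hb
    simp only [RCLike.re_to_complex] at h2
    rw [h1, h2, integral_mul_fourierInv_eq (SchwartzMap.integrable _)
      (integrable_oseenSymbol hτ j k l), ← integral_const_mul, ← SchwartzMap.fourierInv_coe,
      SchwartzMap.fourierInv_lineDerivOp_eq]
    congr 2; ext ξ
    have hg : (fun ξ : E n => inner ℝ ξ (EuclideanSpace.single j 1)).HasTemperateGrowth := by
      fun_prop
    rw [smul_apply, SchwartzMap.smulLeftCLM_apply_apply hg]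
    simp [EuclideanSpace.inner_single_right]
    ring
  have hint : ∀ j, Integrable fun ξ => 𝓕⁻ ψ ξ * ((ξ j : ℂ) * oseenSymbol τ j k l ξ) := by
    intro j
    obtain ⟨B, -, hB⟩ := schwartz_decay (SchwartzMap.smulLeftCLM ℂ (fun ξ : E n => (ξ j : ℂ))
      (𝓕⁻ ψ)) 0
    refine ((integrable_oseenSymbol hτ j k l).bdd_mul (c := B)
      (SchwartzMap.continuous (SchwartzMap.smulLeftCLM ℂ (fun ξ : E n => (ξ j : ℂ))
      (𝓕⁻ ψ))).aestronglyMeasurable (Eventually.of_forall fun x => by simpa using hB x)).congr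
      (Eventually.of_forall fun ξ => ?_)
    simp only [SchwartzMap.smulLeftCLM_apply_apply (hasTemperateGrowth_coord j), smul_eq_mul]
    ring
  simp only [key]
  rw [← Complex.re_sum, ← Finset.mul_sum, ← integral_finsetSum _ fun j _ => hint j]
  simp only [← Finset.mul_sum, sum_coord_mul_oseenSymbol]
  simp

end

/-! ### Control profiles with biorthogonal moments -/

theorem contDiff_partialDeriv {n : ℕ} (i : Fin n) {f : E n → ℝ} (hf : ContDiff ℝ ∞ f) :
    ContDiff ℝ ∞ (partialDeriv i f) :=
  (hf.fderiv_right (m := ∞) (by simp)).clm_apply contDiff_const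

theorem hasCompactSupport_partialDeriv {n : ℕ} (i : Fin n) {f : E n → ℝ}
    (hf : HasCompactSupport f) : HasCompactSupport (partialDeriv i f) :=
  hf.fderiv_apply ℝ _

theorem smooth_iterate_partialDeriv {n : ℕ} (i : Fin n) (k : ℕ) {f : E n → ℝ}
    (hf : ContDiff ℝ ∞ f) (hc : HasCompactSupport f) :
    ContDiff ℝ ∞ ((partialDeriv i)^[k] f) ∧ HasCompactSupport ((partialDeriv i)^[k] f) := by
  induction k generalizing f with
  | zero => exact ⟨hf, hc⟩
  | succ k ih =>
    rw [Function.iterate_succ_apply]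
    exact ih (contDiff_partialDeriv i hf) (hasCompactSupport_partialDeriv i hc)

theorem smooth_foldr_partialDeriv {n : ℕ} (α : Fin n → ℕ) (L : List (Fin n)) {f : E n → ℝ}
    (hf : ContDiff ℝ ∞ f) (hc : HasCompactSupport f) :
    ContDiff ℝ ∞ (L.foldr (fun i g => (partialDeriv i)^[α i] g) f) ∧
      HasCompactSupport (L.foldr (fun i g => (partialDeriv i)^[α i] g) f) := by
  induction L with
  | nil => exact ⟨hf, hc⟩
  | cons i L ih => exact smooth_iterate_partialDeriv i (α i) ih.1 ih.2

theorem hasFDerivAt_coord {n : ℕ} (i : Fin n) (x : E n) :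
    HasFDerivAt (fun x : E n => x i) (EuclideanSpace.proj i : E n →L[ℝ] ℝ) x :=
  (EuclideanSpace.proj i : E n →L[ℝ] ℝ).hasFDerivAt

theorem contDiff_monomialAt {n : ℕ} (β : Fin n → ℕ) :
    ContDiff ℝ ∞ (monomialAt β : E n → ℝ) := by
  unfold monomialAt
  exact contDiff_prod fun i _ =>
    (EuclideanSpace.proj i : E n →L[ℝ] ℝ).contDiff.pow _

theorem partialDeriv_monomialAt {n : ℕ} (β : Fin n → ℕ) (i : Fin n) (x : E n) :
    fderiv ℝ (monomialAt β) x (EuclideanSpace.single i 1) =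
      β i * monomialAt (β - Pi.single i 1) x := by
  have h1 : HasFDerivAt (monomialAt β : E n → ℝ) _ x :=
    HasFDerivAt.finsetProd (u := Finset.univ) fun j _ => (hasFDerivAt_coord j x).pow (β j)
  rw [h1.fderiv]
  simp only [sum_apply, smul_apply, PiLp.proj_apply, smul_eq_mul]
  rw [Finset.sum_eq_single i]
  · rw [monomialAt, ← Finset.mul_prod_erase _ _ (Finset.mem_univ i)]
    have : ∏ j ∈ Finset.univ.erase i, x j ^ ((β - Pi.single i 1 : Fin n → ℕ) j) =
        ∏ j ∈ Finset.univ.erase i, x j ^ β j :=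
      Finset.prod_congr rfl fun j hj => by simp [Finset.ne_of_mem_erase hj]
    rw [this]
    simp
    ring
  · intro j _ hj
    simp [hj]
  · simp

theorem integrable_continuous_mul {n : ℕ} {p f : E n → ℝ} (hp : Continuous p) (hf : Continuous f)
    (hc : HasCompactSupport f) : Integrable fun y => p y * f y :=
  (hp.mul hf).integrable_of_hasCompactSupport hc.mul_left

theorem integral_monomialAt_mul_partialDeriv {n : ℕ} (β : Fin n → ℕ) (i : Fin n) {f : E n → ℝ}
    (hf : ContDiff ℝ ∞ f) (hc : HasCompactSupport f) :
    ∫ y, monomialAt β y * partialDeriv i f y =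
      -(β i : ℝ) * ∫ y, monomialAt (β - Pi.single i 1) y * f y := by
  have h := integral_mul_fderiv_eq_neg_fderiv_mul_of_integrable (μ := (volume : Measure (E n)))
    (f := monomialAt β) (g := f) (v := EuclideanSpace.single i 1) ?_ ?_ ?_ ?_ ?_
  · simp only [partialDeriv_monomialAt, mul_assoc] at h
    rw [integral_const_mul] at h
    rw [neg_mul, ← h]; rfl
  · simp only [partialDeriv_monomialAt]
    exact integrable_continuous_mul (continuous_const.mul (continuous_monomialAt _)) hf.continuous hc
  · exact integrable_continuous_mul (continuous_monomialAt β) (contDiff_partialDeriv i hf).continuous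
      (hasCompactSupport_partialDeriv i hc)
  · exact integrable_continuous_mul (continuous_monomialAt β) hf.continuous hc
  · exact fun x _ => ((contDiff_monomialAt β).differentiable (by simp)).differentiableAt
  · exact fun x _ => (hf.differentiable (by simp)).differentiableAt

theorem integral_monomialAt_mul_iterate {n : ℕ} (β : Fin n → ℕ) (i : Fin n) (k : ℕ) {f : E n → ℝ}
    (hf : ContDiff ℝ ∞ f) (hc : HasCompactSupport f) :
    ∫ y, monomialAt β y * (partialDeriv i)^[k] f y =
      (-1) ^ k * ((β i).descFactorial k : ℝ) * ∫ y, monomialAt (β - Pi.single i k) y * f y := by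
  induction k generalizing f with
  | zero => simp
  | succ k ih =>
    rw [Function.iterate_succ_apply,
      ih (contDiff_partialDeriv i hf) (hasCompactSupport_partialDeriv i hc),
      integral_monomialAt_mul_partialDeriv _ _ hf hc, tsub_tsub, ← Pi.single_add]
    simp only [Pi.sub_apply, Pi.single_eq_same, Nat.descFactorial_succ]
    push_cast
    ring

theorem integral_monomialAt_mul_foldr {n : ℕ} (α : Fin n → ℕ) (L : List (Fin n)) (hL : L.Nodup)
    (β : Fin n → ℕ) {f : E n → ℝ} (hf : ContDiff ℝ ∞ f) (hc : HasCompactSupport f) :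
    ∫ y, monomialAt β y * L.foldr (fun i g => (partialDeriv i)^[α i] g) f y =
      (L.map fun i => (-1) ^ (α i) * ((β i).descFactorial (α i) : ℝ)).prod *
        ∫ y, monomialAt (fun i => if i ∈ L then β i - α i else β i) y * f y := by
  induction L generalizing β with
  | nil => simp
  | cons a L ih =>
    obtain ⟨ha, hL'⟩ := List.nodup_cons.1 hL
    obtain ⟨h1, h2⟩ := smooth_foldr_partialDeriv α L hf hc
    have e1 : (L.map fun i => (-1) ^ (α i) *
        (((β - Pi.single a (α a) : Fin n → ℕ) i).descFactorial (α i) : ℝ)) =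
        L.map fun i => (-1) ^ (α i) * ((β i).descFactorial (α i) : ℝ) := by
      refine List.map_congr_left fun i hi => ?_
      have : i ≠ a := fun h => ha (h ▸ hi)
      simp [this]
    have e2 : (fun i => if i ∈ L then (β - Pi.single a (α a) : Fin n → ℕ) i - α i
        else (β - Pi.single a (α a) : Fin n → ℕ) i) =
        fun i => if i ∈ a :: L then β i - α i else β i := by
      ext i
      by_cases hia : i = a
      · subst hia; simp [ha]
      · simp [hia]
    rw [List.foldr_cons, integral_monomialAt_mul_iterate β a (α a) h1 h2, ih hL', e1, e2,
      List.map_cons, List.prod_cons]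
    ring

/-- The moments of `χ_α` from those of `χ`. Truncated subtraction in `β - α` is harmless, because
the binomial coefficient vanishes unless `α ≤ β`. -/
theorem integral_monomialAt_mul_controlProfile {n : ℕ} (α β : Fin n → ℕ) {χ : E n → ℝ}
    (hf : ContDiff ℝ ∞ χ) (hc : HasCompactSupport χ) :
    ∫ y, monomialAt β y * controlProfile χ α y =
      (∏ i, ((β i).choose (α i) : ℝ)) * ∫ y, monomialAt (β - α) y * χ y := by
  have h := integral_monomialAt_mul_foldr α (List.finRange n) (List.nodup_finRange n) β hf hc
  simp only [List.mem_finRange, if_true] at h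
  rw [show (fun i => β i - α i) = β - α from rfl, ← Fin.prod_univ_def] at h
  have e1 : ∀ y, monomialAt β y * controlProfile χ α y =
      (-1) ^ (∑ i, α i) / (multiFactorial α : ℝ) * (monomialAt β y *
        (List.finRange n).foldr (fun i g => (partialDeriv i)^[α i] g) χ y) := by
    intro y; rw [controlProfile, multiDeriv]; ring
  simp only [e1]
  rw [integral_const_mul, h, ← mul_assoc]
  congr 1
  rw [multiFactorial, Nat.cast_prod, ← Finset.prod_pow_eq_pow_sum, ← Finset.prod_div_distrib,
    ← Finset.prod_mul_distrib]
  refine Finset.prod_congr rfl fun i _ => ?_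
  rw [Nat.descFactorial_eq_factorial_mul_choose, Nat.cast_mul]
  have : ((α i).factorial : ℝ) ≠ 0 := by positivity
  have h2 : ((-1 : ℝ) ^ α i) * (-1) ^ α i = 1 := by rw [← mul_pow]; simp
  field_simp
  rw [sq, h2, one_mul]

theorem norm_le_sum_abs {n : ℕ} (v : E n) : ‖v‖ ≤ ∑ i, |v i| := by
  conv_lhs => rw [← (EuclideanSpace.basisFun (Fin n) ℝ).sum_repr v]
  refine (norm_sum_le _ _).trans (Finset.sum_le_sum fun i _ => ?_)
  simp [norm_smul]

/-- A polynomial that vanishes near a point has zero coefficients. -/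
theorem coeff_eq_zero_of_vanish {n : ℕ} (s : Finset (Fin n → ℕ)) (c : (Fin n → ℕ) → ℝ) (z : E n)
    (h : ∀ᶠ y in nhds z, ∑ α ∈ s, c α * monomialAt α y = 0) : ∀ α ∈ s, c α = 0 := by
  obtain ⟨ε, hε, hb⟩ := Metric.eventually_nhds_iff.1 h
  let P : MvPolynomial (Fin n) ℝ :=
    ∑ α ∈ s, MvPolynomial.monomial (Finsupp.equivFunOnFinite.symm α) (c α)
  have hδ : 0 < ε / (n + 1) := by positivity
  have hP : P = 0 := by
    refine MvPolynomial.funext_set (fun i => Ioo (z i - ε / (n + 1)) (z i + ε / (n + 1)))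
      (fun i => Ioo_infinite (by linarith)) fun x hx => ?_
    have hx' : ∀ i, |x i - z i| < ε / (n + 1) := fun i => by
      have := hx i (mem_univ i)
      rw [abs_lt]; constructor <;> linarith [this.1, this.2]
    have hd : dist (WithLp.toLp 2 x : E n) z < ε := by
      rw [dist_eq_norm]
      refine (norm_le_sum_abs _).trans_lt ?_
      calc ∑ i, |(WithLp.toLp 2 x - z : E n) i| ≤ ∑ _i : Fin n, ε / (n + 1) :=
            Finset.sum_le_sum fun i _ => by simpa using (hx' i).le
        _ < ε := by
            simp only [Finset.sum_const, Finset.card_univ, Fintype.card_fin, nsmul_eq_mul]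
            rw [← mul_div_assoc, div_lt_iff₀ (by positivity)]
            nlinarith
    have := hb hd
    simp only [P, map_sum, MvPolynomial.eval_monomial, map_zero]
    rw [← this]
    refine Finset.sum_congr rfl fun α _ => ?_
    rw [monomialAt, Finsupp.prod_fintype _ _ (by simp)]
    simp
  intro α hα
  have h1 := congrArg (MvPolynomial.coeff (Finsupp.equivFunOnFinite.symm α)) hP
  simp only [P, MvPolynomial.coeff_sum, MvPolynomial.coeff_monomial, MvPolynomial.coeff_zero,
    EmbeddingLike.apply_eq_iff_eq] at h1
  simpa [hα] using h1

theorem monomialAt_add {n : ℕ} (α β : Fin n → ℕ) (x : E n) :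
    monomialAt (α + β) x = monomialAt α x * monomialAt β x := by
  simp [monomialAt, pow_add, Finset.prod_mul_distrib]

/-- Every box carries a smooth function with integral `1` whose moments of positive order `≤ m`
vanish. It is a polynomial times a bump function; the polynomial exists because the Gram matrix of
the monomials in the weighted `L²` space of the bump is invertible. -/
theorem exists_moment_profile {n : ℕ} (m : ℕ) {a b : Fin n → ℝ} (hab : ∀ i, a i < b i) :
    ∃ χ : E n → ℝ, ContDiff ℝ ∞ χ ∧ HasCompactSupport χ ∧ tsupport χ ⊆ box a b ∧
      ∀ γ : Fin n → ℕ, ∑ i, γ i < m + 1 →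
        ∫ y, monomialAt γ y * χ y = if γ = 0 then 1 else 0 := by
  let z : E n := WithLp.toLp 2 fun i => (a i + b i) / 2
  have hz : box a b ∈ nhds z := by
    have h1 : ∀ i, {x : E n | a i ≤ x i ∧ x i ≤ b i} ∈ nhds z := by
      intro i
      have hc : Continuous fun x : E n => x i := by fun_prop
      have := hc.continuousAt (x := z) (Icc_mem_nhds (a := a i) (b := b i)
        (by simp only [z]; linarith [hab i]) (by simp only [z]; linarith [hab i]))
      exact this
    have h2 : box a b = ⋂ i, {x : E n | a i ≤ x i ∧ x i ≤ b i} := by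
      ext x; simp [box]
    rw [h2]
    exact (Filter.iInter_mem).2 h1
  obtain ⟨ψ, hψs, hψc, hψd, hψr, hψz⟩ := exists_contDiff_tsupport_subset (n := ⊤) hz
  have hψ0 : ∀ x, 0 ≤ ψ x := fun x => (hψr (mem_range_self x)).1
  set s := multiIndicesBelow n (m + 1) with hs
  have hint : ∀ γ : Fin n → ℕ, Integrable fun y => monomialAt γ y * ψ y := fun γ =>
    integrable_continuous_mul (continuous_monomialAt γ) hψd.continuous hψc
  let G : (s → ℝ) →ₗ[ℝ] (s → ℝ) :=
    Matrix.toLin' (Matrix.of fun β α : s => ∫ y, monomialAt (α.1 + β.1) y * ψ y)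
  have hG : ∀ (c : s → ℝ) (β : s), G c β =
      ∫ y, (∑ α : s, c α * monomialAt α.1 y) * (monomialAt β.1 y * ψ y) := by
    intro c β
    simp only [G, Matrix.toLin'_apply, Matrix.mulVec, dotProduct, Matrix.of_apply]
    simp only [Finset.sum_mul]
    rw [integral_finsetSum]
    · refine Finset.sum_congr rfl fun α _ => ?_
      rw [mul_comm, ← integral_const_mul]
      congr 1; ext y; rw [monomialAt_add]; ring
    · intro α _
      refine ((hint (α.1 + β.1)).const_mul (c α)).congr (Eventually.of_forall fun y => ?_)
      simp only [monomialAt_add]; ring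
  have hinj : Function.Injective G := by
    rw [← LinearMap.ker_eq_bot, LinearMap.ker_eq_bot']
    intro c hc
    let p : E n → ℝ := fun y => ∑ α : s, c α * monomialAt α.1 y
    have hpc : Continuous p := continuous_finsetSum _ fun α _ =>
      continuous_const.mul (continuous_monomialAt _)
    have hi : ∀ β : Fin n → ℕ, Integrable fun y => p y * (monomialAt β y * ψ y) := fun β => by
      simp only [← mul_assoc]
      exact integrable_continuous_mul (hpc.mul (continuous_monomialAt β)) hψd.continuous hψc
    have h0 : ∫ y, p y ^ 2 * ψ y = 0 := by
      have h1 : ∀ y, p y ^ 2 * ψ y = ∑ β : s, c β * (p y * (monomialAt β.1 y * ψ y)) := by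
        intro y
        calc p y ^ 2 * ψ y = (∑ β : s, c β * monomialAt β.1 y) * (p y * ψ y) := by
              simp only [p]; ring
          _ = _ := by
              rw [Finset.sum_mul]
              exact Finset.sum_congr rfl fun β _ => by ring
      simp only [h1]
      rw [integral_finsetSum _ fun β _ => (hi _).const_mul _]
      refine Finset.sum_eq_zero fun β _ => ?_
      rw [integral_const_mul, ← hG c β, hc]
      simp
    have hcont : Continuous fun y => p y ^ 2 * ψ y := (hpc.pow 2).mul hψd.continuous
    have h2 : (fun y => p y ^ 2 * ψ y) = 0 := by
      have h0' := (integral_eq_zero_iff_of_nonneg (f := fun y => p y ^ 2 * ψ y)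
        (fun y => mul_nonneg (sq_nonneg _) (hψ0 y))
        (integrable_continuous_mul (hpc.pow 2) hψd.continuous hψc)).1 h0
      exact (hcont.ae_eq_iff_eq volume continuous_const).1 h0'
    have h3 : ∀ᶠ y in nhds z, 0 < ψ y :=
      hψd.continuous.continuousAt.eventually (lt_mem_nhds (by rw [hψz]; norm_num))
    have h4 := coeff_eq_zero_of_vanish s (fun α => if h : α ∈ s then c ⟨α, h⟩ else 0) z ?_
    · ext α
      simpa using h4 α.1 α.2
    · filter_upwards [h3] with y hy
      have h5 := congrFun h2 y
      simp only [Pi.zero_apply, mul_eq_zero, hy.ne', or_false, pow_eq_zero_iff two_ne_zero] at h5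
      rw [← h5, ← Finset.sum_coe_sort]
      simp [p]
  have hsurj : Function.Surjective G := LinearMap.injective_iff_surjective.1 hinj
  obtain ⟨c, hc⟩ := hsurj fun γ => if γ.1 = 0 then 1 else 0
  have hpd : ContDiff ℝ ∞ fun y : E n => ∑ α : s, c α * monomialAt α.1 y :=
    ContDiff.sum fun α _ => contDiff_const.mul (contDiff_monomialAt _)
  refine ⟨fun y => (∑ α : s, c α * monomialAt α.1 y) * ψ y, hpd.mul hψd, hψc.mul_left,
    (tsupport_mul_subset_right).trans hψs, fun γ hγ => ?_⟩
  have := congrFun hc ⟨γ, (mem_multiIndicesBelow γ).2 hγ⟩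
  rw [hG] at this
  rw [← this]
  congr 1; ext y; ring

/-- Biorthogonality of the monomials and the profiles `χ_α`. -/
theorem integral_monomialAt_mul_controlProfile_eq {n m : ℕ} {χ : E n → ℝ} (hf : ContDiff ℝ ∞ χ)
    (hc : HasCompactSupport χ) (hχ : ∀ γ : Fin n → ℕ, ∑ i, γ i < m + 1 →
        ∫ y, monomialAt γ y * χ y = if γ = 0 then 1 else 0)
    (α : Fin n → ℕ) {β : Fin n → ℕ} (hβ : ∑ i, β i < m + 1) :
    ∫ y, monomialAt β y * controlProfile χ α y = if α = β then 1 else 0 := by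
  rw [integral_monomialAt_mul_controlProfile α β hf hc, hχ]
  · split_ifs with h1 h2 h2
    · subst h2; simp
    · have : ∃ i, β i < α i := by
        by_contra! h
        exact h2 (le_antisymm h (tsub_eq_zero_iff_le.1 h1))
      obtain ⟨i, hi⟩ := this
      rw [Finset.prod_eq_zero (Finset.mem_univ i), zero_mul]
      rw [Nat.choose_eq_zero_of_lt hi, Nat.cast_zero]
    · subst h2; simp at h1
    · simp
  · refine lt_of_le_of_lt (Finset.sum_le_sum fun i _ => ?_) hβ
    simp

/-! ### Subtracting the moments -/

/-- The function `q - ∑_{|α| < N} (∫ z^α q) χ_α`, whose moments of order `< N` vanish. -/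
noncomputable def momentCorrection {n : ℕ} (N : ℕ) (χ : E n → ℝ) (q : E n → ℝ) (y : E n) : ℝ :=
  q y - ∑ α ∈ multiIndicesBelow n N, controlProfile χ α y * ∫ z, monomialAt α z * q z

theorem integral_inv_add_norm_pow {n : ℕ} {b : ℝ} (hb : 0 < b) (k : ℕ) :
    Integrable (fun z : E n => ((b + ‖z‖) ^ (n + 1 + k))⁻¹) ∧
      ∫ z : E n, ((b + ‖z‖) ^ (n + 1 + k))⁻¹ ≤
        (b ^ (1 + k))⁻¹ * ∫ z : E n, ((1 + ‖z‖) ^ (n + 1))⁻¹ := by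
  have h1 := integrable_inv_one_add_norm_pow (n := n) (e := n + 1 + k) (by omega)
  have hsc : ∀ z : E n, ((b + ‖b • z‖) ^ (n + 1 + k))⁻¹ =
      (b ^ (n + 1 + k))⁻¹ * ((1 + ‖z‖) ^ (n + 1 + k))⁻¹ := by
    intro z
    rw [norm_smul, Real.norm_of_nonneg hb.le, ← mul_inv, ← mul_pow]
    ring_nf
  have hI : Integrable (fun z : E n => ((b + ‖z‖) ^ (n + 1 + k))⁻¹) := by
    rw [← integrable_comp_smul_iff volume _ hb.ne']
    simp only [hsc]
    exact h1.const_mul _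
  refine ⟨hI, ?_⟩
  have h2 := Measure.integral_comp_smul_of_nonneg volume
    (fun z : E n => ((b + ‖z‖) ^ (n + 1 + k))⁻¹) b (hR := hb.le)
  simp only [hsc, finrank_euclideanSpace, Fintype.card_fin, smul_eq_mul] at h2
  rw [integral_const_mul] at h2
  have h3 : ∫ z : E n, ((1 + ‖z‖) ^ (n + 1 + k))⁻¹ ≤ ∫ z : E n, ((1 + ‖z‖) ^ (n + 1))⁻¹ := by
    refine integral_mono h1 (integrable_inv_one_add_norm_pow (by omega)) fun z => ?_
    have : (1 : ℝ) ≤ 1 + ‖z‖ := by linarith [norm_nonneg z]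
    exact inv_anti₀ (by positivity) (pow_le_pow_right₀ this (by omega))
  have h4 : ∫ z : E n, ((b + ‖z‖) ^ (n + 1 + k))⁻¹ =
      (b ^ (1 + k))⁻¹ * ∫ z : E n, ((1 + ‖z‖) ^ (n + 1 + k))⁻¹ := by
    rw [add_assoc n 1 k, pow_add b, mul_inv, mul_assoc] at h2
    rw [add_assoc n 1 k]
    exact (mul_left_cancel₀ (by positivity) h2).symm
  rw [h4]
  gcongr

theorem norm_pow_mul_le {n : ℕ} {a b c : ℝ} (hb : 0 < b) {k p e : ℕ} (hp : p = k + e)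
    {y : E n} (h : |c| ≤ a / (b + ‖y‖) ^ p) : ‖y‖ ^ k * |c| ≤ a * ((b + ‖y‖) ^ e)⁻¹ := by
  subst hp
  have h0 : 0 < b + ‖y‖ := by positivity
  calc ‖y‖ ^ k * |c| ≤ (b + ‖y‖) ^ k * (a / (b + ‖y‖) ^ (k + e)) := by
        gcongr; linarith
    _ = _ := by rw [pow_add]; field_simp

theorem integral_norm_pow_mul_le {n m k : ℕ} (hk : k ≤ m + 1) {a b : ℝ} (ha : 0 ≤ a) (hb : 0 < b)
    {q : E n → ℝ} (hqm : Measurable q)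
    (hq : ∀ y, |q y| ≤ a / (b + ‖y‖) ^ (2 * (n + 1 + m))) :
    Integrable (fun y => ‖y‖ ^ k * |q y|) ∧ ∫ y, ‖y‖ ^ k * |q y| ≤
      (∫ z : E n, ((1 + ‖z‖) ^ (n + 1))⁻¹) * (a / b ^ (n + 2 + 2 * m - k)) := by
  obtain ⟨h1, h2⟩ := integral_inv_add_norm_pow (n := n) hb (n + 1 + 2 * m - k)
  have hle : ∀ y, ‖y‖ ^ k * |q y| ≤ a * ((b + ‖y‖) ^ (n + 1 + (n + 1 + 2 * m - k)))⁻¹ :=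
    fun y => norm_pow_mul_le hb (by omega) (hq y)
  have hi : Integrable (fun y => ‖y‖ ^ k * |q y|) :=
    (h1.const_mul a).mono' (by fun_prop) (Eventually.of_forall fun y => by
      rw [Real.norm_of_nonneg (by positivity)]; exact hle y)
  refine ⟨hi, (integral_mono hi (h1.const_mul a) hle).trans ?_⟩
  rw [integral_const_mul, show n + 2 + 2 * m - k = 1 + (n + 1 + 2 * m - k) by omega]
  calc _ ≤ a * ((b ^ (1 + (n + 1 + 2 * m - k)))⁻¹ * ∫ z : E n, ((1 + ‖z‖) ^ (n + 1))⁻¹) := by gcongr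
    _ = _ := by ring

/-- The moments of a function decaying like `(b + |y|)^{-2(n+1+m)}`. -/
theorem abs_moment_le {n m : ℕ} {a b : ℝ} (ha : 0 ≤ a) (hb : 0 < b)
    {q : E n → ℝ} (hqm : Measurable q)
    (hq : ∀ y, |q y| ≤ a / (b + ‖y‖) ^ (2 * (n + 1 + m))) (α : Fin n → ℕ)
    (hα : ∑ i, α i ≤ m) :
    Integrable (fun z => monomialAt α z * q z) ∧ |∫ z, monomialAt α z * q z| ≤
      (∫ z : E n, ((1 + ‖z‖) ^ (n + 1))⁻¹) * (a / b ^ (n + 2 + 2 * m - ∑ i, α i)) := by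
  obtain ⟨h1, h2⟩ := integral_norm_pow_mul_le (k := ∑ i, α i) (m := m) (by omega) ha hb hqm hq
  have hle : ∀ z, |monomialAt α z * q z| ≤ ‖z‖ ^ (∑ i, α i) * |q z| := fun z => by
    rw [abs_mul]
    gcongr
    exact abs_monomialAt_le α z
  have hi : Integrable (fun z => monomialAt α z * q z) :=
    h1.mono' ((continuous_monomialAt α).aestronglyMeasurable.mul hqm.aestronglyMeasurable)
      (Eventually.of_forall hle)
  exact ⟨hi, abs_integral_le_integral_abs.trans ((integral_mono hi.abs h1 hle).trans h2)⟩

theorem contDiff_controlProfile {n : ℕ} {χ : E n → ℝ} (hf : ContDiff ℝ ∞ χ)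
    (hc : HasCompactSupport χ) (α : Fin n → ℕ) :
    ContDiff ℝ ∞ (controlProfile χ α) ∧ HasCompactSupport (controlProfile χ α) := by
  obtain ⟨h1, h2⟩ := smooth_foldr_partialDeriv α (List.finRange n) hf hc
  exact ⟨contDiff_const.mul h1, h2.mul_left⟩

theorem exists_controlProfile_decay {n : ℕ} {χ : E n → ℝ} (hf : ContDiff ℝ ∞ χ)
    (hc : HasCompactSupport χ) (N e : ℕ) : ∃ C, 0 ≤ C ∧ ∀ α ∈ multiIndicesBelow n N, ∀ y,
      |controlProfile χ α y| ≤ C / (1 + ‖y‖) ^ e := by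
  obtain ⟨C, hC, h⟩ := exists_uniform_bound (ι := multiIndicesBelow n N)
    (P := fun α C => ∀ y, |controlProfile χ α.1 y| ≤ C / (1 + ‖y‖) ^ e)
    (fun i C C' hCC h y => (h y).trans (by gcongr)) (fun α => by
      obtain ⟨h1, h2⟩ := contDiff_controlProfile hf hc α.1
      have hcont : Continuous fun y => (1 + ‖y‖) ^ e * controlProfile χ α.1 y :=
        Continuous.mul (by fun_prop) h1.continuous
      obtain ⟨C, hC⟩ := hcont.bounded_above_of_compact_support h2.mul_left
      refine ⟨C, fun y => ?_⟩
      rw [le_div_iff₀ (by positivity)]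
      have := hC y
      rwa [norm_mul, Real.norm_of_nonneg (by positivity), mul_comm] at this)
  exact ⟨C, hC, fun α hα y => h ⟨α, hα⟩ y⟩

/-- Size of a function decaying like `(b + |y|)^{-2(n+1+m)}` after subtraction of its moments. -/
theorem exists_momentCorrection_le {n m N : ℕ} (hn : 1 ≤ n) (hN : N ≤ m + 1) {χ : E n → ℝ}
    (hf : ContDiff ℝ ∞ χ) (hc : HasCompactSupport χ)
    (hχ : ∀ γ : Fin n → ℕ, ∑ i, γ i < m + 1 →
        ∫ y, monomialAt γ y * χ y = if γ = 0 then 1 else 0) :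
    ∃ C, 0 ≤ C ∧ ∀ a b : ℝ, 0 ≤ a → 1 ≤ b → ∀ q : E n → ℝ, Measurable q →
      (∀ y, |q y| ≤ a / (b + ‖y‖) ^ (2 * (n + 1 + m))) →
      VanishingMoments N (momentCorrection N χ q) ∧
      (∀ y, |momentCorrection N χ q y| ≤
        C * a / b ^ (2 + 2 * m - 2 * N) / (b + ‖y‖) ^ (n + 1 + N)) ∧
      ∫ y, ‖y‖ ^ N * |momentCorrection N χ q y| ≤ C * a / b ^ (n + 2 + 2 * m - N) := by
  obtain ⟨X, hX, hXb⟩ := exists_controlProfile_decay hf hc N (n + 1 + N)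
  set J := ∫ z : E n, ((1 + ‖z‖) ^ (n + 1))⁻¹ with hJ
  have hJ0 : 0 ≤ J := integral_nonneg fun z => by positivity
  set s := multiIndicesBelow n N with hs
  refine ⟨1 + J + s.card * X * J * (1 + J), by positivity, fun a b ha hb q hqm hq => ?_⟩
  have hb0 : 0 < b := by linarith
  have hmom : ∀ α ∈ s, Integrable (fun z => monomialAt α z * q z) ∧
      |∫ z, monomialAt α z * q z| ≤ J * (a / b ^ (n + 3 + 2 * m - N)) := by
    intro α hα
    have hα' := (mem_multiIndicesBelow α).1 hα
    obtain ⟨h1, h2⟩ := abs_moment_le (m := m) ha hb0 hqm hq α (by omega)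
    refine ⟨h1, h2.trans (mul_le_mul_of_nonneg_left ?_ hJ0)⟩
    exact div_le_div_of_nonneg_left ha (by positivity) (pow_le_pow_right₀ hb (by omega))
  have hcorr : ∀ y, |∑ α ∈ s, controlProfile χ α y * ∫ z, monomialAt α z * q z| ≤
      s.card * X * J * (a / b ^ (n + 3 + 2 * m - N)) / (1 + ‖y‖) ^ (n + 1 + N) := by
    intro y
    refine (Finset.abs_sum_le_sum_abs _ _).trans ?_
    calc _ ≤ ∑ α ∈ s, X / (1 + ‖y‖) ^ (n + 1 + N) * (J * (a / b ^ (n + 3 + 2 * m - N))) := by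
          refine Finset.sum_le_sum fun α hα => ?_
          rw [abs_mul]
          exact mul_le_mul (hXb α hα y) (hmom α hα).2 (abs_nonneg _) (by positivity)
      _ = _ := by rw [Finset.sum_const, nsmul_eq_mul]; ring
  have hRm : Measurable (momentCorrection N χ q) := by
    unfold momentCorrection
    refine hqm.sub (Finset.measurable_sum _ fun α _ => ?_)
    exact (contDiff_controlProfile hf hc α).1.continuous.measurable.mul_const _
  have hpt : ∀ y, |momentCorrection N χ q y| ≤
      (1 + J + s.card * X * J * (1 + J)) * a / b ^ (2 + 2 * m - 2 * N) /
        (b + ‖y‖) ^ (n + 1 + N) := by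
    intro y
    have hy0 : 0 < b + ‖y‖ := by positivity
    have h1 : a / (b + ‖y‖) ^ (2 * (n + 1 + m)) ≤
        a / b ^ (2 + 2 * m - 2 * N) / (b + ‖y‖) ^ (n + 1 + N) := by
      rw [div_div]
      have hle : (1 : ℝ) ≤ b + ‖y‖ := by linarith [norm_nonneg y]
      gcongr
      calc b ^ (2 + 2 * m - 2 * N) * (b + ‖y‖) ^ (n + 1 + N)
          ≤ (b + ‖y‖) ^ (2 + 2 * m - 2 * N) * (b + ‖y‖) ^ (n + 1 + N) := by
            gcongr; linarith [norm_nonneg y]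
        _ = (b + ‖y‖) ^ (2 + 2 * m - 2 * N + (n + 1 + N)) := (pow_add _ _ _).symm
        _ ≤ (b + ‖y‖) ^ (2 * (n + 1 + m)) := pow_le_pow_right₀ hle (by omega)
    -- The profiles decay at the scale `1` only; `b (1 + |y|) ≥ b + |y|` trades powers of `b` for it.
    have h2 : a / b ^ (n + 3 + 2 * m - N) / (1 + ‖y‖) ^ (n + 1 + N) ≤
        a / b ^ (2 + 2 * m - 2 * N) / (b + ‖y‖) ^ (n + 1 + N) := by
      rw [div_div, div_div, show n + 3 + 2 * m - N = 2 + 2 * m - 2 * N + (n + 1 + N) by omega,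
        pow_add, mul_assoc, ← mul_pow]
      gcongr
      nlinarith [norm_nonneg y]
    rw [momentCorrection]
    refine (abs_sub _ _).trans ((add_le_add ((hq y).trans h1) ((hcorr y).trans_eq
      (mul_div_assoc _ _ _))).trans ?_)
    calc _ ≤ a / b ^ (2 + 2 * m - 2 * N) / (b + ‖y‖) ^ (n + 1 + N) + s.card * X * J *
          (a / b ^ (2 + 2 * m - 2 * N) / (b + ‖y‖) ^ (n + 1 + N)) := by gcongr
      _ = (1 + s.card * X * J * 1) * a / b ^ (2 + 2 * m - 2 * N) / (b + ‖y‖) ^ (n + 1 + N) := by ring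
      _ ≤ _ := by
        gcongr <;> linarith
  set K := (1 + J + s.card * X * J * (1 + J)) * a / b ^ (2 + 2 * m - 2 * N) with hK
  have hi0 : Integrable (momentCorrection N χ q) :=
    ((integral_inv_add_norm_pow hb0 N).1.const_mul K).mono' hRm.aestronglyMeasurable
      (Eventually.of_forall fun y => (hpt y).trans_eq (div_eq_mul_inv _ _))
  have hiN : Integrable fun y => ‖y‖ ^ N * momentCorrection N χ q y := by
    refine ((integral_inv_add_norm_pow hb0 0).1.const_mul K).mono' (by fun_prop)
      (Eventually.of_forall fun y => ?_)
    rw [norm_mul, norm_pow, norm_norm, Real.norm_eq_abs]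
    exact norm_pow_mul_le hb0 (by ring) (hpt y)
  refine ⟨⟨hi0, hiN, fun β hβ => ?_⟩, hpt, ?_⟩
  · have hβ' : β ∈ s := (mem_multiIndicesBelow β).2 hβ
    have hprof : ∀ α, Integrable fun y => monomialAt β y * controlProfile χ α y := fun α => by
      obtain ⟨h1, h2⟩ := contDiff_controlProfile hf hc α
      exact integrable_continuous_mul (continuous_monomialAt β) h1.continuous h2
    have e1 : ∀ y, monomialAt β y * momentCorrection N χ q y = monomialAt β y * q y -
        ∑ α ∈ s, (∫ z, monomialAt α z * q z) * (monomialAt β y * controlProfile χ α y) := by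
      intro y
      rw [momentCorrection, mul_sub, Finset.mul_sum]
      congr 1
      exact Finset.sum_congr rfl fun α _ => by ring
    simp only [e1]
    rw [integral_sub (hmom β hβ').1 (integrable_finsetSum _ fun α _ => (hprof α).const_mul _),
      integral_finsetSum _ fun α _ => (hprof α).const_mul _, sub_eq_zero]
    simp only [integral_const_mul, integral_monomialAt_mul_controlProfile_eq hf hc hχ _
      (hβ.trans_le hN)]
    simp [hβ']
  · obtain ⟨hq1, hq2⟩ := integral_norm_pow_mul_le hN ha hb0 hqm hq
    have h1J := integrable_inv_one_add_norm_pow (n := n) (e := n + 1) (by omega)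
    have hle : ∀ y, ‖y‖ ^ N * |momentCorrection N χ q y| ≤ ‖y‖ ^ N * |q y| +
        s.card * X * J * (a / b ^ (n + 3 + 2 * m - N)) * ((1 + ‖y‖) ^ (n + 1))⁻¹ := by
      intro y
      rw [momentCorrection]
      refine (mul_le_mul_of_nonneg_left (abs_sub _ _) (by positivity)).trans ?_
      rw [mul_add]
      refine add_le_add le_rfl ?_
      exact norm_pow_mul_le (k := N) (e := n + 1) one_pos (by ring) (hcorr y)
    have hiR : Integrable fun y => ‖y‖ ^ N * |momentCorrection N χ q y| :=
      hiN.norm.congr (Eventually.of_forall fun y => by simp)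
    refine (integral_mono hiR (hq1.add (h1J.const_mul _)) hle).trans ?_
    simp only [Pi.add_apply]
    rw [integral_add hq1 (h1J.const_mul _), integral_const_mul, ← hJ]
    have h3 : a / b ^ (n + 3 + 2 * m - N) ≤ a / b ^ (n + 2 + 2 * m - N) :=
      div_le_div_of_nonneg_left ha (by positivity) (pow_le_pow_right₀ hb (by omega))
    calc _ ≤ J * (a / b ^ (n + 2 + 2 * m - N)) +
          s.card * X * J * (a / b ^ (n + 2 + 2 * m - N)) * J := by gcongr
      _ = (J + s.card * X * J * J) * a / b ^ (n + 2 + 2 * m - N) := by ring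
      _ ≤ _ := by
        gcongr <;> linarith

/-! ### The Duhamel term -/

/-- The convolution of the Oseen kernel with a moment-corrected slice. -/
theorem exists_oseen_correction_le {n m N : ℕ} (hn : 1 ≤ n) (hN : N ≤ m + 1) {χ : E n → ℝ}
    (hf : ContDiff ℝ ∞ χ) (hc : HasCompactSupport χ)
    (hχ : ∀ γ : Fin n → ℕ, ∑ i, γ i < m + 1 →
        ∫ y, monomialAt γ y * χ y = if γ = 0 then 1 else 0) :
    ∃ C, 0 ≤ C ∧ ∀ τ : ℝ, 0 < τ → ∀ j k l : Fin n, ∀ a b : ℝ, 0 ≤ a → 1 ≤ b → ∀ q : E n → ℝ,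
      Measurable q → (∀ y, |q y| ≤ a / (b + ‖y‖) ^ (2 * (n + 1 + m))) → ∀ x : E n,
      |∫ y, oseenKernel τ j k l (x - y) * momentCorrection N χ q y| ≤
        C * a * (1 / b ^ (n + 2 + 2 * m - N) + (√τ)⁻¹ / b ^ (2 + 2 * m - 2 * N)) /
          (b + (√τ + ‖x‖)) ^ (n + 1 + N) := by
  obtain ⟨C₁, hC₁, h₁⟩ := exists_momentCorrection_le hn hN hf hc hχ
  obtain ⟨C₂, hC₂, h₂⟩ := exists_oseen_convolution_le n N
  refine ⟨C₂ * C₁, by positivity, fun τ hτ j k l a b ha hb q hqm hq x => ?_⟩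
  obtain ⟨hv, hS, hI⟩ := h₁ a b ha hb q hqm hq
  have hb0 : 0 < b := by linarith
  have h0 : 0 < √τ := Real.sqrt_pos.2 hτ
  refine (h₂ τ hτ j k l b _ hb0 (by positivity) _ hv hS x).trans ?_
  gcongr ?_ / _
  rw [mul_assoc C₂, mul_assoc C₂]
  refine mul_le_mul_of_nonneg_left ((add_le_add hI le_rfl).trans_eq ?_) hC₂
  ring

theorem integral_inv_sqrt {t : ℝ} (ht : 0 < t) :
    IntegrableOn (fun s : ℝ => (√s)⁻¹) (Ioo 0 t) ∧ ∫ s in Ioo 0 t, (√s)⁻¹ = 2 * √t := by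
  have h1 : ∀ s ∈ Ioo 0 t, (√s)⁻¹ = s ^ (-(1 / 2) : ℝ) := fun s hs => by
    rw [Real.sqrt_eq_rpow, Real.rpow_neg hs.1.le]
  constructor
  · rw [integrableOn_congr_fun h1 measurableSet_Ioo, ← integrableOn_Ioc_iff_integrableOn_Ioo,
      ← intervalIntegrable_iff_integrableOn_Ioc_of_le ht.le]
    exact intervalIntegral.intervalIntegrable_rpow' (by norm_num)
  · rw [setIntegral_congr_fun measurableSet_Ioo h1, ← integral_Ioc_eq_integral_Ioo,
      ← intervalIntegral.integral_of_le ht.le, integral_rpow (Or.inl (by norm_num)),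
      Real.sqrt_eq_rpow]
    norm_num
    ring

theorem integral_inv_sqrt_sub {t : ℝ} (ht : 0 < t) :
    IntegrableOn (fun s : ℝ => (√(t - s))⁻¹) (Ioo 0 t) ∧
      ∫ s in Ioo 0 t, (√(t - s))⁻¹ = 2 * √t := by
  have hmp := (volume : Measure ℝ).measurePreserving_sub_left t
  have hemb := (Homeomorph.subLeft t).measurableEmbedding
  have hpre : (fun s => t - s) ⁻¹' (Ioo 0 t) = Ioo 0 t := by ext s; simp [and_comm]
  obtain ⟨h1, h2⟩ := integral_inv_sqrt ht
  constructor
  · have := (hmp.integrableOn_comp_preimage hemb (f := fun s : ℝ => (√s)⁻¹) (s := Ioo 0 t)).2 h1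
    rwa [hpre] at this
  · have := hmp.setIntegral_preimage_emb hemb (fun s : ℝ => (√s)⁻¹) (Ioo 0 t)
    rw [hpre] at this
    rw [this, h2]

/-- The term `∫₀ᵗ F_{j;k,l}(t - s) * R[q(s)] ds` with the moment-corrected integrand. -/
noncomputable def duhamel {n : ℕ} (N : ℕ) (χ : E n → ℝ) (j k l : Fin n) (q : ℝ → E n → ℝ) (t : ℝ)
    (x : E n) : ℝ :=
  ∫ s in Ioo 0 t, ∫ y, oseenKernel (t - s) j k l (x - y) * momentCorrection N χ (q s) y

/-- Local-in-time estimate of the Duhamel term, with the decay given by the number of vanishing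
moments. -/
theorem exists_duhamel_local_le {n m N : ℕ} (hn : 1 ≤ n) (hN : N ≤ m + 1) {χ : E n → ℝ}
    (hf : ContDiff ℝ ∞ χ) (hc : HasCompactSupport χ)
    (hχ : ∀ γ : Fin n → ℕ, ∑ i, γ i < m + 1 →
        ∫ y, monomialAt γ y * χ y = if γ = 0 then 1 else 0) :
    ∃ C, 0 ≤ C ∧ ∀ t : ℝ, 0 < t → ∀ j k l : Fin n, ∀ a : ℝ, 0 ≤ a → ∀ q : ℝ → E n → ℝ,
      (∀ s, Measurable (q s)) →
      (∀ s ∈ Ioo 0 t, ∀ y, |q s y| ≤ a / (1 + ‖y‖) ^ (2 * (n + 1 + m))) → ∀ x : E n,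
      |duhamel N χ j k l q t x| ≤ C * a * (t + √t) / (1 + ‖x‖) ^ (n + 1 + N) := by
  obtain ⟨C, hC, h⟩ := exists_oseen_correction_le hn hN hf hc hχ
  refine ⟨2 * C, by positivity, fun t ht j k l a ha q hqm hq x => ?_⟩
  obtain ⟨hi, hv⟩ := integral_inv_sqrt_sub ht
  have hb : ∀ s ∈ Ioo 0 t, ‖∫ y, oseenKernel (t - s) j k l (x - y) *
      momentCorrection N χ (q s) y‖ ≤ C * a / (1 + ‖x‖) ^ (n + 1 + N) * (1 + (√(t - s))⁻¹) := by
    intro s hs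
    have hτ : 0 < t - s := by linarith [hs.2]
    refine (h (t - s) hτ j k l a 1 ha le_rfl (q s) (hqm s) (hq s hs) x).trans ?_
    rw [one_pow, one_pow, div_one, div_one, div_mul_eq_mul_div]
    gcongr
    linarith [Real.sqrt_nonneg (t - s)]
  have hi1 : IntegrableOn (fun _ : ℝ => (1 : ℝ)) (Ioo 0 t) := by simp
  have hint : IntegrableOn (fun s => C * a / (1 + ‖x‖) ^ (n + 1 + N) * (1 + (√(t - s))⁻¹))
      (Ioo 0 t) := (hi1.add hi).const_mul _
  refine (norm_integral_le_of_norm_le hint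
    ((ae_restrict_mem measurableSet_Ioo).mono hb)).trans ?_
  rw [integral_const_mul, integral_add hi1 hi, hv]
  simp only [integral_const, measureReal_restrict_apply_univ, smul_eq_mul, mul_one]
  rw [Real.volume_real_Ioo_of_le ht.le, sub_zero, div_mul_eq_mul_div]
  gcongr ?_ / _
  have h3 : C * a * (t + 2 * √t) ≤ C * a * (2 * (t + √t)) := by gcongr; linarith
  linarith

/-- Global-in-time estimate of the Duhamel term: the decay in time of `q` compensates for the length
of the time interval. -/
theorem exists_duhamel_global_le {n m : ℕ} (hn : 2 ≤ n) {χ : E n → ℝ}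
    (hf : ContDiff ℝ ∞ χ) (hc : HasCompactSupport χ)
    (hχ : ∀ γ : Fin n → ℕ, ∑ i, γ i < m + 1 →
        ∫ y, monomialAt γ y * χ y = if γ = 0 then 1 else 0) :
    ∃ C, 0 ≤ C ∧ ∀ t : ℝ, 0 < t → ∀ j k l : Fin n, ∀ a : ℝ, 0 ≤ a → ∀ q : ℝ → E n → ℝ,
      (∀ s, Measurable (q s)) →
      (∀ s ∈ Ioo 0 t, ∀ y, |q s y| ≤ a / ((1 + √s) + ‖y‖) ^ (2 * (n + 1 + m))) → ∀ x : E n,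
      |duhamel m χ j k l q t x| ≤ C * a / ((1 + √t) + ‖x‖) ^ (n + 1 + m) := by
  obtain ⟨C, hC, h⟩ := exists_oseen_correction_le (N := m) (by omega) (by omega) hf hc hχ
  refine ⟨C * 12, by positivity, fun t ht j k l a ha q hqm hq x => ?_⟩
  obtain ⟨hi, hv⟩ := integral_inv_sqrt_sub ht
  obtain ⟨hi', hv'⟩ := integral_inv_sqrt ht
  obtain ⟨hi3, hv3⟩ := integral_inv_sqrt_add_pow_three (τ := 0) (X := 1) le_rfl zero_le_one
    (by norm_num)
  have hi3' : IntegrableOn (fun s : ℝ => ((√s + 1) ^ 3)⁻¹) (Ioo 0 t) :=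
    hi3.mono_set Ioo_subset_Ioi_self
  have ht0 : 0 < √t := Real.sqrt_pos.2 ht
  set D := C * a / ((1 + √t) + ‖x‖) ^ (n + 1 + m) with hD
  have hD0 : 0 ≤ D := by positivity
  have hb : ∀ s ∈ Ioo 0 t, ‖∫ y, oseenKernel (t - s) j k l (x - y) *
      momentCorrection m χ (q s) y‖ ≤
      D * (((√s + 1) ^ 3)⁻¹ + 2 * (√t)⁻¹ * ((√s)⁻¹ + (√(t - s))⁻¹)) := by
    intro s hs
    have hτ : 0 < t - s := by linarith [hs.2]
    have hs0 : 0 < √s := Real.sqrt_pos.2 hs.1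
    have hτ0 : 0 < √(t - s) := Real.sqrt_pos.2 hτ
    have hsq : √s * √s = s := Real.mul_self_sqrt hs.1.le
    have hτq : √(t - s) * √(t - s) = t - s := Real.mul_self_sqrt hτ.le
    have htq : √t * √t = t := Real.mul_self_sqrt ht.le
    have hsum : √t ≤ √s + √(t - s) := by nlinarith [mul_pos hs0 hτ0]
    refine (h (t - s) hτ j k l a (1 + √s) ha (by linarith) (q s) (hqm s) (hq s hs) x).trans ?_
    have e1 : 1 / (1 + √s) ^ (n + 2 + 2 * m - m) ≤ ((√s + 1) ^ 3)⁻¹ := by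
      rw [one_div, add_comm (√s)]
      exact inv_anti₀ (by positivity) (pow_le_pow_right₀ (by linarith) (by omega))
    -- `1 / √(s(t-s)) ≤ 2 t^{-1/2} (s^{-1/2} + (t-s)^{-1/2})` has an integral independent of `t`.
    have e2 : (√(t - s))⁻¹ / (1 + √s) ^ (2 + 2 * m - 2 * m) ≤
        2 * (√t)⁻¹ * ((√s)⁻¹ + (√(t - s))⁻¹) := by
      have e3 : (√(t - s))⁻¹ / (1 + √s) ^ (2 + 2 * m - 2 * m) ≤ (√(t - s))⁻¹ * (√s)⁻¹ := by
        rw [div_eq_mul_inv]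
        gcongr
        calc √s ≤ (1 + √s) ^ 1 := by linarith
          _ ≤ _ := pow_le_pow_right₀ (by linarith) (by omega)
      refine e3.trans ?_
      have e4 : 2 * (√t)⁻¹ * ((√s)⁻¹ + (√(t - s))⁻¹) =
          2 * (√s + √(t - s)) / √t * ((√(t - s))⁻¹ * (√s)⁻¹) := by
        field_simp
        ring
      rw [e4]
      refine le_mul_of_one_le_left (by positivity) ?_
      rw [one_le_div ht0]
      linarith
    rw [mul_div_right_comm]
    gcongr ?_ * ?_
    · rw [hD]
      refine div_le_div_of_nonneg_left (by positivity) (by positivity) ?_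
      exact pow_le_pow_left₀ (by positivity) (by linarith only [hsum]) _
    · exact add_le_add e1 e2
  have hint2 : IntegrableOn (fun s => 2 * (√t)⁻¹ * ((√s)⁻¹ + (√(t - s))⁻¹)) (Ioo 0 t) :=
    (hi'.add hi).const_mul _
  refine (norm_integral_le_of_norm_le ((hi3'.add hint2).const_mul D)
    ((ae_restrict_mem measurableSet_Ioo).mono hb)).trans ?_
  simp only [Pi.add_apply]
  rw [integral_const_mul, integral_add hi3' hint2, integral_const_mul, integral_add hi' hi, hv, hv']
  have h5 : ∫ s in Ioo 0 t, ((√s + 1) ^ 3)⁻¹ ≤ 4 := by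
    refine (setIntegral_mono_set hi3 (Eventually.of_forall fun s => ?_)
      (Ioo_subset_Ioi_self.eventuallyLE)).trans (hv3.trans ?_)
    · simp only [Pi.zero_apply]; positivity
    · simp
  calc _ ≤ D * (4 + 2 * (√t)⁻¹ * (2 * √t + 2 * √t)) := by gcongr
    _ = _ := by rw [hD]; field_simp; ring

/-! ### Integrability and measurability of the potentials -/

theorem measurable_of_coord {n : ℕ} {α : Type*} [MeasurableSpace α] {f : α → E n}
    (h : ∀ j, Measurable fun p => f p j) : Measurable f :=
  (WithLp.measurable_toLp 2 (Fin n → ℝ)).comp (measurable_pi_iff.2 h)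

theorem measurable_coord {n : ℕ} {α : Type*} [MeasurableSpace α] {f : α → E n}
    (h : Measurable f) (j : Fin n) : Measurable fun p => f p j :=
  (EuclideanSpace.proj (𝕜 := ℝ) j).continuous.measurable.comp h

/-- Against a bounded density, the space-time Oseen potential converges absolutely, with a bound
independent of the point. -/
theorem exists_integrable_oseenKernel_mul {n : ℕ} {t : ℝ} (ht : 0 < t) (j k l : Fin n)
    {R : ℝ → E n → ℝ} (hR : Measurable (Function.uncurry R)) {B : ℝ}
    (hB : ∀ s ∈ Ioo 0 t, ∀ y, |R s y| ≤ B) :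
    ∃ C, ∀ x : E n,
      (∀ s ∈ Ioo 0 t, Integrable fun y => oseenKernel (t - s) j k l (x - y) * R s y) ∧
      Integrable (fun p : ℝ × E n => oseenKernel (t - p.1) j k l (x - p.2) * R p.1 p.2)
        ((volume.restrict (Ioo 0 t)).prod volume) ∧
      ∫ p, ‖oseenKernel (t - p.1) j k l (x - p.2) * R p.1 p.2‖
        ∂((volume.restrict (Ioo 0 t)).prod volume) ≤ C := by
  obtain ⟨C, hC, hK⟩ := exists_integral_oseenKernel_le n
  obtain ⟨hi, hv⟩ := integral_inv_sqrt_sub ht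
  have hB0 : 0 ≤ B := (abs_nonneg _).trans (hB (t / 2) ⟨by linarith, by linarith⟩ 0)
  refine ⟨B * C * (2 * √t), fun x => ?_⟩
  have hm : Measurable fun p : ℝ × E n => oseenKernel (t - p.1) j k l (x - p.2) * R p.1 p.2 := by
    have h1 : Measurable fun p : ℝ × E n => ((t - p.1, x - p.2) : ℝ × E n) := by fun_prop
    exact ((measurable_oseenKernel j k l).comp h1).mul hR
  have hsl : ∀ s ∈ Ioo 0 t, (Integrable fun y => oseenKernel (t - s) j k l (x - y) * R s y) ∧
      ∫ y, ‖oseenKernel (t - s) j k l (x - y) * R s y‖ ≤ B * C * (√(t - s))⁻¹ := by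
    intro s hs
    have hτ : 0 < t - s := by linarith [hs.2]
    have hF := ((integrable_integral_norm_oseenKernel hτ j k l).1).comp_sub_left x
    have hle : ∀ y, ‖oseenKernel (t - s) j k l (x - y) * R s y‖ ≤
        B * |oseenKernel (t - s) j k l (x - y)| := fun y => by
      rw [norm_mul, mul_comm, Real.norm_eq_abs, Real.norm_eq_abs]
      exact mul_le_mul_of_nonneg_right (hB s hs y) (abs_nonneg _)
    have hI : Integrable fun y => oseenKernel (t - s) j k l (x - y) * R s y :=
      (hF.abs.const_mul B).mono' (hm.comp measurable_prodMk_left).aestronglyMeasurable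
        (Eventually.of_forall hle)
    refine ⟨hI, (integral_mono hI.norm (hF.abs.const_mul B) hle).trans ?_⟩
    rw [integral_const_mul, mul_assoc,
      integral_sub_left_eq_self (fun y => |oseenKernel (t - s) j k l y|) volume x]
    exact mul_le_mul_of_nonneg_left (hK (t - s) hτ j k l) hB0
  have hb : ∀ᵐ s ∂(volume.restrict (Ioo 0 t)),
      ‖∫ y, ‖oseenKernel (t - s) j k l (x - y) * R s y‖‖ ≤ B * C * (√(t - s))⁻¹ :=
    (ae_restrict_mem measurableSet_Ioo).mono fun s hs => by
      rw [Real.norm_of_nonneg (integral_nonneg fun y => norm_nonneg _)]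
      exact (hsl s hs).2
  have hint : Integrable (fun p : ℝ × E n => oseenKernel (t - p.1) j k l (x - p.2) * R p.1 p.2)
      ((volume.restrict (Ioo 0 t)).prod volume) := by
    rw [integrable_prod_iff hm.aestronglyMeasurable]
    refine ⟨(ae_restrict_mem measurableSet_Ioo).mono fun s hs => (hsl s hs).1, ?_⟩
    exact (hi.const_mul (B * C)).mono'
      (hm.aestronglyMeasurable.norm.integral_prod_right') hb
  refine ⟨fun s hs => (hsl s hs).1, hint, ?_⟩
  rw [integral_prod _ hint.norm]
  refine (le_abs_self _).trans ((norm_integral_le_of_norm_le (hi.const_mul (B * C)) hb).trans_eq ?_)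
  rw [integral_const_mul, hv]

theorem measurable_momentCorrection {n N : ℕ} {χ : E n → ℝ} (hf : ContDiff ℝ ∞ χ)
    (hc : HasCompactSupport χ) {q : ℝ → E n → ℝ} (hq : Measurable (Function.uncurry q)) :
    Measurable (Function.uncurry fun s => momentCorrection N χ (q s)) := by
  refine hq.sub (Finset.measurable_sum _ fun α _ => Measurable.mul ?_ ?_)
  · exact (contDiff_controlProfile hf hc α).1.continuous.measurable.comp measurable_snd
  · have h : StronglyMeasurable fun p : ℝ × E n => monomialAt α p.2 * q p.1 p.2 :=
      (((continuous_monomialAt α).measurable.comp measurable_snd).mul hq).stronglyMeasurable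
    exact (h.integral_prod_right' (ν := volume)).measurable.comp measurable_fst

theorem measurable_duhamel {n N : ℕ} {χ : E n → ℝ} (hf : ContDiff ℝ ∞ χ)
    (hc : HasCompactSupport χ) (j k l : Fin n) {q : ℝ → E n → ℝ}
    (hq : Measurable (Function.uncurry q)) :
    Measurable (Function.uncurry (duhamel N χ j k l q)) := by
  have h1 : StronglyMeasurable fun p : ((ℝ × E n) × ℝ) × E n =>
      oseenKernel (p.1.1.1 - p.1.2) j k l (p.1.1.2 - p.2) * momentCorrection N χ (q p.1.2) p.2 := by
    have e1 : Measurable fun p : ((ℝ × E n) × ℝ) × E n =>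
        ((p.1.1.1 - p.1.2, p.1.1.2 - p.2) : ℝ × E n) := by fun_prop
    have e2 : Measurable fun p : ((ℝ × E n) × ℝ) × E n => ((p.1.2, p.2) : ℝ × E n) := by fun_prop
    exact (((measurable_oseenKernel j k l).comp e1).mul
      ((measurable_momentCorrection hf hc hq).comp e2)).stronglyMeasurable
  have h2 := (h1.integral_prod_right' (ν := volume)).measurable
  have h3 : MeasurableSet {p : (ℝ × E n) × ℝ | p.2 ∈ Ioo 0 p.1.1} :=
    (measurableSet_lt measurable_const measurable_snd).inter
      (measurableSet_lt measurable_snd (measurable_fst.comp measurable_fst))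
  have h4 := ((h2.indicator h3).stronglyMeasurable.integral_prod_right' (ν := volume)).measurable
  convert h4 using 1
  ext ⟨t, x⟩
  rw [Function.uncurry_apply_pair, duhamel, ← integral_indicator measurableSet_Ioo]
  rfl

/-- The heat convolution `e^{tΔ} v`. -/
noncomputable def heatConv {n : ℕ} (t : ℝ) (v : E n → E n) (x : E n) : E n :=
  ∫ y, heatKernel t (x - y) • v y

theorem measurable_heatConv {n : ℕ} {v : E n → E n} (hv : Measurable v) :
    Measurable (Function.uncurry fun t => heatConv t v) := by
  have h1 : StronglyMeasurable fun p : (ℝ × E n) × E n =>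
      heatKernel p.1.1 (p.1.2 - p.2) • v p.2 := by
    have e1 : Measurable fun p : (ℝ × E n) × E n => ((p.1.1, p.1.2 - p.2) : ℝ × E n) := by fun_prop
    exact (((measurable_heatKernel n).comp e1).smul (hv.comp measurable_snd)).stronglyMeasurable
  exact (h1.integral_prod_right' (ν := volume)).measurable

/-! ### Contractions for a weighted supremum norm -/

/-- A map that preserves the measurable functions `u` with `‖u‖ ≤ r W` and halves distances there
has a fixed point among them. -/
theorem exists_fixedPoint_of_weighted_contraction {α F : Type*} [MeasurableSpace α]
    [NormedAddCommGroup F] [CompleteSpace F] [MeasurableSpace F] [BorelSpace F]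
    {W : α → ℝ} (hW : ∀ p, 0 ≤ W p) {r : ℝ} (hr : 0 ≤ r) (Φ : (α → F) → α → F)
    (hΦ : ∀ u, Measurable u → (∀ p, ‖u p‖ ≤ r * W p) →
      Measurable (Φ u) ∧ ∀ p, ‖Φ u p‖ ≤ r * W p)
    (hcon : ∀ u w, Measurable u → Measurable w → (∀ p, ‖u p‖ ≤ r * W p) →
      (∀ p, ‖w p‖ ≤ r * W p) → ∀ δ : ℝ, 0 ≤ δ → (∀ p, ‖u p - w p‖ ≤ δ * W p) →
      ∀ p, ‖Φ u p - Φ w p‖ ≤ δ / 2 * W p) :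
    ∃ u, Measurable u ∧ (∀ p, ‖u p‖ ≤ r * W p) ∧ Φ u = u := by
  let U : ℕ → α → F := fun k => Φ^[k] 0
  have hU : ∀ k, U (k + 1) = Φ (U k) := fun k => Function.iterate_succ_apply' Φ k 0
  have hball : ∀ k, Measurable (U k) ∧ ∀ p, ‖U k p‖ ≤ r * W p := by
    intro k
    induction k with
    | zero => exact ⟨measurable_const, fun p => by simpa [U] using mul_nonneg hr (hW p)⟩
    | succ k ih => rw [hU]; exact hΦ _ ih.1 ih.2
  have hstep : ∀ k p, ‖U (k + 1) p - U k p‖ ≤ r / 2 ^ k * W p := by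
    intro k
    induction k with
    | zero => intro p; simpa [U] using (hball 1).2 p
    | succ k ih =>
      intro p
      have := hcon _ _ (hball (k + 1)).1 (hball k).1 (hball (k + 1)).2 (hball k).2 _
        (by positivity) ih p
      rw [← hU, ← hU] at this
      rwa [pow_succ, ← div_div]
  have hd : ∀ p k, dist (U k p) (U (k + 1) p) ≤ 2 * (r * W p) / 2 / 2 ^ k := by
    intro p k
    rw [dist_comm, dist_eq_norm]
    exact (hstep k p).trans_eq (by ring)
  have hlim : ∀ p, ∃ a, Tendsto (fun k => U k p) atTop (nhds a) := fun p =>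
    cauchySeq_tendsto_of_complete (cauchySeq_of_le_geometric_two (hd p))
  choose u hu using hlim
  have hum : Measurable u :=
    measurable_of_tendsto_metrizable (fun k => (hball k).1) (tendsto_pi_nhds.2 hu)
  have hub : ∀ p, ‖u p‖ ≤ r * W p := fun p =>
    le_of_tendsto (hu p).norm (Eventually.of_forall fun k => (hball k).2 p)
  refine ⟨u, hum, hub, funext fun p => ?_⟩
  have hdist : ∀ k p, ‖U k p - u p‖ ≤ 2 * r / 2 ^ k * W p := by
    intro k p
    rw [← dist_eq_norm]
    exact (dist_le_of_le_geometric_two_of_tendsto (hd p) (hu p) k).trans_eq (by ring)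
  have hconv : Tendsto (fun k => U (k + 1) p) atTop (nhds (Φ u p)) := by
    rw [tendsto_iff_norm_sub_tendsto_zero]
    have hz : Tendsto (fun k : ℕ => r * W p * (1 / 2 : ℝ) ^ k) atTop (nhds 0) := by
      simpa using (tendsto_pow_atTop_nhds_zero_of_lt_one (by norm_num : (0 : ℝ) ≤ 1 / 2)
        (by norm_num)).const_mul (r * W p)
    refine squeeze_zero (fun _ => norm_nonneg _) (fun k => ?_) hz
    rw [hU]
    refine (hcon _ _ (hball k).1 hum (hball k).2 hub _ (by positivity) (hdist k) p).trans_eq ?_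
    rw [div_pow, one_pow]
    ring
  exact tendsto_nhds_unique hconv ((hu p).comp (tendsto_add_atTop_nat 1))

/-! ### Linearity of the Duhamel term -/

theorem exists_momentCorrection_bound {n m N : ℕ} (hn : 1 ≤ n) (hN : N ≤ m + 1) {χ : E n → ℝ}
    (hf : ContDiff ℝ ∞ χ) (hc : HasCompactSupport χ)
    (hχ : ∀ γ : Fin n → ℕ, ∑ i, γ i < m + 1 →
        ∫ y, monomialAt γ y * χ y = if γ = 0 then 1 else 0) {a : ℝ} (ha : 0 ≤ a) :
    ∃ B, ∀ q : E n → ℝ, Measurable q → (∀ y, |q y| ≤ a / (1 + ‖y‖) ^ (2 * (n + 1 + m))) →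
      ∀ y, |momentCorrection N χ q y| ≤ B := by
  obtain ⟨C, hC, h⟩ := exists_momentCorrection_le hn hN hf hc hχ
  refine ⟨C * a, fun q hq hqb y => ((h a 1 ha le_rfl q hq hqb).2.1 y).trans ?_⟩
  rw [one_pow, div_one]
  refine div_le_self (by positivity) (one_le_pow₀ ?_)
  linarith [norm_nonneg y]

theorem momentCorrection_sub {n m N : ℕ} (hN : N ≤ m + 1) (χ : E n → ℝ) {a : ℝ} (ha : 0 ≤ a)
    {q r : E n → ℝ} (hqm : Measurable q) (hrm : Measurable r)
    (hq : ∀ y, |q y| ≤ a / (1 + ‖y‖) ^ (2 * (n + 1 + m)))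
    (hr : ∀ y, |r y| ≤ a / (1 + ‖y‖) ^ (2 * (n + 1 + m))) (y : E n) :
    momentCorrection N χ (fun z => q z - r z) y =
      momentCorrection N χ q y - momentCorrection N χ r y := by
  have h : ∀ α ∈ multiIndicesBelow n N, ∫ z, monomialAt α z * (q z - r z) =
      (∫ z, monomialAt α z * q z) - ∫ z, monomialAt α z * r z := by
    intro α hα
    have hα' := (mem_multiIndicesBelow α).1 hα
    simp only [mul_sub]
    exact integral_sub (abs_moment_le ha one_pos hqm hq α (by omega)).1
      (abs_moment_le ha one_pos hrm hr α (by omega)).1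
  simp only [momentCorrection]
  rw [Finset.sum_congr rfl fun α hα => by rw [h α hα]]
  simp only [mul_sub, Finset.sum_sub_distrib]
  ring

theorem duhamel_sub {n m N : ℕ} (hn : 1 ≤ n) (hN : N ≤ m + 1) {χ : E n → ℝ}
    (hf : ContDiff ℝ ∞ χ) (hc : HasCompactSupport χ)
    (hχ : ∀ γ : Fin n → ℕ, ∑ i, γ i < m + 1 →
        ∫ y, monomialAt γ y * χ y = if γ = 0 then 1 else 0) {a : ℝ} (ha : 0 ≤ a)
    {q r : ℝ → E n → ℝ} (hqm : Measurable (Function.uncurry q))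
    (hrm : Measurable (Function.uncurry r)) {t : ℝ} (ht : 0 < t)
    (hq : ∀ s ∈ Ioo 0 t, ∀ y, |q s y| ≤ a / (1 + ‖y‖) ^ (2 * (n + 1 + m)))
    (hr : ∀ s ∈ Ioo 0 t, ∀ y, |r s y| ≤ a / (1 + ‖y‖) ^ (2 * (n + 1 + m)))
    (j k l : Fin n) (x : E n) :
    duhamel N χ j k l (fun s y => q s y - r s y) t x =
      duhamel N χ j k l q t x - duhamel N χ j k l r t x := by
  obtain ⟨B, hB⟩ := exists_momentCorrection_bound (N := N) hn hN hf hc hχ ha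
  have hqs : ∀ s, Measurable (q s) := fun s => hqm.comp measurable_prodMk_left
  have hrs : ∀ s, Measurable (r s) := fun s => hrm.comp measurable_prodMk_left
  obtain ⟨_, h1⟩ := exists_integrable_oseenKernel_mul ht j k l
    (measurable_momentCorrection (N := N) hf hc hqm) (fun s hs => hB _ (hqs s) (hq s hs))
  obtain ⟨_, h2⟩ := exists_integrable_oseenKernel_mul ht j k l
    (measurable_momentCorrection (N := N) hf hc hrm) (fun s hs => hB _ (hrs s) (hr s hs))
  obtain ⟨h1s, h1i, -⟩ := h1 x
  obtain ⟨h2s, h2i, -⟩ := h2 x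
  rw [duhamel, duhamel, duhamel, ← integral_sub h1i.integral_prod_left h2i.integral_prod_left]
  refine setIntegral_congr_fun measurableSet_Ioo fun s hs => ?_
  simp only
  rw [← integral_sub (h1s s hs) (h2s s hs)]
  refine integral_congr_ae (Eventually.of_forall fun y => ?_)
  simp only
  rw [momentCorrection_sub hN χ ha (hqs s) (hrs s) (hq s hs) (hr s hs), mul_sub]

/-! ### Incompressibility -/

theorem locallyIntegrable_of_bounded {n : ℕ} {v : E n → E n} (hv : Measurable v) {B : ℝ}
    (hB : ∀ x, ‖v x‖ ≤ B) : LocallyIntegrable v volume :=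
  (locallyIntegrable_const B).mono hv.aestronglyMeasurable
    (Eventually.of_forall fun x => (hB x).trans (le_abs_self B))

theorem integrable_heatKernel_smul {n : ℕ} {t : ℝ} (ht : 0 < t) {v : E n → E n}
    (hv : Measurable v) {B : ℝ} (hB : ∀ x, ‖v x‖ ≤ B) (x : E n) :
    Integrable fun y => heatKernel t (x - y) • v y := by
  refine (((integrable_heatKernel ht).comp_sub_left x).norm.mul_const B).mono'
    (((measurable_heatKernel_apply t).comp (by fun_prop)).smul hv).aestronglyMeasurable
    (Eventually.of_forall fun y => ?_)
  rw [norm_smul]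
  exact mul_le_mul_of_nonneg_left (hB y) (norm_nonneg _)

/-- The heat flow preserves the divergence-free condition: the heat kernel averages translates. -/
theorem integral_fderiv_heatConv {n : ℕ} {t : ℝ} (ht : 0 < t) {v : E n → E n} (hv : Measurable v)
    {B : ℝ} (hB : ∀ x, ‖v x‖ ≤ B) (hdiv : IsWeaklyDivFree v) {φ : E n → ℝ}
    (hφ : ContDiff ℝ ∞ φ) (hc : HasCompactSupport φ) :
    ∫ x, fderiv ℝ φ x (heatConv t v x) = 0 := by
  have hφ' : Continuous (fderiv ℝ φ) := hφ.continuous_fderiv (by simp)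
  have hφi : Integrable (fun x => ‖fderiv ℝ φ x‖) :=
    hφ'.norm.integrable_of_hasCompactSupport (hc.fderiv (𝕜 := ℝ)).norm
  have hg := integrable_heatKernel (n := n) ht
  have hgv := integrable_heatKernel_smul ht hv hB
  have h1 : ∀ x, fderiv ℝ φ x (heatConv t v x) =
      ∫ z, heatKernel t z * fderiv ℝ φ x (v (x - z)) := by
    intro x
    rw [heatConv, ← ContinuousLinearMap.integral_comp_comm _ (hgv x),
      ← integral_sub_left_eq_self _ volume x]
    simp
  have hm : Measurable fun p : E n × E n => heatKernel t p.2 * fderiv ℝ φ p.1 (v (p.1 - p.2)) := by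
    have e1 : Measurable fun p : E n × E n => v (p.1 - p.2) :=
      hv.comp (measurable_fst.sub measurable_snd)
    have e2 : Measurable fun p : E n × E n => fderiv ℝ φ p.1 :=
      hφ'.measurable.comp measurable_fst
    exact ((measurable_heatKernel_apply t).comp measurable_snd).mul
      (isBoundedBilinearMap_apply.continuous.measurable.comp (e2.prodMk e1))
  have hint : Integrable (fun p : E n × E n => heatKernel t p.2 * fderiv ℝ φ p.1 (v (p.1 - p.2)))
      (volume.prod volume) := by
    refine ((hφi.mul_prod hg.norm).mul_const B).mono' hm.aestronglyMeasurable
      (Eventually.of_forall fun p => ?_)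
    rw [norm_mul]
    calc _ ≤ ‖heatKernel t p.2‖ * (‖fderiv ℝ φ p.1‖ * ‖v (p.1 - p.2)‖) := by
          gcongr; exact ContinuousLinearMap.le_opNorm _ _
      _ ≤ ‖heatKernel t p.2‖ * (‖fderiv ℝ φ p.1‖ * B) := by gcongr; exact hB _
      _ = _ := by ring
  simp only [h1]
  rw [integral_integral_swap hint]
  have h2 : ∀ z, ∫ x, heatKernel t z * fderiv ℝ φ x (v (x - z)) = 0 := by
    intro z
    have e := hdiv.2 (fun x => φ (x + z)) (hφ.comp (contDiff_id.add contDiff_const))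
      (hc.comp_homeomorph (Homeomorph.addRight z))
    rw [integral_const_mul, ← integral_add_right_eq_self _ z]
    simp only [fderiv_comp_add_right] at e
    simp only [add_sub_cancel_right, e, mul_zero]
  simp only [h2, integral_zero]

/-- The Duhamel term is divergence free, because the Oseen kernel is. -/
theorem sum_integral_partialDeriv_mul_duhamel {n m N : ℕ} (hn : 1 ≤ n) (hN : N ≤ m + 1)
    {χ : E n → ℝ} (hf : ContDiff ℝ ∞ χ) (hc : HasCompactSupport χ)
    (hχ : ∀ γ : Fin n → ℕ, ∑ i, γ i < m + 1 →
        ∫ y, monomialAt γ y * χ y = if γ = 0 then 1 else 0) {a : ℝ} (ha : 0 ≤ a)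
    {q : ℝ → E n → ℝ} (hqm : Measurable (Function.uncurry q)) {t : ℝ} (ht : 0 < t)
    (hq : ∀ s ∈ Ioo 0 t, ∀ y, |q s y| ≤ a / (1 + ‖y‖) ^ (2 * (n + 1 + m)))
    (k l : Fin n) {φ : E n → ℝ} (hφ : ContDiff ℝ ∞ φ) (hφc : HasCompactSupport φ) :
    ∑ j, ∫ x, partialDeriv j φ x * duhamel N χ j k l q t x = 0 := by
  obtain ⟨B, hB⟩ := exists_momentCorrection_bound (N := N) hn hN hf hc hχ ha
  have hqs : ∀ s, Measurable (q s) := fun s => hqm.comp measurable_prodMk_left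
  have hRm := measurable_momentCorrection (N := N) hf hc hqm
  set R : ℝ → E n → ℝ := fun s => momentCorrection N χ (q s) with hR
  set μ := (volume.restrict (Ioo 0 t)).prod (volume : Measure (E n)) with hμ
  have key : ∀ j, Integrable (fun p : E n × (ℝ × E n) => partialDeriv j φ p.1 *
      (oseenKernel (t - p.2.1) j k l (p.1 - p.2.2) * R p.2.1 p.2.2)) (volume.prod μ) ∧
      ∀ x, duhamel N χ j k l q t x =
        ∫ p, oseenKernel (t - p.1) j k l (x - p.2) * R p.1 p.2 ∂μ := by
    intro j
    obtain ⟨C, hC⟩ := exists_integrable_oseenKernel_mul ht j k l hRm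
      (fun s hs => hB _ (hqs s) (hq s hs))
    refine ⟨?_, fun x => (integral_prod _ (hC x).2.1).symm⟩
    have hd : Continuous (partialDeriv j φ) := (contDiff_partialDeriv j hφ).continuous
    have hdi : Integrable (partialDeriv j φ) :=
      hd.integrable_of_hasCompactSupport (hasCompactSupport_partialDeriv j hφc)
    have hm : Measurable fun p : E n × (ℝ × E n) => partialDeriv j φ p.1 *
        (oseenKernel (t - p.2.1) j k l (p.1 - p.2.2) * R p.2.1 p.2.2) := by
      have e1 : Measurable fun p : E n × (ℝ × E n) =>
          ((t - p.2.1, p.1 - p.2.2) : ℝ × E n) := by fun_prop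
      exact (hd.measurable.comp measurable_fst).mul
        (((measurable_oseenKernel j k l).comp e1).mul (hRm.comp measurable_snd))
    rw [integrable_prod_iff hm.aestronglyMeasurable]
    refine ⟨Eventually.of_forall fun x => (hC x).2.1.const_mul (partialDeriv j φ x), ?_⟩
    refine (hdi.norm.mul_const C).mono' hm.aestronglyMeasurable.norm.integral_prod_right'
      (Eventually.of_forall fun x => ?_)
    rw [Real.norm_of_nonneg (integral_nonneg fun p => norm_nonneg _)]
    simp only [norm_mul (partialDeriv j φ x)]
    rw [integral_const_mul]
    exact mul_le_mul_of_nonneg_left (hC x).2.2 (norm_nonneg _)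
  have h1 : ∀ j, ∫ x, partialDeriv j φ x * duhamel N χ j k l q t x =
      ∫ p, (∫ x, partialDeriv j φ x *
        (oseenKernel (t - p.1) j k l (x - p.2) * R p.1 p.2)) ∂μ := by
    intro j
    rw [← integral_integral_swap (key j).1]
    refine integral_congr_ae (Eventually.of_forall fun x => ?_)
    simp only
    rw [(key j).2, integral_const_mul]
  simp only [h1]
  rw [← integral_finsetSum _ fun j _ => (key j).1.integral_prod_right]
  refine integral_eq_zero_of_ae ?_
  have hae : ∀ᵐ p ∂μ, p.1 ∈ Ioo 0 t := by
    have : ∀ᵐ s ∂(volume.restrict (Ioo 0 t)), s ∈ Ioo 0 t := ae_restrict_mem measurableSet_Ioo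
    exact Measure.quasiMeasurePreserving_fst.ae this
  filter_upwards [hae] with p hp
  have h2 := sum_integral_partialDeriv_mul_oseenKernel (τ := t - p.1) (by linarith [hp.2]) k l
    hφ hφc p.2
  simp only [← mul_assoc, integral_mul_const]
  rw [← Finset.sum_mul, h2, zero_mul, Pi.zero_apply]

/-! ### The fixed point equation -/

/-- The entry `u_k u_l` of `u ⊗ u`. -/
def tensorEntry {n : ℕ} (u : ℝ → E n → E n) (k l : Fin n) (s : ℝ) (y : E n) : ℝ :=
  u s y k * u s y l

open Classical in
/-- The right-hand side of the integral equation on the time set `I`, with the force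
`f = ∑_{|α| < N} (∫ z^α u ⊗ u) χ_α` expressed through `u`; it is `v` at time `0`, and `0`
outside `I`. -/
noncomputable def mildMap {n : ℕ} (N : ℕ) (χ : E n → ℝ) (I : Set ℝ) (v : E n → E n)
    (u : ℝ → E n → E n) (t : ℝ) (x : E n) : E n :=
  if t = 0 then v x else if t ∈ I then
    heatConv t v x - WithLp.toLp 2 fun j => ∑ k, ∑ l, duhamel N χ j k l (tensorEntry u k l) t x
  else 0

/-- The weight `(b(t) + |x|)^{-(n+1+m)}`. -/
noncomputable def decayWeight {n : ℕ} (m : ℕ) (b : ℝ → ℝ) (t : ℝ) (x : E n) : ℝ :=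
  ((b t + ‖x‖) ^ (n + 1 + m))⁻¹

/-- A time set `I` and a scale `b` for which the Duhamel term maps the square of the weight
`decayWeight m b` to the weight itself, with constant `D`. -/
structure IsDuhamelScale {n : ℕ} (m N : ℕ) (χ : E n → ℝ) (I : Set ℝ) (b : ℝ → ℝ) (D : ℝ) :
    Prop where
  measurableSet : MeasurableSet I
  nonneg : I ⊆ Ici 0
  Ioo_subset : ∀ t ∈ I, Ioo 0 t ⊆ I
  one_le : ∀ t, 1 ≤ b t
  zero_eq : b 0 = 1
  const_nonneg : 0 ≤ D
  duhamel_le : ∀ t ∈ I, 0 < t → ∀ j k l : Fin n, ∀ a : ℝ, 0 ≤ a → ∀ q : ℝ → E n → ℝ,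
    (∀ s, Measurable (q s)) →
    (∀ s ∈ Ioo 0 t, ∀ y, |q s y| ≤ a / (b s + ‖y‖) ^ (2 * (n + 1 + m))) → ∀ x : E n,
    |duhamel N χ j k l q t x| ≤ D * a * decayWeight m b t x

theorem measurable_tensorEntry {n : ℕ} {u : ℝ → E n → E n} (hu : Measurable (Function.uncurry u))
    (k l : Fin n) : Measurable (Function.uncurry (tensorEntry u k l)) :=
  (measurable_coord hu k).mul (measurable_coord hu l)

theorem abs_coord_le {n : ℕ} (x : E n) (k : Fin n) : |x k| ≤ ‖x‖ := PiLp.norm_apply_le x k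

theorem abs_mul_coord_sub_le {n : ℕ} {x y : E n} {r δ : ℝ} (hx : ‖x‖ ≤ r) (hy : ‖y‖ ≤ r)
    (hxy : ‖x - y‖ ≤ δ) (k l : Fin n) : |x k * x l - y k * y l| ≤ 2 * r * δ := by
  have e : x k * x l - y k * y l = (x - y) k * x l + y k * (x - y) l := by
    simp only [PiLp.sub_apply]; ring
  have hr : 0 ≤ r := (norm_nonneg x).trans hx
  have hδ : 0 ≤ δ := (norm_nonneg _).trans hxy
  rw [e]
  refine (abs_add_le _ _).trans ?_
  rw [abs_mul, abs_mul]
  calc _ ≤ δ * r + r * δ := by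
        gcongr
        exacts [(abs_coord_le _ _).trans hxy, (abs_coord_le _ _).trans hx,
          (abs_coord_le _ _).trans hy, (abs_coord_le _ _).trans hxy]
    _ = _ := by ring

theorem norm_toLp_le {n : ℕ} {f : Fin n → ℝ} {c : ℝ} (h : ∀ j, |f j| ≤ c) :
    ‖(WithLp.toLp 2 f : E n)‖ ≤ n * c := by
  refine (norm_le_sum_abs _).trans ((Finset.sum_le_sum fun j _ => h j).trans_eq ?_)
  simp

theorem abs_sum_sum_le {n : ℕ} {f : Fin n → Fin n → ℝ} {c : ℝ} (h : ∀ k l, |f k l| ≤ c) :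
    |∑ k, ∑ l, f k l| ≤ n * (n * c) := by
  refine (Finset.abs_sum_le_sum_abs _ _).trans ?_
  refine (Finset.sum_le_sum fun k _ => (Finset.abs_sum_le_sum_abs _ _).trans
    (Finset.sum_le_sum fun l _ => h k l)).trans_eq ?_
  simp

section

variable {n m N : ℕ} {χ : E n → ℝ} {I : Set ℝ} {b : ℝ → ℝ} {D c : ℝ} {v : E n → E n}

theorem decayWeight_nonneg (hb : ∀ t, 1 ≤ b t) (t : ℝ) (x : E n) : 0 ≤ decayWeight m b t x := by
  have := hb t
  unfold decayWeight
  positivity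

theorem decayWeight_le (hb : ∀ t, 1 ≤ b t) (t : ℝ) (x : E n) :
    decayWeight m b t x ≤ ((1 + ‖x‖) ^ (n + 1 + m))⁻¹ := by
  have := hb t
  unfold decayWeight
  gcongr

theorem decayWeight_le_one (hb : ∀ t, 1 ≤ b t) (t : ℝ) (x : E n) : decayWeight m b t x ≤ 1 :=
  (decayWeight_le hb t x).trans
    (inv_le_one_of_one_le₀ (one_le_pow₀ (by linarith [norm_nonneg x])))

theorem mul_decayWeight_sq (a t : ℝ) (x : E n) :
    a * (decayWeight m b t x * decayWeight m b t x) =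
      a / (b t + ‖x‖) ^ (2 * (n + 1 + m)) := by
  rw [decayWeight, ← mul_inv, ← pow_add, ← two_mul, div_eq_mul_inv]

theorem abs_tensorEntry_le {u : ℝ → E n → E n} {r : ℝ} (hr : 0 ≤ r) (hb : ∀ t, 1 ≤ b t)
    (hu : ∀ t x, ‖u t x‖ ≤ r * decayWeight m b t x) (k l : Fin n) (s : ℝ) (y : E n) :
    |tensorEntry u k l s y| ≤ r ^ 2 / (b s + ‖y‖) ^ (2 * (n + 1 + m)) := by
  have hW := decayWeight_nonneg (m := m) hb s y
  rw [← mul_decayWeight_sq, tensorEntry, abs_mul]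
  calc _ ≤ (r * decayWeight m b s y) * (r * decayWeight m b s y) := by
        gcongr
        exacts [(abs_coord_le _ _).trans (hu s y), (abs_coord_le _ _).trans (hu s y)]
    _ = _ := by ring

theorem div_add_norm_pow_le (hb : ∀ t, 1 ≤ b t) {a : ℝ} (ha : 0 ≤ a) (s : ℝ) (y : E n) (p : ℕ) :
    a / (b s + ‖y‖) ^ p ≤ a / (1 + ‖y‖) ^ p := by
  have := hb s
  gcongr

theorem measurable_mildMap (hf : ContDiff ℝ ∞ χ) (hc : HasCompactSupport χ) (hI : MeasurableSet I)
    (hv : Measurable v) {u : ℝ → E n → E n} (hu : Measurable (Function.uncurry u)) :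
    Measurable (Function.uncurry (mildMap N χ I v u)) := by
  have h1 : Measurable fun p : ℝ × E n => heatConv p.1 v p.2 -
      WithLp.toLp 2 fun j => ∑ k, ∑ l, duhamel N χ j k l (tensorEntry u k l) p.1 p.2 := by
    refine (measurable_heatConv hv).sub (measurable_of_coord fun j => ?_)
    change Measurable fun p : ℝ × E n =>
      ∑ k, ∑ l, duhamel N χ j k l (tensorEntry u k l) p.1 p.2
    exact Finset.measurable_sum _ fun k _ => Finset.measurable_sum _ fun l _ =>
      measurable_duhamel hf hc j k l (measurable_tensorEntry hu k l)
  have h0 : MeasurableSet {p : ℝ × E n | p.1 = 0} := measurable_fst (measurableSet_singleton 0)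
  exact Measurable.ite h0 (hv.comp measurable_snd)
    (Measurable.ite (measurable_fst hI) h1 measurable_const)

/-- For small data, the integral equation has a solution with the decay of the weight. -/
theorem exists_mildMap_eq (hn : 1 ≤ n) (hN : N ≤ m + 1) (hf : ContDiff ℝ ∞ χ)
    (hc : HasCompactSupport χ) (hχ : ∀ γ : Fin n → ℕ, ∑ i, γ i < m + 1 →
      ∫ y, monomialAt γ y * χ y = if γ = 0 then 1 else 0)
    (hD : IsDuhamelScale m N χ I b D) (hv : Measurable v) (hc0 : 0 ≤ c)
    (h0 : ∀ x, ‖v x‖ ≤ c * ((1 + ‖x‖) ^ (n + 1 + m))⁻¹)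
    (hH : ∀ t ∈ I, 0 < t → ∀ x, ‖heatConv t v x‖ ≤ c * decayWeight m b t x)
    (hsmall : 8 * (n : ℝ) ^ 3 * D * c ≤ 1) :
    ∃ u : ℝ → E n → E n, Measurable (Function.uncurry u) ∧
      (∀ t x, ‖u t x‖ ≤ 2 * c * decayWeight m b t x) ∧ mildMap N χ I v u = u := by
  have hb := hD.one_le
  have hD0 := hD.const_nonneg
  have hpos : ∀ t ∈ I, t ≠ 0 → 0 < t := fun t ht h => lt_of_le_of_ne (hD.nonneg ht) h.symm
  have hball : ∀ u : ℝ → E n → E n, Measurable (Function.uncurry u) →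
      (∀ t x, ‖u t x‖ ≤ 2 * c * decayWeight m b t x) → ∀ t x,
      ‖mildMap N χ I v u t x‖ ≤ 2 * c * decayWeight m b t x := by
    intro u hu hub t x
    have hW := decayWeight_nonneg (m := m) hb t x
    unfold mildMap
    split_ifs with ht ht
    · subst ht
      refine (h0 x).trans ?_
      rw [decayWeight, hD.zero_eq, mul_assoc 2, two_mul]
      exact le_add_of_nonneg_left (by positivity)
    · have hd : ∀ j k l, |duhamel N χ j k l (tensorEntry u k l) t x| ≤
          D * (2 * c) ^ 2 * decayWeight m b t x := fun j k l =>
        hD.duhamel_le t ht (hpos t ht ‹_›) j k l _ (by positivity) _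
          (fun s => (measurable_tensorEntry hu k l).comp measurable_prodMk_left)
          (fun s _ y => abs_tensorEntry_le (by positivity) hb hub k l s y) x
      refine (norm_sub_le _ _).trans ((add_le_add (hH t ht (hpos t ht ‹_›) x)
        (norm_toLp_le fun j => abs_sum_sum_le (hd j))).trans ?_)
      have h1 : 8 * (n : ℝ) ^ 3 * D * c * (c * decayWeight m b t x) ≤
          1 * (c * decayWeight m b t x) := mul_le_mul_of_nonneg_right hsmall (by positivity)
      have h2 : 0 ≤ c * decayWeight m b t x := by positivity
      calc _ = c * decayWeight m b t x +
            8 * (n : ℝ) ^ 3 * D * c * (c * decayWeight m b t x) / 2 := by ring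
        _ ≤ _ := by linarith
    · rw [norm_zero]; positivity
  have hcon : ∀ u w : ℝ → E n → E n, Measurable (Function.uncurry u) →
      Measurable (Function.uncurry w) → (∀ t x, ‖u t x‖ ≤ 2 * c * decayWeight m b t x) →
      (∀ t x, ‖w t x‖ ≤ 2 * c * decayWeight m b t x) → ∀ δ : ℝ, 0 ≤ δ →
      (∀ t x, ‖u t x - w t x‖ ≤ δ * decayWeight m b t x) → ∀ t x,
      ‖mildMap N χ I v u t x - mildMap N χ I v w t x‖ ≤ δ / 2 * decayWeight m b t x := by
    intro u w hu hw hub hwb δ hδ huw t x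
    have hW := decayWeight_nonneg (m := m) hb t x
    unfold mildMap
    split_ifs with ht ht
    · rw [sub_self, norm_zero]; positivity
    · have ht0 := hpos t ht ‹_›
      have hum := measurable_tensorEntry hu
      have hwm := measurable_tensorEntry hw
      have hd : ∀ j k l, |duhamel N χ j k l (tensorEntry w k l) t x -
          duhamel N χ j k l (tensorEntry u k l) t x| ≤
          D * (2 * (2 * c) * δ) * decayWeight m b t x := by
        intro j k l
        rw [abs_sub_comm, ← duhamel_sub hn hN hf hc hχ (sq_nonneg (2 * c)) (hum k l) (hwm k l) ht0
          (fun s _ y => (abs_tensorEntry_le (by positivity) hb hub k l s y).trans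
            (div_add_norm_pow_le hb (by positivity) s y _))
          (fun s _ y => (abs_tensorEntry_le (by positivity) hb hwb k l s y).trans
            (div_add_norm_pow_le hb (by positivity) s y _))]
        refine hD.duhamel_le t ht ht0 j k l _ (by positivity) _
          (fun s => ((hum k l).sub (hwm k l)).comp measurable_prodMk_left) (fun s _ y => ?_) x
        rw [← mul_decayWeight_sq]
        exact (abs_mul_coord_sub_le (hub s y) (hwb s y) (huw s y) k l).trans_eq (by ring)
      rw [sub_sub_sub_cancel_left, ← WithLp.toLp_sub]
      refine (norm_toLp_le (c := n * (n * (D * (2 * (2 * c) * δ) * decayWeight m b t x)))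
        fun j => ?_).trans ?_
      · simp only [Pi.sub_apply, ← Finset.sum_sub_distrib]
        exact abs_sum_sum_le (hd j)
      · have h1 : 8 * (n : ℝ) ^ 3 * D * c * (δ / 2 * decayWeight m b t x) ≤
          1 * (δ / 2 * decayWeight m b t x) := mul_le_mul_of_nonneg_right hsmall (by positivity)
        calc _ = 8 * (n : ℝ) ^ 3 * D * c * (δ / 2 * decayWeight m b t x) := by ring
          _ ≤ _ := by linarith
    · rw [sub_self, norm_zero]; positivity
  obtain ⟨u, hum, hub, hu⟩ := exists_fixedPoint_of_weighted_contraction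
    (W := fun p : ℝ × E n => decayWeight m b p.1 p.2) (fun p => decayWeight_nonneg hb _ _)
    (r := 2 * c) (by positivity)
    (fun u p => mildMap N χ I v (fun t x => u (t, x)) p.1 p.2)
    (fun u hu hub => ⟨measurable_mildMap hf hc hD.measurableSet hv hu,
      fun p => hball (fun t x => u (t, x)) hu (fun t x => hub (t, x)) p.1 p.2⟩)
    (fun u w hu hw hub hwb δ hδ huw p => hcon (fun t x => u (t, x)) (fun t x => w (t, x)) hu hw
      (fun t x => hub (t, x)) (fun t x => hwb (t, x)) δ hδ (fun t x => huw (t, x)) p.1 p.2)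
  exact ⟨fun t x => u (t, x), hum, fun t x => hub (t, x),
    funext fun t => funext fun x => congrFun hu (t, x)⟩

/-- The matrices `∫ z^α (u ⊗ u)(z, t) dz`. -/
noncomputable def momentMatrix (u : ℝ → E n → E n) (α : Fin n → ℕ) (t : ℝ) :
    Matrix (Fin n) (Fin n) ℝ :=
  Matrix.of fun k l => ∫ z, monomialAt α z * tensorEntry u k l t z

theorem tensorEntry_sub_controlForce (u : ℝ → E n → E n) (k l : Fin n) (s : ℝ) (y : E n) :
    u s y k * u s y l - controlForce N χ (momentMatrix u) s y k l =
      momentCorrection N χ (tensorEntry u k l s) y := by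
  rw [momentCorrection, controlForce, Matrix.sum_apply]
  rfl

/-- A decaying solution of the fixed point equation is a mild solution. -/
theorem isMildSolution_of_mildMap_eq (hn : 1 ≤ n) (hN : N ≤ m + 1) (hf : ContDiff ℝ ∞ χ)
    (hc : HasCompactSupport χ) (hχ : ∀ γ : Fin n → ℕ, ∑ i, γ i < m + 1 →
      ∫ y, monomialAt γ y * χ y = if γ = 0 then 1 else 0)
    (hI : I ⊆ Ici 0) (hb : ∀ t, 1 ≤ b t) (hv : Measurable v) (hc0 : 0 ≤ c)
    (h0 : ∀ x, ‖v x‖ ≤ c) (hdiv : IsWeaklyDivFree v)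
    {u : ℝ → E n → E n} (hum : Measurable (Function.uncurry u))
    (hub : ∀ t x, ‖u t x‖ ≤ c * decayWeight m b t x) (hu : mildMap N χ I v u = u) :
    IsMildSolution I v (controlForce N χ (momentMatrix u)) u := by
  have heq : ∀ t ∈ I, 0 < t → ∀ x, u t x = heatConv t v x -
      WithLp.toLp 2 fun j => ∑ k, ∑ l, duhamel N χ j k l (tensorEntry u k l) t x := by
    intro t ht ht0 x
    conv_lhs => rw [← hu]
    rw [mildMap, if_neg ht0.ne', if_pos ht]
  have hu0 : u 0 = v := by
    rw [← hu]
    funext x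
    rw [mildMap, if_pos rfl]
  have hub' : ∀ t x, ‖u t x‖ ≤ c := fun t x => (hub t x).trans
    (mul_le_of_le_one_right hc0 (decayWeight_le_one hb t x))
  have htm := measurable_tensorEntry hum
  have htm' : ∀ k l s, Measurable (tensorEntry u k l s) := fun k l s =>
    (htm k l).comp measurable_prodMk_left
  have htb : ∀ k l s y, |tensorEntry u k l s y| ≤ c ^ 2 / (1 + ‖y‖) ^ (2 * (n + 1 + m)) :=
    fun k l s y => (abs_tensorEntry_le hc0 hb hub k l s y).trans
      (div_add_norm_pow_le hb (sq_nonneg c) s y _)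
  obtain ⟨B, hB⟩ := exists_momentCorrection_bound (N := N) hn hN hf hc hχ (sq_nonneg c)
  have htb' : ∀ k l s y, |tensorEntry u k l s y| ≤ c ^ 2 := fun k l s y =>
    (htb k l s y).trans (div_le_self (sq_nonneg c) (one_le_pow₀ (by linarith [norm_nonneg y])))
  have hset : ∀ t : ℝ, (volume.prod volume).restrict (Ioo 0 t ×ˢ univ) =
      (volume.restrict (Ioo 0 t)).prod (volume : Measure (E n)) := fun t => by
    rw [← Measure.prod_restrict, Measure.restrict_univ]
  have hnl : ∀ t, 0 < t → ∀ x j k l, IntegrableOn (fun p : ℝ × E n =>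
      oseenKernel (t - p.1) j k l (x - p.2) * tensorEntry u k l p.1 p.2)
      (Ioo 0 t ×ˢ univ) (volume.prod volume) := fun t ht x j k l => by
    obtain ⟨_, h⟩ := exists_integrable_oseenKernel_mul ht j k l (htm k l)
      (fun s _ y => htb' k l s y)
    rw [IntegrableOn, hset]
    exact (h x).2.1
  have hR : ∀ t, 0 < t → ∀ x j k l,
      (∀ s ∈ Ioo 0 t, Integrable fun y =>
        oseenKernel (t - s) j k l (x - y) * momentCorrection N χ (tensorEntry u k l s) y) ∧
      Integrable (fun p : ℝ × E n => oseenKernel (t - p.1) j k l (x - p.2) *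
        momentCorrection N χ (tensorEntry u k l p.1) p.2)
        ((volume.restrict (Ioo 0 t)).prod volume) := fun t ht x j k l => by
    obtain ⟨_, h⟩ := exists_integrable_oseenKernel_mul ht j k l
      (measurable_momentCorrection (N := N) hf hc (htm k l))
      (fun s _ y => hB _ (htm' k l s) (htb k l s) y)
    exact ⟨(h x).1, (h x).2.1⟩
  refine ⟨hum, by rw [hu0], fun t ht => ?_, fun t ht ht0 x => integrable_heatKernel_smul ht0 hv h0 x,
    fun t ht ht0 x j k l => hnl t ht0 x j k l, fun t ht ht0 x j k l => ?_, fun t ht ht0 x j => ?_⟩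
  · rcases (show 0 ≤ t from hI ht).eq_or_lt with h | ht0
    · rw [← h, hu0]; exact hdiv
    have hut : Measurable (u t) := hum.comp measurable_prodMk_left
    refine ⟨locallyIntegrable_of_bounded hut (hub' t), fun φ hφ hφc => ?_⟩
    have hd : ∀ j, Continuous (partialDeriv j φ) := fun j => (contDiff_partialDeriv j hφ).continuous
    have hdi : ∀ j, Integrable (partialDeriv j φ) := fun j =>
      (hd j).integrable_of_hasCompactSupport (hasCompactSupport_partialDeriv j hφc)
    have hdu : ∀ j k l, Integrable fun x =>
        partialDeriv j φ x * duhamel N χ j k l (tensorEntry u k l) t x := by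
      intro j k l
      obtain ⟨C, hC⟩ := exists_integrable_oseenKernel_mul ht0 j k l
        (measurable_momentCorrection (N := N) hf hc (htm k l))
        (fun s _ y => hB _ (htm' k l s) (htb k l s) y)
      refine ((hdi j).norm.mul_const C).mono' ((hd j).measurable.mul
        ((measurable_duhamel hf hc j k l (htm k l)).comp
          measurable_prodMk_left)).aestronglyMeasurable (Eventually.of_forall fun x => ?_)
      rw [norm_mul]
      refine mul_le_mul_of_nonneg_left ?_ (norm_nonneg _)
      rw [duhamel, ← integral_prod _ (hC x).2.1]
      exact (norm_integral_le_integral_norm _).trans (hC x).2.2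
    have hφ' : Continuous (fderiv ℝ φ) := hφ.continuous_fderiv (by simp)
    have hφu : Integrable fun x => fderiv ℝ φ x (u t x) := by
      refine ((hφ'.norm.integrable_of_hasCompactSupport
        (hφc.fderiv (𝕜 := ℝ)).norm).mul_const c).mono'
        (isBoundedBilinearMap_apply.continuous.measurable.comp
          (hφ'.measurable.prodMk hut)).aestronglyMeasurable (Eventually.of_forall fun x => ?_)
      exact (ContinuousLinearMap.le_opNorm _ _).trans
        (mul_le_mul_of_nonneg_left (hub' t x) (norm_nonneg _))
    have hpt : ∀ x, fderiv ℝ φ x (heatConv t v x) = fderiv ℝ φ x (u t x) +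
        ∑ k, ∑ l, ∑ j, partialDeriv j φ x * duhamel N χ j k l (tensorEntry u k l) t x := by
      intro x
      have hS : fderiv ℝ φ x (WithLp.toLp 2 fun j => ∑ k, ∑ l,
          duhamel N χ j k l (tensorEntry u k l) t x) =
          ∑ k, ∑ l, ∑ j, partialDeriv j φ x * duhamel N χ j k l (tensorEntry u k l) t x := by
        rw [fderiv_apply_eq_sum]
        simp only [smul_eq_mul, Finset.sum_mul]
        rw [Finset.sum_comm]
        refine Finset.sum_congr rfl fun k _ => ?_
        rw [Finset.sum_comm]
        exact Finset.sum_congr rfl fun l _ => Finset.sum_congr rfl fun j _ => mul_comm _ _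
      rw [heq t ht ht0 x, map_sub, hS, sub_add_cancel]
    have h1 := integral_fderiv_heatConv ht0 hv h0 hdiv hφ hφc
    simp only [hpt] at h1
    rw [integral_add hφu (integrable_finsetSum _ fun k _ => integrable_finsetSum _ fun l _ =>
        integrable_finsetSum _ fun j _ => hdu j k l),
      integral_finsetSum _ fun k _ => integrable_finsetSum _ fun l _ =>
        integrable_finsetSum _ fun j _ => hdu j k l] at h1
    rw [Finset.sum_eq_zero fun k _ => ?_, add_zero] at h1
    · exact h1
    rw [integral_finsetSum _ fun l _ => integrable_finsetSum _ fun j _ => hdu j k l]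
    refine Finset.sum_eq_zero fun l _ => ?_
    rw [integral_finsetSum _ fun j _ => hdu j k l]
    exact sum_integral_partialDeriv_mul_duhamel hn hN hf hc hχ (sq_nonneg c) (htm k l) ht0
      (fun s _ y => htb k l s y) k l hφ hφc
  · have h := (hR t ht0 x j k l).2
    rw [← hset] at h
    refine ((hnl t ht0 x j k l).sub h).congr (Eventually.of_forall fun p => ?_)
    simp only [Pi.sub_apply]
    rw [← tensorEntry_sub_controlForce, ← mul_sub, tensorEntry, sub_sub_cancel]
  · simp only [tensorEntry_sub_controlForce]
    rw [heq t ht ht0 x, PiLp.sub_apply, heatConv]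
    congr 1
    have hin : ∀ s ∈ Ioo 0 t, ∫ y, ∑ k, ∑ l, oseenKernel (t - s) j k l (x - y) *
        momentCorrection N χ (tensorEntry u k l s) y = ∑ k, ∑ l, ∫ y,
        oseenKernel (t - s) j k l (x - y) * momentCorrection N χ (tensorEntry u k l s) y := by
      intro s hs
      have hi := fun k l => (hR t ht0 x j k l).1 s hs
      rw [integral_finsetSum _ fun k _ => integrable_finsetSum _ fun l _ => hi k l]
      exact Finset.sum_congr rfl fun k _ => integral_finsetSum _ fun l _ => hi k l
    rw [setIntegral_congr_fun measurableSet_Ioo hin]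
    change ∑ k, ∑ l, duhamel N χ j k l (tensorEntry u k l) t x = _
    have ho := fun k l => (hR t ht0 x j k l).2.integral_prod_left
    rw [integral_finsetSum _ fun k _ => integrable_finsetSum _ fun l _ => ho k l]
    exact Finset.sum_congr rfl fun k _ => (integral_finsetSum _ fun l _ => ho k l).symm

theorem IsMildSolution.congr_initial {u₀ : E n → E n} {f : ℝ → E n → Matrix (Fin n) (Fin n) ℝ}
    {u : ℝ → E n → E n} (h : IsMildSolution I v f u) (hv : v =ᵐ[volume] u₀) :
    IsMildSolution I u₀ f u := by
  have hs : ∀ t (x : E n), (fun y => heatKernel t (x - y) • v y) =ᵐ[volume]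
      fun y => heatKernel t (x - y) • u₀ y := fun t x => hv.mono fun y hy => by
    simp only [hy]
  refine ⟨h.measurable, h.initial.trans hv, h.divFree,
    fun t ht ht0 x => (h.integrable_heat t ht ht0 x).congr (hs t x), h.integrable_nonlinear,
    h.integrable_force, fun t ht ht0 x j => ?_⟩
  rw [h.equation t ht ht0 x j, integral_congr_ae (hs t x)]

theorem IsMildSolution.mono {J : Set ℝ} {f : ℝ → E n → Matrix (Fin n) (Fin n) ℝ}
    {u : ℝ → E n → E n} (h : IsMildSolution I v f u) (hJ : J ⊆ I) : IsMildSolution J v f u :=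
  ⟨h.measurable, h.initial, fun t ht => h.divFree t (hJ ht),
    fun t ht => h.integrable_heat t (hJ ht), fun t ht => h.integrable_nonlinear t (hJ ht),
    fun t ht => h.integrable_force t (hJ ht), fun t ht => h.equation t (hJ ht)⟩

end

/-! ### Decay of the heat flow -/

theorem heatConv_apply {n : ℕ} {t : ℝ} (ht : 0 < t) {v : E n → E n} (hv : Measurable v) {B : ℝ}
    (hB : ∀ x, ‖v x‖ ≤ B) (x : E n) (j : Fin n) :
    heatConv t v x j = ∫ y, heatKernel t (x - y) * v y j :=
  ((EuclideanSpace.proj (𝕜 := ℝ) j).integral_comp_comm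
    (integrable_heatKernel_smul ht hv hB x)).symm

theorem norm_heatConv_le {n : ℕ} {t : ℝ} (ht : 0 < t) {v : E n → E n} (hv : Measurable v) {B : ℝ}
    (hB : ∀ x, ‖v x‖ ≤ B) {x : E n} {c : ℝ}
    (h : ∀ j, |∫ y, heatKernel t (x - y) * v y j| ≤ c) : ‖heatConv t v x‖ ≤ n * c := by
  refine (norm_le_sum_abs _).trans ((Finset.sum_le_sum fun j _ => ?_).trans_eq
    (Finset.sum_const c) |>.trans_eq ?_)
  · rw [heatConv_apply ht hv hB]; exact h j
  · simp

/-- The heat flow preserves the decay `|x|^{-e}`, `e > n`, with a constant growing in time. -/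
theorem exists_norm_heatConv_le (n k : ℕ) : ∃ C, 0 ≤ C ∧ ∀ t : ℝ, 0 < t → ∀ v : E n → E n,
    Measurable v → ∀ B : ℝ, (∀ x, ‖v x‖ ≤ B) → ∀ c : ℝ, 0 ≤ c →
    (∀ᵐ x, ‖v x‖ ≤ c * ((1 + ‖x‖) ^ (n + 1 + k))⁻¹) → ∀ x,
    ‖heatConv t v x‖ ≤ C * c * (1 + √t ^ (1 + k)) * ((1 + ‖x‖) ^ (n + 1 + k))⁻¹ := by
  obtain ⟨C, hC, h⟩ := exists_heat_convolution_le n 0 (n + 1 + k)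
  have hJi := integrable_inv_one_add_norm_pow (n := n) (e := n + 1 + k) (by omega)
  set J := ∫ y : E n, ((1 + ‖y‖) ^ (n + 1 + k))⁻¹ with hJ
  have hJ0 : 0 ≤ J := integral_nonneg fun y => by positivity
  refine ⟨n * (C * (1 + J)), by positivity, fun t ht v hv B hB c hc hvc x => ?_⟩
  have h0 : 0 < √t := Real.sqrt_pos.2 ht
  refine (norm_heatConv_le ht hv hB (c := C * (1 + J) * c * (1 + √t ^ (1 + k)) *
    ((1 + ‖x‖) ^ (n + 1 + k))⁻¹) fun j => ?_).trans_eq (by ring)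
  have hvm := measurable_coord hv j
  have hle : ∀ᵐ y, |v y j| ≤ c * ((1 + ‖y‖) ^ (n + 1 + k))⁻¹ :=
    hvc.mono fun y hy => (abs_coord_le _ _).trans hy
  have hvi : Integrable fun y => v y j :=
    (hJi.const_mul c).mono' hvm.aestronglyMeasurable hle
  have hvan : VanishingMoments 0 fun y => v y j :=
    ⟨hvi, by simpa using hvi, fun α hα => absurd hα (by omega)⟩
  have hI : ∫ y, ‖y‖ ^ 0 * |v y j| ≤ c * J := by
    simp only [pow_zero, one_mul]
    rw [hJ, ← integral_const_mul]
    exact integral_mono_ae hvi.abs (hJi.const_mul c) hle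
  refine (h t ht c hc _ hvan (hle.mono fun y hy => hy.trans_eq (div_eq_mul_inv _ _).symm) x).trans ?_
  have hp : √t ^ (n + 1 + k) / √t ^ (n + 0) = √t ^ (1 + k) := by
    rw [add_zero, add_assoc, pow_add, mul_div_cancel_left₀ _ (by positivity)]
  rw [hp, div_eq_mul_inv]
  have hp0 : 0 ≤ √t ^ (1 + k) := by positivity
  refine mul_le_mul ?_ ?_ (by positivity) (by positivity)
  · rw [mul_assoc, mul_assoc]
    refine mul_le_mul_of_nonneg_left ?_ hC
    calc √t ^ (1 + k) * (∫ y, ‖y‖ ^ 0 * |v y j|) + c ≤ √t ^ (1 + k) * (c * J) + c := by gcongr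
      _ ≤ √t ^ (1 + k) * (c * J) + c + (c * J + c * √t ^ (1 + k)) :=
          le_add_of_nonneg_right (by positivity)
      _ = _ := by ring
  · gcongr
    linarith

/-- The heat flow of a field with vanishing moments up to order `m` decays in space-time like the
heat kernel's derivatives of order `m + 1`. -/
theorem exists_norm_heatConv_le_of_moments (n m : ℕ) : ∃ C, 0 ≤ C ∧ ∀ t : ℝ, 0 < t →
    ∀ v : E n → E n, Measurable v → ∀ c : ℝ, 0 ≤ c →
    (∀ x, ‖v x‖ ≤ c * ((1 + ‖x‖) ^ (n + 1 + m))⁻¹) →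
    Integrable (fun x => ‖x‖ ^ (m + 1) * ‖v x‖) → ∫ x, ‖x‖ ^ (m + 1) * ‖v x‖ ≤ c →
    (∀ α : Fin n → ℕ, ∑ i, α i ≤ m → ∀ j, ∫ x, monomialAt α x * v x j = 0) → ∀ x,
    ‖heatConv t v x‖ ≤ C * c * (((1 + √t) + ‖x‖) ^ (n + 1 + m))⁻¹ := by
  obtain ⟨C, hC, h⟩ := exists_heat_convolution_le n (m + 1) (n + 1 + m)
  refine ⟨n * (C * 2), by positivity, fun t ht v hv c hc hvc hi hI hmom x => ?_⟩
  have h0 : 0 < √t := Real.sqrt_pos.2 ht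
  have hB : ∀ x, ‖v x‖ ≤ c := fun x => (hvc x).trans (mul_le_of_le_one_right hc
    (inv_le_one_of_one_le₀ (one_le_pow₀ (by linarith [norm_nonneg x]))))
  refine (norm_heatConv_le ht hv hB (c := C * 2 * c * (((1 + √t) + ‖x‖) ^ (n + 1 + m))⁻¹)
    fun j => ?_).trans_eq (by ring)
  have hvm := measurable_coord hv j
  have hle : ∀ y, |v y j| ≤ c * ((1 + ‖y‖) ^ (n + 1 + m))⁻¹ :=
    fun y => (abs_coord_le _ _).trans (hvc y)
  have hJi := integrable_inv_one_add_norm_pow (n := n) (e := n + 1 + m) (by omega)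
  have hle' : ∀ y, ‖‖y‖ ^ (m + 1) * v y j‖ ≤ ‖y‖ ^ (m + 1) * ‖v y‖ := fun y => by
    rw [norm_mul, norm_pow, norm_norm]
    gcongr
    exact abs_coord_le _ _
  have hip : Integrable fun y => ‖y‖ ^ (m + 1) * v y j :=
    hi.mono' (by fun_prop) (Eventually.of_forall hle')
  have hvan : VanishingMoments (m + 1) fun y => v y j :=
    ⟨(hJi.const_mul c).mono' hvm.aestronglyMeasurable (Eventually.of_forall hle), hip,
      fun α hα => hmom α (by omega) j⟩
  refine (h t ht c hc _ hvan (Eventually.of_forall fun y =>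
    (hle y).trans_eq (div_eq_mul_inv _ _).symm) x).trans ?_
  have hI' : ∫ y, ‖y‖ ^ (m + 1) * |v y j| ≤ c := by
    refine (integral_mono ?_ hi fun y => ?_).trans hI
    · exact hip.norm.congr (Eventually.of_forall fun y => by simp)
    · exact mul_le_mul_of_nonneg_left (abs_coord_le _ _) (by positivity)
  rw [show n + (m + 1) = n + 1 + m by ring, div_self (by positivity), one_mul, div_eq_mul_inv,
    ← add_assoc]
  refine mul_le_mul_of_nonneg_right ?_ (by positivity)
  rw [mul_assoc]
  exact mul_le_mul_of_nonneg_left (by linarith) hC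

/-- The heat flow preserves the decay `o(|x|^{-(n+1+m)})`, uniformly on bounded time intervals:
the part of the field far away is small, and the part near the origin gains a power of decay. -/
theorem eventually_norm_heatConv_le {n m : ℕ} {v : E n → E n} (hv : Measurable v) {M : ℝ}
    (hM : 0 ≤ M) (hvM : ∀ x, ‖v x‖ ≤ M * ((1 + ‖x‖) ^ (n + 1 + m))⁻¹)
    (ho : ∀ ε : ℝ, 0 < ε → ∃ R : ℝ, ∀ᵐ x, R ≤ ‖x‖ → ‖v x‖ ≤ ε * (‖x‖ ^ (n + 1 + m))⁻¹)
    (T : ℝ) {ε : ℝ} (hε : 0 < ε) :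
    ∀ᶠ x in Bornology.cobounded (E n), ∀ t ∈ Ioc 0 T,
      ‖heatConv t v x‖ ≤ ε * (‖x‖ ^ (n + 1 + m))⁻¹ := by
  obtain ⟨C₁, hC₁, h₁⟩ := exists_norm_heatConv_le n m
  obtain ⟨C₂, hC₂, h₂⟩ := exists_norm_heatConv_le n (m + 1)
  set G := (C₁ + 1) * (1 + √T ^ (1 + m)) with hG
  have hG0 : 0 < G := by positivity
  obtain ⟨R₀, hR₀⟩ := ho (ε / (2 * G * 2 ^ (n + 1 + m))) (by positivity)
  set R := max R₀ 1 with hR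
  have hR1 : 1 ≤ R := le_max_right _ _
  set S : Set (E n) := {x | ‖x‖ < R} with hS
  have hSm : MeasurableSet S := measurableSet_lt measurable_norm measurable_const
  have hB : ∀ x, ‖v x‖ ≤ M := fun x => (hvM x).trans (mul_le_of_le_one_right hM
    (inv_le_one_of_one_le₀ (one_le_pow₀ (by linarith [norm_nonneg x]))))
  have hB₁ : ∀ x, ‖S.indicator v x‖ ≤ M := fun x =>
    (norm_indicator_le_norm_self v x).trans (hB x)
  have hB₂ : ∀ x, ‖Sᶜ.indicator v x‖ ≤ M := fun x =>
    (norm_indicator_le_norm_self v x).trans (hB x)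
  have hnear : ∀ x, ‖S.indicator v x‖ ≤ M * (1 + R) * ((1 + ‖x‖) ^ (n + 1 + (m + 1)))⁻¹ := by
    intro x
    by_cases hx : x ∈ S
    · rw [indicator_of_mem hx]
      refine (hvM x).trans ?_
      rw [mul_assoc]
      refine mul_le_mul_of_nonneg_left ?_ hM
      rw [← add_assoc, pow_succ _ (n + 1 + m), mul_inv, mul_left_comm]
      refine le_mul_of_one_le_right (by positivity) ?_
      rw [← div_eq_mul_inv, one_le_div (by positivity)]
      have : ‖x‖ < R := hx
      linarith
    · rw [indicator_of_notMem hx, norm_zero]; positivity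
  have hfar : ∀ᵐ x, ‖Sᶜ.indicator v x‖ ≤ ε / (2 * G) * ((1 + ‖x‖) ^ (n + 1 + m))⁻¹ := by
    filter_upwards [hR₀] with x hx
    by_cases hxS : x ∈ S
    · rw [indicator_of_notMem (by simpa using hxS), norm_zero]; positivity
    · rw [indicator_of_mem hxS]
      have hxR : R ≤ ‖x‖ := not_lt.1 hxS
      have hx1 : 1 ≤ ‖x‖ := hR1.trans hxR
      refine (hx ((le_max_left _ _).trans hxR)).trans ?_
      have e : ε / (2 * G) * ((1 + ‖x‖) ^ (n + 1 + m))⁻¹ =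
          ε / (2 * G * 2 ^ (n + 1 + m)) * (((1 + ‖x‖) / 2) ^ (n + 1 + m))⁻¹ := by
        rw [div_pow]; field_simp
      rw [e]
      have hx0 : 0 < ‖x‖ := by linarith
      gcongr
      linarith
  have hsum : ∀ t, 0 < t → ∀ x, heatConv t v x =
      heatConv t (S.indicator v) x + heatConv t (Sᶜ.indicator v) x := by
    intro t ht x
    rw [heatConv, heatConv, heatConv, ← integral_add
      (integrable_heatKernel_smul ht (hv.indicator hSm) hB₁ x)
      (integrable_heatKernel_smul ht (hv.indicator hSm.compl) hB₂ x)]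
    refine integral_congr_ae (Eventually.of_forall fun y => ?_)
    simp only
    rw [← smul_add, indicator_self_add_compl_apply]
  set H := C₂ * (M * (1 + R)) * (1 + √T ^ (1 + (m + 1))) with hH
  have hlarge : ∀ᶠ x in Bornology.cobounded (E n), 2 * H / ε ≤ ‖x‖ ∧ 1 ≤ ‖x‖ :=
    (tendsto_norm_cobounded_atTop.eventually_ge_atTop _).and
      (tendsto_norm_cobounded_atTop.eventually_ge_atTop _)
  filter_upwards [hlarge] with x hx t ht
  have hx0 : 0 < ‖x‖ := by linarith [hx.2]
  have htT : √t ≤ √T := Real.sqrt_le_sqrt ht.2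
  have hH0 : 0 ≤ H := by positivity
  have b1 : ‖heatConv t (S.indicator v) x‖ ≤ ε / 2 * (‖x‖ ^ (n + 1 + m))⁻¹ := by
    refine (h₂ t ht.1 _ (hv.indicator hSm) M hB₁ (M * (1 + R)) (by positivity)
      (Eventually.of_forall hnear) x).trans ?_
    calc _ ≤ H * ((‖x‖) ^ (n + 1 + (m + 1)))⁻¹ := by rw [hH]; gcongr; linarith
      _ = H / ‖x‖ * (‖x‖ ^ (n + 1 + m))⁻¹ := by
          rw [← add_assoc, pow_succ _ (n + 1 + m)]; field_simp
      _ ≤ _ := by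
          refine mul_le_mul_of_nonneg_right ?_ (by positivity)
          have := hx.1
          rw [div_le_iff₀ hε] at this
          rw [div_le_iff₀ hx0]
          linarith
  have b2 : ‖heatConv t (Sᶜ.indicator v) x‖ ≤ ε / 2 * (‖x‖ ^ (n + 1 + m))⁻¹ := by
    refine (h₁ t ht.1 _ (hv.indicator hSm.compl) M hB₂ (ε / (2 * G)) (by positivity)
      hfar x).trans ?_
    calc _ ≤ (C₁ + 1) * (ε / (2 * G)) * (1 + √T ^ (1 + m)) * (‖x‖ ^ (n + 1 + m))⁻¹ := by
          gcongr <;> linarith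
      _ = G * (ε / (2 * G)) * (‖x‖ ^ (n + 1 + m))⁻¹ := by rw [hG]; ring
      _ = _ := by field_simp
  rw [hsum t ht.1]
  refine (norm_add_le _ _).trans ((add_le_add b1 b2).trans_eq (by ring))

/-! ### Existence of solutions -/

section

variable {n m N : ℕ} {χ : E n → ℝ}

theorem norm_mildMap_sub_heatConv_le {I : Set ℝ} {v : E n → E n} {u : ℝ → E n → E n}
    (hu : mildMap N χ I v u = u) {t : ℝ} (ht : t ∈ I) (ht0 : 0 < t) {x : E n} {c : ℝ}
    (h : ∀ j k l, |duhamel N χ j k l (tensorEntry u k l) t x| ≤ c) :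
    ‖u t x - heatConv t v x‖ ≤ n * (n * (n * c)) := by
  have e : u t x = heatConv t v x -
      WithLp.toLp 2 fun j => ∑ k, ∑ l, duhamel N χ j k l (tensorEntry u k l) t x := by
    conv_lhs => rw [← hu]
    rw [mildMap, if_neg ht0.ne', if_pos ht]
  rw [e, sub_sub_cancel_left, norm_neg]
  exact norm_toLp_le fun j => abs_sum_sum_le (h j)

/-- For `r = √T`, the product of the growth factors of the Duhamel term and of the heat flow. -/
theorem add_sq_mul_one_add_pow_le {r : ℝ} (hr : 0 ≤ r) (m : ℕ) :
    (r ^ 2 + r) * (1 + r ^ (1 + m)) ≤ 3 * (r + r ^ (m + 3)) := by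
  have h2 : r ^ 2 ≤ r + r ^ (m + 3) := by
    rcases le_total r 1 with h | h
    · have : r ^ 2 ≤ r := by nlinarith
      have : 0 ≤ r ^ (m + 3) := by positivity
      linarith
    · have : r ^ 2 ≤ r ^ (m + 3) := pow_le_pow_right₀ h (by omega)
      linarith
  have h3 : r ^ (m + 2) ≤ r + r ^ (m + 3) := by
    rcases le_total r 1 with h | h
    · have : r ^ (m + 2) ≤ r := pow_le_of_le_one hr h (by omega)
      have : 0 ≤ r ^ (m + 3) := by positivity
      linarith
    · have : r ^ (m + 2) ≤ r ^ (m + 3) := pow_le_pow_right₀ h (by omega)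
      linarith
  have e : (r ^ 2 + r) * (1 + r ^ (1 + m)) = r ^ 2 + r + r ^ (m + 3) + r ^ (m + 2) := by ring
  rw [e]
  linarith

/-- Local existence, with a Duhamel term decaying faster when one more order of moments is
controlled. -/
theorem exists_local_solution (hn : 1 ≤ n) (hmN : m ≤ N) (hN : N ≤ m + 1) (hf : ContDiff ℝ ∞ χ)
    (hc : HasCompactSupport χ) (hχ : ∀ γ : Fin n → ℕ, ∑ i, γ i < m + 1 →
      ∫ y, monomialAt γ y * χ y = if γ = 0 then 1 else 0) :
    ∃ κ : ℝ, 0 < κ ∧ ∀ T : ℝ, 0 < T → ∀ M : ℝ, 0 ≤ M → (√T + √T ^ (m + 3)) * M ≤ κ →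
    ∀ v : E n → E n, Measurable v → IsWeaklyDivFree v →
    (∀ x, ‖v x‖ ≤ M * ((1 + ‖x‖) ^ (n + 1 + m))⁻¹) →
    ∃ u, IsMildSolution (Icc 0 T) v (controlForce N χ (momentMatrix u)) u ∧
      ∃ C : ℝ, 0 ≤ C ∧ (∀ t x, ‖u t x‖ ≤ C * ((1 + ‖x‖) ^ (n + 1 + m))⁻¹) ∧
        ∀ t ∈ Ioc 0 T, ∀ x, ‖u t x - heatConv t v x‖ ≤ C * ((1 + ‖x‖) ^ (n + 1 + N))⁻¹ := by
  obtain ⟨C₁, hC₁, h₁⟩ := exists_duhamel_local_le (N := N) hn hN hf hc hχ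
  obtain ⟨C₂, hC₂, h₂⟩ := exists_norm_heatConv_le n m
  set G := 8 * (n : ℝ) ^ 3 * C₁ * (1 + C₂) * 3 with hG
  have hG0 : 0 ≤ G := by positivity
  refine ⟨1 / (G + 1), by positivity, fun T hT M hM hTM v hv hdiv hvM => ?_⟩
  have hvB : ∀ x, ‖v x‖ ≤ M := fun x => (hvM x).trans (mul_le_of_le_one_right hM
    (inv_le_one_of_one_le₀ (one_le_pow₀ (by linarith [norm_nonneg x]))))
  have hsq : √T ^ 2 = T := Real.sq_sqrt hT.le
  have hp0 : 0 ≤ √T ^ (1 + m) := by positivity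
  set c := (1 + C₂) * M * (1 + √T ^ (1 + m)) with hcdef
  have hc0 : 0 ≤ c := by positivity
  have hmono : ∀ t ∈ Icc 0 T, t + √t ≤ T + √T := fun t ht => by
    have := Real.sqrt_le_sqrt ht.2
    linarith [ht.2]
  have hD : IsDuhamelScale m N χ (Icc 0 T) (fun _ => 1) (C₁ * (T + √T)) :=
    { measurableSet := measurableSet_Icc
      nonneg := Icc_subset_Ici_self
      Ioo_subset := fun t ht s hs => ⟨hs.1.le, hs.2.le.trans ht.2⟩
      one_le := fun _ => le_rfl
      zero_eq := rfl
      const_nonneg := by positivity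
      duhamel_le := fun t ht ht0 j k l a ha q hqm hq x => by
        refine (h₁ t ht0 j k l a ha q hqm hq x).trans ?_
        have h := hmono t ht
        have hx : (1 : ℝ) ≤ 1 + ‖x‖ := by linarith [norm_nonneg x]
        rw [decayWeight, div_eq_mul_inv]
        calc _ ≤ C₁ * a * (T + √T) * ((1 + ‖x‖) ^ (n + 1 + m))⁻¹ := by
              gcongr ?_ * ?_
              · exact mul_le_mul_of_nonneg_left h (by positivity)
              · exact inv_anti₀ (by positivity) (pow_le_pow_right₀ hx (by omega))
          _ = _ := by ring }
  have hsmall : 8 * (n : ℝ) ^ 3 * (C₁ * (T + √T)) * c ≤ 1 := by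
    have h3 := add_sq_mul_one_add_pow_le (Real.sqrt_nonneg T) m
    rw [hsq] at h3
    calc _ = 8 * (n : ℝ) ^ 3 * C₁ * (1 + C₂) * M * ((T + √T) * (1 + √T ^ (1 + m))) := by
          rw [hcdef]; ring
      _ ≤ 8 * (n : ℝ) ^ 3 * C₁ * (1 + C₂) * M * (3 * (√T + √T ^ (m + 3))) := by gcongr
      _ = G * ((√T + √T ^ (m + 3)) * M) := by rw [hG]; ring
      _ ≤ G * (1 / (G + 1)) := by gcongr
      _ ≤ 1 := by rw [mul_one_div, div_le_one (by positivity)]; linarith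
  have hMc : M ≤ c := by
    rw [hcdef, mul_right_comm]
    exact le_mul_of_one_le_left hM (one_le_mul_of_one_le_of_one_le (by linarith) (by linarith))
  have h0 : ∀ x, ‖v x‖ ≤ c * ((1 + ‖x‖) ^ (n + 1 + m))⁻¹ := fun x => (hvM x).trans (by gcongr)
  have hH : ∀ t ∈ Icc 0 T, 0 < t → ∀ x, ‖heatConv t v x‖ ≤
      c * decayWeight m (fun _ => 1) t x := by
    intro t ht ht0 x
    refine (h₂ t ht0 v hv M hvB M hM (Eventually.of_forall hvM) x).trans ?_
    have := Real.sqrt_le_sqrt ht.2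
    rw [decayWeight, hcdef]
    gcongr
    linarith
  obtain ⟨u, hum, hub, hu⟩ := exists_mildMap_eq hn hN hf hc hχ hD hv hc0 h0 hH hsmall
  refine ⟨u, ?_, 2 * c + n * (n * (n * (C₁ * (2 * c) ^ 2 * (T + √T)))), by positivity, ?_, ?_⟩
  · refine isMildSolution_of_mildMap_eq hn hN hf hc hχ hD.nonneg hD.one_le hv
      (c := 2 * c) (by positivity) (fun x => (hvB x).trans (by linarith)) hdiv hum hub hu
  · intro t x
    refine (hub t x).trans ?_
    rw [decayWeight]
    gcongr
    exact le_add_of_nonneg_right (by positivity)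
  · intro t ht x
    have hle := hmono t ⟨ht.1.le, ht.2⟩
    refine (norm_mildMap_sub_heatConv_le hu ⟨ht.1.le, ht.2⟩ ht.1
      (c := C₁ * (2 * c) ^ 2 * (T + √T) * ((1 + ‖x‖) ^ (n + 1 + N))⁻¹) fun j k l => ?_).trans ?_
    · refine (h₁ t ht.1 j k l _ (sq_nonneg (2 * c)) _
        (fun s => (measurable_tensorEntry hum k l).comp measurable_prodMk_left)
        (fun s _ y => abs_tensorEntry_le (by positivity) hD.one_le hub k l s y) x).trans ?_
      rw [div_eq_mul_inv]
      gcongr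
    · have hW : 0 ≤ 2 * c * ((1 + ‖x‖) ^ (n + 1 + N))⁻¹ := by positivity
      rw [add_mul]
      exact (le_add_of_nonneg_left hW).trans_eq' (by ring)

theorem isMildSolution_zero (I : Set ℝ) :
    IsMildSolution I (0 : E n → E n) (controlForce N χ 0) 0 := by
  have hf : ∀ t x, controlForce N χ 0 t x = 0 := fun t x => by simp [controlForce]
  refine ⟨measurable_const, EventuallyEq.rfl, fun t _ => ⟨locallyIntegrable_const (0 : E n), ?_⟩,
    ?_, ?_, ?_, ?_⟩
  · simp
  · simp
  · simp
  · simp [hf]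
  · simp [hf]

/-- A single family of matrices serves all admissible times: it comes from the solution on the
longest admissible interval. -/
theorem exists_local_solution_family (hn : 1 ≤ n) (hmN : m ≤ N) (hN : N ≤ m + 1)
    (hf : ContDiff ℝ ∞ χ) (hc : HasCompactSupport χ)
    (hχ : ∀ γ : Fin n → ℕ, ∑ i, γ i < m + 1 →
      ∫ y, monomialAt γ y * χ y = if γ = 0 then 1 else 0) :
    ∃ κ : ℝ, 0 < κ ∧ ∀ M : ℝ, 0 ≤ M → ∀ v : E n → E n, Measurable v → IsWeaklyDivFree v →
    (∀ x, ‖v x‖ ≤ M * ((1 + ‖x‖) ^ (n + 1 + m))⁻¹) →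
    ∃ A : (Fin n → ℕ) → ℝ → Matrix (Fin n) (Fin n) ℝ,
    ∀ T : ℝ, 0 < T → (√T + √T ^ (m + 3)) * M ≤ κ →
    ∃ u, IsMildSolution (Icc 0 T) v (controlForce N χ A) u ∧
      ∃ C : ℝ, 0 ≤ C ∧ (∀ t x, ‖u t x‖ ≤ C * ((1 + ‖x‖) ^ (n + 1 + m))⁻¹) ∧
        ∀ t ∈ Ioc 0 T, ∀ x, ‖u t x - heatConv t v x‖ ≤ C * ((1 + ‖x‖) ^ (n + 1 + N))⁻¹ := by
  obtain ⟨κ, hκ, h⟩ := exists_local_solution hn hmN hN hf hc hχ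
  refine ⟨κ, hκ, fun M hM v hv hdiv hvM => ?_⟩
  rcases hM.eq_or_lt with hM0 | hM0
  · have hv0 : v = 0 := funext fun x => norm_le_zero_iff.1 ((hvM x).trans_eq (by simp [← hM0]))
    subst hv0
    refine ⟨0, fun T hT _ => ⟨0, isMildSolution_zero _, 0, le_rfl, by simp, ?_⟩⟩
    simp [heatConv]
  · have hcont : ContinuousOn (fun r : ℝ => r + r ^ (m + 3)) (Icc 0 (κ / M)) := by fun_prop
    have hq : 0 < κ / M := by positivity
    obtain ⟨r, hr, hre⟩ := intermediate_value_Icc hq.le hcont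
      (show κ / M ∈ Icc _ _ by
        constructor
        · simpa using hq.le
        · exact le_add_of_nonneg_right (by positivity))
    simp only at hre
    have hr0 : 0 < r := by
      refine lt_of_le_of_ne hr.1 fun hz => ?_
      rw [← hz] at hre
      rw [zero_add, zero_pow (by omega)] at hre
      exact hq.ne hre
    have hrs : √(r ^ 2) = r := Real.sqrt_sq hr.1
    obtain ⟨u, hu, C, hC, hub, hud⟩ := h (r ^ 2) (by positivity) M hM
      (by rw [hrs, hre, div_mul_cancel₀ _ hM0.ne']) v hv hdiv hvM
    refine ⟨momentMatrix u, fun T hT hTM => ?_⟩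
    have hTr : T ≤ r ^ 2 := by
      rw [← Real.sqrt_le_left hr.1]
      by_contra! hlt
      rw [← le_div_iff₀ hM0, ← hre] at hTM
      have : r ^ (m + 3) ≤ √T ^ (m + 3) := pow_le_pow_left₀ hr.1 hlt.le _
      linarith
    exact ⟨u, hu.mono (Icc_subset_Icc_right hTr), C, hC, hub,
      fun t ht => hud t ⟨ht.1, ht.2.trans hTr⟩⟩

/-- Global existence for small data with vanishing moments up to order `m`. -/
theorem exists_global_solution (hn : 2 ≤ n) (hf : ContDiff ℝ ∞ χ)
    (hc : HasCompactSupport χ) (hχ : ∀ γ : Fin n → ℕ, ∑ i, γ i < m + 1 →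
      ∫ y, monomialAt γ y * χ y = if γ = 0 then 1 else 0) :
    ∃ κ : ℝ, 0 < κ ∧ ∀ v : E n → E n, Measurable v → IsWeaklyDivFree v →
    (∀ x, ‖v x‖ ≤ κ * ((1 + ‖x‖) ^ (n + 1 + m))⁻¹) →
    Integrable (fun x => ‖x‖ ^ (m + 1) * ‖v x‖) → ∫ x, ‖x‖ ^ (m + 1) * ‖v x‖ ≤ κ →
    (∀ α : Fin n → ℕ, ∑ i, α i ≤ m → ∀ j, ∫ x, monomialAt α x * v x j = 0) →
    ∃ u, IsMildSolution (Ici 0) v (controlForce m χ (momentMatrix u)) u ∧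
      Measurable (Function.uncurry u) ∧
      ∃ C : ℝ, 0 ≤ C ∧ ∀ t x, ‖u t x‖ ≤ C * decayWeight m (fun t => 1 + √t) t x := by
  obtain ⟨C₁, hC₁, h₁⟩ := exists_duhamel_global_le hn hf hc hχ
  obtain ⟨C₂, hC₂, h₂⟩ := exists_norm_heatConv_le_of_moments n m
  set G := 8 * (n : ℝ) ^ 3 * C₁ * (1 + C₂) with hG
  have hG0 : 0 ≤ G := by positivity
  set κ := 1 / (G + 1) with hκ
  have hκ0 : 0 < κ := by positivity
  refine ⟨κ, hκ0, fun v hv hdiv hvb hvi hvI hmom => ?_⟩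
  have hD : IsDuhamelScale m m χ (Ici 0) (fun t => 1 + √t) C₁ :=
    { measurableSet := measurableSet_Ici
      nonneg := subset_rfl
      Ioo_subset := fun t ht s hs => hs.1.le
      one_le := fun t => le_add_of_nonneg_right (Real.sqrt_nonneg t)
      zero_eq := by simp
      const_nonneg := hC₁
      duhamel_le := fun t _ ht0 j k l a ha q hqm hq x =>
        (h₁ t ht0 j k l a ha q hqm hq x).trans_eq (div_eq_mul_inv _ _) }
  set c := (1 + C₂) * κ with hcdef
  have hκc : κ ≤ c := le_mul_of_one_le_left hκ0.le (by linarith)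
  have hc0 : 0 ≤ c := hκ0.le.trans hκc
  have h0 : ∀ x, ‖v x‖ ≤ c * ((1 + ‖x‖) ^ (n + 1 + m))⁻¹ := fun x => (hvb x).trans (by gcongr)
  have hvB : ∀ x, ‖v x‖ ≤ 2 * c := fun x => (h0 x).trans ((mul_le_of_le_one_right hc0
    (inv_le_one_of_one_le₀ (one_le_pow₀ (by linarith [norm_nonneg x])))).trans (by linarith))
  have hsmall : 8 * (n : ℝ) ^ 3 * C₁ * c ≤ 1 := by
    calc _ = G * (1 / (G + 1)) := by rw [hcdef, hG, hκ]; ring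
      _ ≤ 1 := by rw [mul_one_div, div_le_one (by positivity)]; linarith
  have hH : ∀ t ∈ Ici (0 : ℝ), 0 < t → ∀ x, ‖heatConv t v x‖ ≤
      c * decayWeight m (fun t => 1 + √t) t x := by
    intro t _ ht0 x
    refine (h₂ t ht0 v hv κ hκ0.le hvb hvi hvI hmom x).trans ?_
    rw [decayWeight, hcdef]
    gcongr
    linarith
  obtain ⟨u, hum, hub, hu⟩ := exists_mildMap_eq (by omega) (by omega) hf hc hχ hD hv hc0 h0 hH
    hsmall
  exact ⟨u, isMildSolution_of_mildMap_eq (by omega) (by omega) hf hc hχ hD.nonneg hD.one_le hv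
      (c := 2 * c) (by positivity) hvB hdiv hum hub hu, hum, 2 * c, by positivity, hub⟩

/-- Decay in time of the force, whose coefficients are moments of order at most `m - 1` of a
function of size `(1 + √t + |x|)^{-2(n+1+m)}`. -/
theorem exists_abs_controlForce_le (hf : ContDiff ℝ ∞ χ) (hc : HasCompactSupport χ)
    {u : ℝ → E n → E n} (hum : Measurable (Function.uncurry u)) {C : ℝ} (hC : 0 ≤ C)
    (hu : ∀ t x, ‖u t x‖ ≤ C * decayWeight m (fun t => 1 + √t) t x) :
    ∃ K : ℝ, ∀ t x i j, |controlForce m χ (momentMatrix u) t x i j| ≤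
      K * ((1 + √t) ^ (n + 3 + m))⁻¹ := by
  obtain ⟨X, hX, hXb⟩ := exists_controlProfile_decay hf hc m 0
  set J := ∫ z : E n, ((1 + ‖z‖) ^ (n + 1))⁻¹ with hJ
  have hJ0 : 0 ≤ J := integral_nonneg fun z => by positivity
  have hb : ∀ t : ℝ, 1 ≤ 1 + √t := fun t => le_add_of_nonneg_right (Real.sqrt_nonneg t)
  refine ⟨(multiIndicesBelow n m).card * (X * (J * C ^ 2)), fun t x i j => ?_⟩
  have hA : ∀ α ∈ multiIndicesBelow n m, |controlProfile χ α x * momentMatrix u α t i j| ≤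
      X * (J * C ^ 2) * ((1 + √t) ^ (n + 3 + m))⁻¹ := by
    intro α hα
    have hα' := (mem_multiIndicesBelow α).1 hα
    have h1 := hXb α hα x
    rw [pow_zero, div_one] at h1
    have h2 := (abs_moment_le (m := m) (sq_nonneg C) (lt_of_lt_of_le one_pos (hb t))
      ((measurable_tensorEntry hum i j).comp measurable_prodMk_left)
      (fun y => abs_tensorEntry_le hC hb hu i j t y) α (by omega)).2
    have h3 : C ^ 2 / (1 + √t) ^ (n + 2 + 2 * m - ∑ i, α i) ≤
        C ^ 2 * ((1 + √t) ^ (n + 3 + m))⁻¹ := by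
      rw [div_eq_mul_inv]
      refine mul_le_mul_of_nonneg_left ?_ (sq_nonneg C)
      exact inv_anti₀ (by positivity) (pow_le_pow_right₀ (hb t) (by omega))
    rw [abs_mul, mul_assoc, mul_assoc]
    exact mul_le_mul h1 (h2.trans (mul_le_mul_of_nonneg_left h3 hJ0)) (abs_nonneg _) hX
  have e : controlForce m χ (momentMatrix u) t x i j =
      ∑ α ∈ multiIndicesBelow n m, controlProfile χ α x * momentMatrix u α t i j := by
    rw [controlForce, Matrix.sum_apply]
    rfl
  rw [e]
  refine (Finset.abs_sum_le_sum_abs _ _).trans ((Finset.sum_le_sum hA).trans_eq ?_)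
  rw [Finset.sum_const, nsmul_eq_mul]
  ring

end

/-! ### The size conditions -/

section

variable {n m : ℕ}

theorem rpow_neg_decay {r : ℝ} (hr : 0 ≤ r) :
    r ^ (-((n : ℝ) + 1 + m)) = (r ^ (n + 1 + m))⁻¹ := by
  rw [Real.rpow_neg hr, ← Real.rpow_natCast]
  push_cast
  rfl

theorem rpow_half_eq_sqrt_pow {t : ℝ} (ht : 0 ≤ t) {p : ℝ} {k : ℕ} (h : p = k) :
    t ^ (p / 2) = √t ^ k := by
  rw [Real.sqrt_eq_rpow, ← Real.rpow_natCast, ← Real.rpow_mul ht, h]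
  congr 1
  ring

theorem rpow_neg_half_eq_sqrt_pow {t : ℝ} (ht : 0 ≤ t) {p : ℝ} {k : ℕ} (h : p = k) :
    t ^ (-p / 2) = (√t ^ k)⁻¹ := by
  rw [neg_div, Real.rpow_neg ht, rpow_half_eq_sqrt_pow ht h]

/-- A finite weighted essential supremum gives a representative bounded everywhere. -/
theorem exists_measurable_representative {u₀ : E n → E n} (hu : AEStronglyMeasurable u₀ volume)
    {M : ℝ} (hM : 0 ≤ M) (h : weightedSup m u₀ ≤ ENNReal.ofReal M) :
    ∃ v : E n → E n, Measurable v ∧ v =ᵐ[volume] u₀ ∧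
      ∀ x, ‖v x‖ ≤ M * ((1 + ‖x‖) ^ (n + 1 + m))⁻¹ := by
  obtain ⟨w, hw, hwu⟩ := hu.aemeasurable
  set S : Set (E n) := {x | ‖w x‖ ≤ M * ((1 + ‖x‖) ^ (n + 1 + m))⁻¹} with hS
  have hSm : MeasurableSet S := measurableSet_le hw.norm (by fun_prop)
  refine ⟨S.indicator w, hw.indicator hSm, ?_, fun x => ?_⟩
  · have h1 : ∀ᵐ x, ENNReal.ofReal ((1 + ‖x‖) ^ (n + 1 + m) * ‖u₀ x‖) ≤ weightedSup m u₀ :=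
      ENNReal.ae_le_essSup _
    filter_upwards [h1, hwu] with x hx hxw
    have hx' := (ENNReal.ofReal_le_ofReal_iff hM).1 (hx.trans h)
    have hxS : x ∈ S := by
      change ‖w x‖ ≤ _
      rw [← hxw, ← div_eq_mul_inv, le_div_iff₀ (by positivity), mul_comm]
      exact hx'
    rw [indicator_of_mem hxS, hxw]
  · by_cases hx : x ∈ S
    · rw [indicator_of_mem hx]; exact hx
    · rw [indicator_of_notMem hx, norm_zero]; positivity

theorem IsWeaklyDivFree.congr {v w : E n → E n} (h : IsWeaklyDivFree w) (hv : v =ᵐ[volume] w) :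
    IsWeaklyDivFree v := by
  refine ⟨h.1.congr hv.symm, fun φ hφ hc => ?_⟩
  rw [← h.2 φ hφ hc]
  exact integral_congr_ae (hv.mono fun x hx => by simp only [hx])

/-- The initial time is negligible, so that bounds at positive times suffice. -/
theorem timeSup_le {I : Set ℝ} (hI : MeasurableSet I) {u : ℝ → E n → E n} {x : E n} {c : ℝ}
    (h : ∀ t ∈ I, t ≠ 0 → ‖u t x‖ ≤ c) : timeSup I u x ≤ ENNReal.ofReal c := by
  refine essSup_le_of_ae_le _ ?_
  have h0 : ∀ᵐ t ∂(volume.restrict I), t ≠ 0 :=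
    ae_restrict_of_ae (compl_mem_ae_iff.2 (measure_singleton 0))
  filter_upwards [h0, ae_restrict_mem hI] with t ht htI
  rw [← ofReal_norm]
  exact ENNReal.ofReal_le_ofReal (h t htI ht)

theorem essSup_enorm_le {F : Type*} [NormedAddCommGroup F] {f : E n → F} {c : ℝ}
    (h : ∀ x, ‖f x‖ ≤ c) : essSup (fun x => ‖f x‖ₑ) volume ≤ ENNReal.ofReal c := by
  refine essSup_le_of_ae_le _ (Eventually.of_forall fun x => ?_)
  simp only
  rw [← ofReal_norm]
  exact ENNReal.ofReal_le_ofReal (h x)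

theorem eventually_timeSup_le {I : Set ℝ} (hI : MeasurableSet I) {u : ℝ → E n → E n} {C : ℝ}
    (hC : 0 ≤ C) (h : ∀ t x, ‖u t x‖ ≤ C * ((1 + ‖x‖) ^ (n + 1 + m))⁻¹) :
    ∀ᶠ x in Bornology.cobounded (E n),
      timeSup I u x ≤ ENNReal.ofReal (C * ‖x‖ ^ (-((n : ℝ) + 1 + m))) := by
  filter_upwards [tendsto_norm_cobounded_atTop.eventually_ge_atTop 1] with x hx
  refine timeSup_le hI fun t _ _ => (h t x).trans ?_
  rw [rpow_neg_decay (norm_nonneg x)]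
  have : 0 < ‖x‖ := by linarith
  gcongr
  linarith

/-- The moment and integrability conditions pass to a decaying representative. -/
theorem moment_conditions_of_ae_eq {u₀ v : E n → E n} (hv : Measurable v) (hvu : v =ᵐ[volume] u₀)
    {M κ : ℝ} (hκ : 0 ≤ κ) (hvM : ∀ x, ‖v x‖ ≤ M * ((1 + ‖x‖) ^ (n + 1 + m))⁻¹)
    (hI : weightedIntegral m u₀ ≤ ENNReal.ofReal κ)
    (hmom : ∀ α : Fin n → ℕ, ∑ i, α i ≤ m → ∫ x, monomialAt α x • u₀ x = 0) :
    Integrable (fun x => ‖x‖ ^ (m + 1) * ‖v x‖) ∧ ∫ x, ‖x‖ ^ (m + 1) * ‖v x‖ ≤ κ ∧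
      ∀ α : Fin n → ℕ, ∑ i, α i ≤ m → ∀ j, ∫ x, monomialAt α x * v x j = 0 := by
  have hnn : 0 ≤ᵐ[volume] fun x => ‖x‖ ^ (m + 1) * ‖v x‖ :=
    Eventually.of_forall fun x => by positivity
  have hm : Measurable fun x => ‖x‖ ^ (m + 1) * ‖v x‖ := by fun_prop
  have hl : ∫⁻ x, ENNReal.ofReal (‖x‖ ^ (m + 1) * ‖v x‖) ≤ ENNReal.ofReal κ := by
    refine (lintegral_mono_ae ?_).trans hI
    filter_upwards [hvu] with x hx
    rw [hx]
    refine ENNReal.ofReal_le_ofReal ?_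
    gcongr
    linarith
  refine ⟨⟨hm.aestronglyMeasurable, (hasFiniteIntegral_iff_ofReal hnn).2
    (hl.trans_lt ENNReal.ofReal_lt_top)⟩, ?_, fun α hα j => ?_⟩
  · rw [integral_eq_lintegral_of_nonneg_ae hnn hm.aestronglyMeasurable]
    exact ENNReal.toReal_le_of_le_ofReal hκ hl
  · have hi : Integrable fun x => monomialAt α x • v x := by
      refine ((integrable_inv_one_add_norm_pow (n := n) (e := n + 1 + m - ∑ i, α i)
        (by omega)).const_mul M).mono' (((continuous_monomialAt α).measurable.smul
          hv).aestronglyMeasurable) (Eventually.of_forall fun x => ?_)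
      rw [norm_smul]
      have h1 := norm_pow_mul_le (k := ∑ i, α i) (e := n + 1 + m - ∑ i, α i) (c := ‖v x‖)
        one_pos (by omega) (y := x) (a := M) (p := n + 1 + m)
        (by rw [abs_norm, div_eq_mul_inv]; exact hvM x)
      rw [abs_norm] at h1
      exact (mul_le_mul_of_nonneg_right (abs_monomialAt_le α x) (norm_nonneg _)).trans h1
    have h0 : ∫ x, monomialAt α x • v x = 0 := by
      rw [← hmom α hα]
      exact integral_congr_ae (hvu.mono fun x hx => by simp only [hx])
    have h2 := (EuclideanSpace.proj (𝕜 := ℝ) j).integral_comp_comm hi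
    rw [h0, map_zero] at h2
    exact h2

end

theorem theorem1 (n m : ℕ) (hn : 2 ≤ n) (a b : Fin n → ℝ) (hab : ∀ i, a i < b i) :
    ∃ χ : E n → ℝ, ContDiff ℝ ∞ χ ∧ HasCompactSupport χ ∧ tsupport χ ⊆ box a b ∧
    ∃ κ : ℝ, 0 < κ ∧
    ∀ u₀ : E n → E n, AEStronglyMeasurable u₀ volume → IsWeaklyDivFree u₀ →
    ∃ A B : (Fin n → ℕ) → ℝ → Matrix (Fin n) (Fin n) ℝ,
      -- local-in-time solutions
      (∀ T : ℝ, 0 < T →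
        ENNReal.ofReal (√T + T ^ (((m : ℝ) + 3) / 2)) * weightedSup m u₀ ≤ ENNReal.ofReal κ →
        (∃ u : ℝ → E n → E n, IsMildSolution (Icc 0 T) u₀ (controlForce m χ A) u ∧
          ∃ C : ℝ, ∀ᶠ x in Bornology.cobounded (E n),
            timeSup (Icc 0 T) u x ≤ ENNReal.ofReal (C * ‖x‖ ^ (-((n : ℝ) + 1 + m)))) ∧
        ((∀ ε : ℝ, 0 < ε → ∃ R : ℝ, ∀ᵐ x ∂(volume : Measure (E n)), R ≤ ‖x‖ →
            ‖u₀ x‖ ≤ ε * ‖x‖ ^ (-((n : ℝ) + 1 + m))) →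
          ∃ u : ℝ → E n → E n, IsMildSolution (Icc 0 T) u₀ (controlForce (m + 1) χ B) u ∧
            ∀ ε : ℝ, 0 < ε → ∀ᶠ x in Bornology.cobounded (E n),
              timeSup (Icc 0 T) u x ≤ ENNReal.ofReal (ε * ‖x‖ ^ (-((n : ℝ) + 1 + m))))) ∧
      -- global solutions
      (weightedSup m u₀ ≤ ENNReal.ofReal κ →
        weightedIntegral m u₀ ≤ ENNReal.ofReal κ →
        (∀ α : Fin n → ℕ, ∑ i, α i ≤ m → ∫ x, monomialAt α x • u₀ x = 0) →
        (∃ u : ℝ → E n → E n, IsMildSolution (Ici 0) u₀ (controlForce m χ A) u ∧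
          (∃ C : ℝ, ∀ᶠ x in Bornology.cobounded (E n),
            timeSup (Ici 0) u x ≤ ENNReal.ofReal (C * ‖x‖ ^ (-((n : ℝ) + 1 + m)))) ∧
          (∃ C : ℝ, ∀ᶠ t in atTop,
            essSup (fun x => ‖u t x‖ₑ) volume ≤
              ENNReal.ofReal (C * t ^ (-((n : ℝ) + 1 + m) / 2)))) ∧
        (∃ C : ℝ, ∀ᶠ t in atTop, ∀ i j : Fin n,
          essSup (fun x => ‖controlForce m χ A t x i j‖ₑ) volume ≤
            ENNReal.ofReal (C * t ^ (-((n : ℝ) + 3 + m) / 2)))) := by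
  have hn1 : 1 ≤ n := by omega
  obtain ⟨χ, hf, hc, hbox, hχ⟩ := exists_moment_profile m hab
  obtain ⟨κ₁, hκ₁, h₁⟩ := exists_local_solution_family (N := m) hn1 le_rfl (by omega) hf hc hχ
  obtain ⟨κ₂, hκ₂, h₂⟩ := exists_local_solution_family (m := m) (N := m + 1) hn1 (by omega) le_rfl
    hf hc hχ
  obtain ⟨κ₃, hκ₃, h₃⟩ := exists_global_solution hn hf hc hχ
  refine ⟨χ, hf, hc, hbox, min κ₁ (min κ₂ κ₃), by positivity, fun u₀ hu₀ hdiv => ?_⟩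
  set κ := min κ₁ (min κ₂ κ₃) with hκdef
  have hκ : 0 < κ := by positivity
  have hκ1 : κ ≤ κ₁ := min_le_left _ _
  have hκ2 : κ ≤ κ₂ := (min_le_right _ _).trans (min_le_left _ _)
  have hκ3 : κ ≤ κ₃ := (min_le_right _ _).trans (min_le_right _ _)
  by_cases hS : weightedSup m u₀ = ⊤
  · refine ⟨0, 0, fun T hT h => ?_, fun h => ?_⟩
    · have : 0 < √T + T ^ (((m : ℝ) + 3) / 2) := by positivity
      rw [hS, ENNReal.mul_top (ENNReal.ofReal_pos.2 this).ne', top_le_iff] at h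
      exact absurd h ENNReal.ofReal_ne_top
    · rw [hS, top_le_iff] at h
      exact absurd h ENNReal.ofReal_ne_top
  set M := (weightedSup m u₀).toReal with hM
  have hM0 : 0 ≤ M := ENNReal.toReal_nonneg
  have hSM : weightedSup m u₀ = ENNReal.ofReal M := (ENNReal.ofReal_toReal hS).symm
  obtain ⟨v, hv, hvu, hvM⟩ := exists_measurable_representative hu₀ hM0 hSM.le
  have hvdiv := hdiv.congr hvu
  have hsmall : ∀ T : ℝ, 0 < T →
      ENNReal.ofReal (√T + T ^ (((m : ℝ) + 3) / 2)) * weightedSup m u₀ ≤ ENNReal.ofReal κ →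
      (√T + √T ^ (m + 3)) * M ≤ κ := by
    intro T hT h
    rw [rpow_half_eq_sqrt_pow hT.le (k := m + 3) (by push_cast; rfl), hSM,
      ← ENNReal.ofReal_mul (by positivity)] at h
    exact (ENNReal.ofReal_le_ofReal_iff hκ.le).1 h
  obtain ⟨B, hB⟩ := h₂ M hM0 v hv hvdiv hvM
  have hlittle : ∀ T : ℝ, 0 < T →
      ENNReal.ofReal (√T + T ^ (((m : ℝ) + 3) / 2)) * weightedSup m u₀ ≤ ENNReal.ofReal κ →
      (∀ ε : ℝ, 0 < ε → ∃ R : ℝ, ∀ᵐ x ∂(volume : Measure (E n)), R ≤ ‖x‖ →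
        ‖u₀ x‖ ≤ ε * ‖x‖ ^ (-((n : ℝ) + 1 + m))) →
      ∃ u : ℝ → E n → E n, IsMildSolution (Icc 0 T) u₀ (controlForce (m + 1) χ B) u ∧
        ∀ ε : ℝ, 0 < ε → ∀ᶠ x in Bornology.cobounded (E n),
          timeSup (Icc 0 T) u x ≤ ENNReal.ofReal (ε * ‖x‖ ^ (-((n : ℝ) + 1 + m))) := by
    intro T hT h ho
    obtain ⟨u, hu, C, hC, -, hud⟩ := hB T hT ((hsmall T hT h).trans hκ2)
    refine ⟨u, hu.congr_initial hvu, fun ε hε => ?_⟩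
    have hov : ∀ ε : ℝ, 0 < ε → ∃ R : ℝ, ∀ᵐ x, R ≤ ‖x‖ →
        ‖v x‖ ≤ ε * (‖x‖ ^ (n + 1 + m))⁻¹ := by
      intro ε hε
      obtain ⟨R, hR⟩ := ho ε hε
      refine ⟨R, ?_⟩
      filter_upwards [hR, hvu] with x hx hxv
      rw [hxv, ← rpow_neg_decay (norm_nonneg x)]
      exact hx
    filter_upwards [eventually_norm_heatConv_le hv hM0 hvM hov T (half_pos hε),
      tendsto_norm_cobounded_atTop.eventually_ge_atTop 1,
      tendsto_norm_cobounded_atTop.eventually_ge_atTop (2 * C / ε)] with x hx hx1 hxC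
    have hx0 : 0 < ‖x‖ := by linarith
    refine timeSup_le measurableSet_Icc fun t ht ht0 => ?_
    have ht' : t ∈ Ioc 0 T := ⟨lt_of_le_of_ne ht.1 ht0.symm, ht.2⟩
    rw [rpow_neg_decay (norm_nonneg x)]
    have e1 : ‖u t x - heatConv t v x‖ ≤ ε / 2 * (‖x‖ ^ (n + 1 + m))⁻¹ := by
      calc _ ≤ C * ((1 + ‖x‖) ^ (n + 1 + (m + 1)))⁻¹ := hud t ht' x
        _ ≤ C * (‖x‖ ^ (n + 1 + (m + 1)))⁻¹ := by gcongr; linarith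
        _ = C / ‖x‖ * (‖x‖ ^ (n + 1 + m))⁻¹ := by
            rw [← add_assoc, pow_succ _ (n + 1 + m)]; field_simp
        _ ≤ _ := by
            refine mul_le_mul_of_nonneg_right ?_ (by positivity)
            rw [div_le_iff₀ hε] at hxC
            rw [div_le_iff₀ hx0]
            linarith
    calc ‖u t x‖ = ‖(u t x - heatConv t v x) + heatConv t v x‖ := by rw [sub_add_cancel]
      _ ≤ _ := (norm_add_le _ _).trans ((add_le_add e1 (hx t ht')).trans_eq (by ring))
  -- The family `A` has to serve both parts, so the global solution is used whenever it exists.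
  by_cases hG : weightedSup m u₀ ≤ ENNReal.ofReal κ ∧ weightedIntegral m u₀ ≤ ENNReal.ofReal κ ∧
      ∀ α : Fin n → ℕ, ∑ i, α i ≤ m → ∫ x, monomialAt α x • u₀ x = 0
  · obtain ⟨g1, g2, g3⟩ := hG
    have hMκ : M ≤ κ := by
      rw [hSM] at g1
      exact (ENNReal.ofReal_le_ofReal_iff hκ.le).1 g1
    obtain ⟨i1, i2, i3⟩ := moment_conditions_of_ae_eq hv hvu hκ.le hvM g2 g3
    obtain ⟨u, hu, hum, C, hC, hub⟩ := h₃ v hv hvdiv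
      (fun x => (hvM x).trans (by gcongr; exact hMκ.trans hκ3)) i1 (i2.trans hκ3) i3
    have hu' := hu.congr_initial hvu
    have hb : ∀ t : ℝ, 1 ≤ 1 + √t := fun t => le_add_of_nonneg_right (Real.sqrt_nonneg t)
    have hub' : ∀ t x, ‖u t x‖ ≤ C * ((1 + ‖x‖) ^ (n + 1 + m))⁻¹ := fun t x =>
      (hub t x).trans (mul_le_mul_of_nonneg_left (decayWeight_le hb t x) hC)
    refine ⟨momentMatrix u, B, fun T hT h => ⟨⟨u, hu'.mono Icc_subset_Ici_self, C,
      eventually_timeSup_le measurableSet_Icc hC hub'⟩, hlittle T hT h⟩, fun _ _ _ =>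
      ⟨⟨u, hu', ⟨C, eventually_timeSup_le measurableSet_Ici hC hub'⟩, C, ?_⟩, ?_⟩⟩
    · filter_upwards [eventually_gt_atTop 0] with t ht
      have ht0 : 0 < √t := Real.sqrt_pos.2 ht
      refine essSup_enorm_le fun x => (hub t x).trans ?_
      rw [rpow_neg_half_eq_sqrt_pow ht.le (k := n + 1 + m) (by push_cast; rfl), decayWeight]
      gcongr
      linarith [norm_nonneg x]
    · obtain ⟨K, hK⟩ := exists_abs_controlForce_le (m := m) hf hc hum hC hub
      refine ⟨|K|, ?_⟩
      filter_upwards [eventually_gt_atTop 0] with t ht i j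
      have ht0 : 0 < √t := Real.sqrt_pos.2 ht
      refine essSup_enorm_le fun x => (hK t x i j).trans ?_
      rw [rpow_neg_half_eq_sqrt_pow ht.le (k := n + 3 + m) (by push_cast; rfl)]
      gcongr
      · exact le_abs_self K
      · linarith
  · obtain ⟨A, hA⟩ := h₁ M hM0 v hv hvdiv hvM
    refine ⟨A, B, fun T hT h => ⟨?_, hlittle T hT h⟩, fun g1 g2 g3 => absurd ⟨g1, g2, g3⟩ hG⟩
    obtain ⟨u, hu, C, hC, hub, -⟩ := hA T hT ((hsmall T hT h).trans hκ1)
    exact ⟨u, hu.congr_initial hvu, C, eventually_timeSup_le measurableSet_Icc hC hub⟩
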